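/- Let $\mathcal X$ be a finite set, let $p_X$ be a probability distribution on $\mathcal X$ with $p_X(x)>0$ for all $x$, such that every $p_X(x)$ is a computable real number, and let $d:\mathcal X\times\mathcal X\to[0,\infty)$. Logarithms are in base $2$, $[\tau]=\{1,\dots,\lfloor\tau\rfloor\}$, $\mathbb R_+=(0,\infty)$, $\mathbb N=\{1,2,\dots\}$, and $d$ is extended additively: $d(x_{1:n},y_{1:n})=\frac1n\sum_{t}d(x_t,y_t)$, and the distortion of a batch of pairs of sequences is the average of the distortions of the pairs. **Codes.** An $(n,R,R_c)$ code is a pair of conditional distributions, $F^{(n)}_{M|X_{1:n},J}$ from $\mathcal X^n\times[2^{nR_c}]$ to $[2^{nR}]$ and $G^{(n)}_{Y_{1:n}|M,J}$ from $[2^{nR}]\times[2^{nR_c}]$ to $\mathcal X^n$. It induces the distribution $P^{(n)}=p_X^{\otimes n}\cdot p^{\mathcal U}_{[2^{nR_c}]}\cdot F^{(n)}_{M|X_{1:n},J}\cdot G^{(n)}_{Y_{1:n}|M,J}$ of $(X_{1:n},J,M,Y_{1:n})$, where $p^{\mathcal U}$ denotes the uniform distribution. **Critics.** A $p_X^{\otimes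 *}$-critic is a function $\delta:\bigcup_{n\in\mathbb N}\mathcal X^n\to\mathbb R$ with $\sum_{x\in\mathcal X^n}p_X^{\otimes n}(x)2^{\delta(x)}\le 1$ for every $n\in\mathbb N$. It is lower semi-computable if it is the pointwise limit of $\varphi(\cdot,k)$ as $k\to\infty$, for a computable rational-valued function $\varphi$ that is non-decreasing in $k$. A batch of $b$ sequences of length $n$ is evaluated by $\delta$ as the concatenated sequence of length $nb$. **Achievability.** Let $\{B_n\}_{n\ge1}$ be a sequence of positive integers. * $(R,R_c,\{B_n\},\Delta)$ is asymptotically achievable with *algorithmic realism* if for every $\varepsilon>0$ there is a sequence of codes, the $n$-th being an $(n,R+\varepsilon,R_c)$ code, such that, for batches $(\mathbf X^{(n,B_n)},\mathbf Y^{(n,B_n)})$ of $B_n$ i.i.d. pairs distributed according to $P^{(n)}_{X_{1:n},Y_{1:n}}$, $\limsup_{n\to\infty}\mathbb E[d(\mathbf X^{(n,B_n)},\mathbf Y^{(n,B_n)})]\le\Delta+\varepsilon$, and for every lower semi-computable $p_X^{\otimes *}$-critic $\delta$, $\sup_{n\in\mathbb N}\mathbb E[\delta(\mathbf Y^{(n,B_n)})]<\infty$.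 * $(R,R_c,\Delta)$ is asymptotically achievable with *near-perfect realism* if for every $\varepsilon>0$ there is a sequence of codes, the $n$-th being an $(n,R+\varepsilon,R_c)$ code, such that $\limsup_{n\to\infty}\mathbb E_{P^{(n)}}[d(X_{1:n},Y_{1:n})]\le\Delta+\varepsilon$ and $\|P^{(n)}_{Y_{1:n}}-p_X^{\otimes n}\|_{TV}\to0$, where $\|\cdot\|_{TV}$ denotes total variation distance. * $(R,R_c,\Delta)$ is asymptotically achievable with *perfect realism* if the same holds with the last condition replaced by: there is $N$ such that $P^{(n)}_{Y_{1:n}}=p_X^{\otimes n}$ for all $n\ge N$. **Theorem.** Let $\{B_n\}_{n\ge1}$ be a computable, increasing (not necessarily strictly) sequence of positive integers with $B_n/|\mathcal X|^n\to\infty$. Then for every $R_c\in\mathbb R_{\ge0}$ and $(R,\Delta)\in(\mathbb R_+)^2$, the following are equivalent: $(R,R_c,\{B_n\},\Delta)$ is asymptotically achievable with algorithmic realism; $(R,R_c,\Delta)$ is asymptotically achievable with near-perfect realism; $(R,R_c,\Delta)$ is asymptotically achievable with perfect realism. Moreover, the closure in $\mathbb R^3$ of the set of such achievable triplets $(R,R_c,\Delta)\in\mathbb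 R_+\times\mathbb R_{\ge0}\times\mathbb R_+$ is the set of all $(R,R_c,\Delta)\in\mathbb R^3$ with $R_c\ge0$ for which there exist a finite set $\mathcal V$ and a conditional distribution $p_{Y,V|X}$ from $\mathcal X$ to $\mathcal X\times\mathcal V$ such that, under $p_X\cdot p_{Y,V|X}$, $$p_Y=p_X,\qquad R\ge I(X;V),\qquad R+R_c\ge I(Y;V),\qquad \Delta\ge\mathbb E[d(X,Y)],$$ and $X-V-Y$ is a Markov chain. -/

import Mathlib

open Filter Topology

noncomputable section

namespace RDP

/-! ### Computability -/

/-- A map to `ℚ` is computable if it is `a ↦ ± num / den` for a computable map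
`a ↦ (sign, num, den)` with `den > 0`. -/
def ComputableRat {α : Type*} [Primcodable α] (φ : α → ℚ) : Prop :=
  ∃ f : α → Bool × ℕ × ℕ, Computable f ∧
    ∀ a, 0 < (f a).2.2 ∧
      φ a = (if (f a).1 then 1 else -1) * ((f a).2.1 : ℚ) / ((f a).2.2 : ℚ)

/-- `f` is the pointwise limit of a nondecreasing computable sequence of rational-valued maps. -/
def LowerSemicomputable {α : Type*} [Primcodable α] (f : α → ℝ) : Prop :=
  ∃ φ : α × ℕ → ℚ, ComputableRat φ ∧
    (∀ a k, φ (a, k) ≤ φ (a, k + 1)) ∧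
    ∀ a, Tendsto (fun k => (φ (a, k) : ℝ)) atTop (𝓝 (f a))

/-- A computable real-valued map. -/
def ComputableRealMap {α : Type*} [Primcodable α] (f : α → ℝ) : Prop :=
  LowerSemicomputable f ∧ LowerSemicomputable (fun a => -f a)

/-! ### Finite distributions

A distribution on a finite type `α` is an element of `stdSimplex ℝ α`. -/

/-- Expectation of `f` under the mass function `P`. -/
def expect {α : Type*} [Fintype α] (P : α → ℝ) (f : α → ℝ) : ℝ := ∑ a, P a * f a

/-- The `n`-fold product `P^{⊗ n}`. -/
def iid {α : Type*} (P : α → ℝ) (n : ℕ) : (Fin n → α) → ℝ := fun z => ∏ i, P (z i)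

/-- Total variation distance. -/
def tvDist {α : Type*} [Fintype α] (P Q : α → ℝ) : ℝ := (1 / 2) * ∑ a, |P a - Q a|

/-- Mutual information, in bits, between the two coordinates of the joint mass function `Q`.
Pairs of mass zero contribute zero. -/
def mutualInfo {α β : Type*} [Fintype α] [Fintype β] (Q : α × β → ℝ) : ℝ :=
  ∑ a, ∑ b, Q (a, b) * Real.logb 2 (Q (a, b) / ((∑ b', Q (a, b')) * (∑ a', Q (a', b))))

/-! ### Critics -/

/-- A `p^{⊗ *}`-critic. Only the values on nonempty words matter. -/
def IsCritic {X : Type*} [Fintype X] (p : X → ℝ) (δ : List X → ℝ) : Prop :=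
  ∀ n : ℕ, 1 ≤ n →
    ∑ x : Fin n → X, iid p n x * (2 : ℝ) ^ (δ (List.ofFn x)) ≤ 1

/-- The word of length `n * b` obtained by concatenating a batch of `b` words of length `n`. -/
def batchWord {X : Type*} {n b : ℕ} (y : Fin b → Fin n → X) : List X :=
  (List.ofFn fun k => List.ofFn (y k)).flatten

/-! ### Codes -/

/-- The cardinality of `[2^{nR}] = {1, …, ⌊2^{nR}⌋}`. -/
def indexCard (n : ℕ) (R : ℝ) : ℕ := ⌊(2 : ℝ) ^ ((n : ℝ) * R)⌋₊

/-- An `(n, R, Rc)` code: a privately randomized encoder `F_{M | X_{1:n}, J}` (written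
`enc x j m`) and a privately randomized decoder `G_{Y_{1:n} | M, J}` (written `dec m j y`). -/
structure Code (X : Type*) [Fintype X] (n : ℕ) (R Rc : ℝ) where
  enc : (Fin n → X) → Fin (indexCard n Rc) → Fin (indexCard n R) → ℝ
  dec : Fin (indexCard n R) → Fin (indexCard n Rc) → (Fin n → X) → ℝ
  enc_mem : ∀ x j, enc x j ∈ stdSimplex ℝ (Fin (indexCard n R))
  dec_mem : ∀ m j, dec m j ∈ stdSimplex ℝ (Fin n → X)

namespace Code

variable {X : Type*} [Fintype X] {n : ℕ} {R Rc : ℝ}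

/-- The distribution of `(X_{1:n}, J, M, Y_{1:n})` induced by the code, with `X_{1:n}` i.i.d.
according to `p` and `J` uniform and independent of `X_{1:n}`. -/
def induced (c : Code X n R Rc) (p : X → ℝ) :
    (Fin n → X) × Fin (indexCard n Rc) × Fin (indexCard n R) × (Fin n → X) → ℝ :=
  fun w => iid p n w.1 * (1 / (indexCard n Rc : ℝ)) * c.enc w.1 w.2.1 w.2.2.1 *
    c.dec w.2.2.1 w.2.1 w.2.2.2

/-- The induced distribution of `(X_{1:n}, Y_{1:n})`. -/
def inducedXY (c : Code X n R Rc) (p : X → ℝ) : (Fin n → X) × (Fin n → X) → ℝ :=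
  fun z => ∑ j, ∑ m, c.induced p (z.1, j, m, z.2)

/-- The induced distribution of the reconstruction `Y_{1:n}`. -/
def inducedY (c : Code X n R Rc) (p : X → ℝ) : (Fin n → X) → ℝ :=
  fun y => ∑ x, c.inducedXY p (x, y)

end Code

/-! ### Achievability -/

/-- Additive extension of a distortion measure to sequences of length `b`. -/
def avgDist {α : Type*} (d : α → α → ℝ) {b : ℕ} (x y : Fin b → α) : ℝ :=
  (1 / (b : ℝ)) * ∑ k, d (x k) (y k)

/-- Expected distortion of a batch of `b` i.i.d. pairs `(X_{1:n}, Y_{1:n})`. -/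
def batchDistortion {X : Type*} [Fintype X] (p : X → ℝ) (d : X → X → ℝ) {n : ℕ} {R Rc : ℝ}
    (c : Code X n R Rc) (b : ℕ) : ℝ :=
  expect (iid (c.inducedXY p) b)
    (fun z => avgDist (avgDist d) (fun k => (z k).1) (fun k => (z k).2))

/-- Expected score given by `δ` to a batch of `b` i.i.d. reconstructions. -/
def batchScore {X : Type*} [Fintype X] (p : X → ℝ) (δ : List X → ℝ) {n : ℕ} {R Rc : ℝ}
    (c : Code X n R Rc) (b : ℕ) : ℝ :=
  expect (iid (c.inducedXY p) b) (fun z => δ (batchWord fun k => (z k).2))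

/-- Expected distortion of a single pair `(X_{1:n}, Y_{1:n})`. -/
def distortion {X : Type*} [Fintype X] (p : X → ℝ) (d : X → X → ℝ) {n : ℕ} {R Rc : ℝ}
    (c : Code X n R Rc) : ℝ :=
  expect (c.inducedXY p) (fun z => avgDist d z.1 z.2)

/-- Asymptotic achievability with algorithmic realism. Block lengths are the `n ≥ 1`.
The code sequence is chosen before the critic, and the bound on the score may depend on
the critic. (The distortion sequences in this and the next definitions are bounded since the
alphabet is finite, so that `limsup` is the genuine one.) -/
def AchievableAlgorithmic {X : Type*} [Fintype X] [Primcodable X] (p : X → ℝ) (d : X → X → ℝ)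
    (R Rc : ℝ) (B : ℕ → ℕ) (Δ : ℝ) : Prop :=
  ∀ ε : ℝ, 0 < ε → ∃ c : ∀ n : ℕ, Code X n (R + ε) Rc,
    limsup (fun n => batchDistortion p d (c n) (B n)) atTop ≤ Δ + ε ∧
    ∀ δ : List X → ℝ, LowerSemicomputable δ → IsCritic p δ →
      ∃ C : ℝ, ∀ n : ℕ, 1 ≤ n → batchScore p δ (c n) (B n) ≤ C

/-- Asymptotic achievability with near-perfect realism. -/
def AchievableNearPerfect {X : Type*} [Fintype X] (p : X → ℝ) (d : X → X → ℝ)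
    (R Rc Δ : ℝ) : Prop :=
  ∀ ε : ℝ, 0 < ε → ∃ c : ∀ n : ℕ, Code X n (R + ε) Rc,
    limsup (fun n => distortion p d (c n)) atTop ≤ Δ + ε ∧
    Tendsto (fun n => tvDist ((c n).inducedY p) (iid p n)) atTop (𝓝 0)

/-- Asymptotic achievability with perfect realism. -/
def AchievablePerfect {X : Type*} [Fintype X] (p : X → ℝ) (d : X → X → ℝ)
    (R Rc Δ : ℝ) : Prop :=
  ∀ ε : ℝ, 0 < ε → ∃ c : ∀ n : ℕ, Code X n (R + ε) Rc,
    limsup (fun n => distortion p d (c n)) atTop ≤ Δ + ε ∧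
    ∃ N : ℕ, ∀ n : ℕ, N ≤ n → (c n).inducedY p = iid p n

/-! ### The single-letter region -/

/-- The joint mass function of `(X, Y, V)` when `X` has law `p` and `(Y, V)` has conditional law
`W x` given `X = x`. -/
def jointXYV {X V : Type*} (p : X → ℝ) (W : X → X × V → ℝ) (x y : X) (v : V) : ℝ :=
  p x * W x (y, v)

/-- The triplets `(R, Rc, Δ)` with `Rc ≥ 0` for which there are a finite alphabet for `V` and a
conditional distribution `W = p_{Y,V|X}` with `p_Y = p_X`, `X - V - Y` a Markov chain,
`R ≥ I(X;V)`, `R + Rc ≥ I(Y;V)` and `Δ ≥ E[d(X,Y)]`. -/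
def region {X : Type*} [Fintype X] (p : X → ℝ) (d : X → X → ℝ) : Set (ℝ × ℝ × ℝ) :=
  {t | 0 ≤ t.2.1 ∧ ∃ (s : ℕ) (W : X → X × Fin s → ℝ),
    (∀ x, W x ∈ stdSimplex ℝ (X × Fin s)) ∧
    (∀ y, ∑ x, ∑ v, jointXYV p W x y v = p y) ∧
    mutualInfo (fun a : X × Fin s => ∑ y, jointXYV p W a.1 y a.2) ≤ t.1 ∧
    mutualInfo (fun a : X × Fin s => ∑ x, jointXYV p W x a.1 a.2) ≤ t.1 + t.2.1 ∧
    ∑ x, ∑ y, ∑ v, jointXYV p W x y v * d x y ≤ t.2.2 ∧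
    ∀ x y v, jointXYV p W x y v * (∑ x', ∑ y', jointXYV p W x' y' v) =
      (∑ y', jointXYV p W x y' v) * (∑ x', jointXYV p W x' y v)}

end RDP

end

noncomputable section

namespace RDP

/-! ### Averages against a finite weight vector -/

section Weights

variable {α : Type*} [Fintype α]

/-! The three notions form a cycle: algorithmic, near-perfect, perfect, algorithmic. The region then
follows from a converse for perfect realism and a coding theorem for near-perfect realism.

Perfect to algorithmic is Jensen's inequality: under the source law the mean of `δ` is at most the
logarithm of the mean of `2 ^ δ`, hence nonpositive (`score_le_zero`). Near-perfect to perfect lets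
the decoder move its output along a maximal coupling with the source law, which costs no rate and a
vanishing distortion (`exists_coupling_kernel`).

Algorithmic to near-perfect needs one critic that works against every code. A code with total
variation bounded away from zero favours some event of words of length `n`, and a large batch
reveals this in its empirical frequencies. The event depends on the code, but since `B n` dominates
the number of words, the empirical law of true samples is close to the source law in `ℓ¹`, that is,
uniformly over events. The critic may thus search all events for one that is too frequent and pay
for its score with the mean `ℓ¹` deviation. A successful search has a finite certificate, so the
score is lower semicomputable (`exists_empirical_critic`).

For the region, a point is a mixture of product laws `q v ⊗ r v`, and all constraints are averages
over `v`. The region is therefore described by the convex hull of a compact set in finite dimension,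
and is closed (`isClosed_region`). Conversely, a perfect code is such a mixture with `V = (J, M,
T)`, `T` a uniform time index; both information bounds come from one Jensen estimate
(`sum_relEnt_marginal_le`). Directly, a random codebook drawn from the law of `V` covers the source
law for each `j` when `R` exceeds `I(X;V)`, and covers the reconstruction law as a whole when `R +
Rc` exceeds `I(Y;V)` (`iid_soft_covering`). The encoder that samples the message from its posterior
then gives the code (`exists_likelihood_code`). -/

theorem sq_sum_weight_le {w : α → ℝ} (hw : w ∈ stdSimplex ℝ α) (z : α → ℝ) (hz : ∀ a, 0 ≤ z a) :
    ∑ a, w a * z a ≤ √(∑ a, w a * z a ^ 2) :=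
  Real.le_sqrt_of_sq_le
    (Real.pow_arith_mean_le_arith_mean_pow Finset.univ w z (fun a _ => hw.1 a) hw.2
      (fun a _ => hz a) 2)

theorem exists_le_of_sum_weight_le {w : α → ℝ} (hw : w ∈ stdSimplex ℝ α) (F : α → ℝ) {b : ℝ}
    (h : ∑ a, w a * F a ≤ b) : ∃ a, F a ≤ b := by
  by_contra! hF
  have h1 : ∑ a, w a * b < ∑ a, w a * F a := by
    obtain ⟨a, ha⟩ : ∃ a, 0 < w a := by
      by_contra! h0
      have : ∑ a, w a ≤ 0 := Finset.sum_nonpos fun a _ => h0 a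
      linarith [hw.2]
    exact Finset.sum_lt_sum (fun a _ => mul_le_mul_of_nonneg_left (hF a).le (hw.1 a))
      ⟨a, Finset.mem_univ _, mul_lt_mul_of_pos_left (hF a) ha⟩
  rw [← Finset.sum_mul, hw.2, one_mul] at h1
  linarith

/-- Jensen's inequality for the logarithm in base `2`, terms of weight zero being ignored. -/
theorem sum_weight_logb_le {w : α → ℝ} (hw : w ∈ stdSimplex ℝ α) (z : α → ℝ)
    (hz : ∀ a, 0 < w a → 0 < z a) {b : ℝ} (hb : ∑ a, w a * z a ≤ b) :
    ∑ a, w a * Real.logb 2 (z a) ≤ Real.logb 2 b := by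
  have hterm : ∀ a, 0 ≤ w a * z a := fun a => by
    rcases (hw.1 a).eq_or_lt with h | h
    · simp [← h]
    · exact (mul_pos h (hz a h)).le
  obtain ⟨a₀, ha₀⟩ : ∃ a, 0 < w a := by
    by_contra! h0
    have : ∑ a, w a ≤ 0 := Finset.sum_nonpos fun a _ => h0 a
    linarith [hw.2]
  have hs : 0 < ∑ a, w a * z a :=
    Finset.sum_pos' (fun a _ => hterm a) ⟨a₀, Finset.mem_univ _, mul_pos ha₀ (hz a₀ ha₀)⟩
  have hb0 : 0 < b := hs.trans_le hb
  have hlog2 : 0 < Real.log 2 := Real.log_pos one_lt_two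
  -- The tangent bound `log u ≤ u - 1` at `u = z a / b`. After averaging, the correction is
  -- nonpositive because the mean of `z` is at most `b`.
  have key : ∀ a, w a * Real.logb 2 (z a) ≤
      w a * Real.logb 2 b + (w a * z a / b - w a) / Real.log 2 := by
    intro a
    rcases (hw.1 a).eq_or_lt with h | h
    · simp [← h]
    · have h1 := Real.log_le_sub_one_of_pos (div_pos (hz a h) hb0)
      rw [Real.log_div (hz a h).ne' hb0.ne'] at h1
      rw [Real.logb, Real.logb, ← sub_nonneg]
      have : w a * (Real.log b / Real.log 2) + (w a * z a / b - w a) / Real.log 2 -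
          w a * (Real.log (z a) / Real.log 2) =
          w a * ((z a / b - 1) - (Real.log (z a) - Real.log b)) / Real.log 2 := by
        field_simp
        ring
      rw [this]
      exact div_nonneg (mul_nonneg h.le (by linarith)) hlog2.le
  calc ∑ a, w a * Real.logb 2 (z a)
      ≤ ∑ a, (w a * Real.logb 2 b + (w a * z a / b - w a) / Real.log 2) :=
        Finset.sum_le_sum fun a _ => key a
    _ = Real.logb 2 b + ((∑ a, w a * z a) / b - 1) / Real.log 2 := by
        rw [Finset.sum_add_distrib, ← Finset.sum_mul, ← Finset.sum_div, Finset.sum_sub_distrib,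
          ← Finset.sum_div, hw.2, one_mul]
    _ ≤ Real.logb 2 b := by
        have : (∑ a, w a * z a) / b ≤ 1 := (div_le_one hb0).2 hb
        have : ((∑ a, w a * z a) / b - 1) / Real.log 2 ≤ 0 :=
          div_nonpos_of_nonpos_of_nonneg (by linarith) hlog2.le
        linarith

end Weights

/-! ### Finite product distributions -/

section Product

variable {ι α : Type*} [Fintype ι] [DecidableEq ι] [Fintype α]

/-- The form in which independence is used below: changing single factors `h i` yields total masses,
marginals and mixed moments of product laws. -/
theorem sum_pi_prod (h : ι → α → ℝ) :
    ∑ c : ι → α, ∏ i, h i (c i) = ∏ i, ∑ a, h i a := by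
  rw [Finset.prod_univ_sum, Fintype.piFinset_univ]

theorem prod_weight_nonneg {ι α : Type*} [Fintype ι] {w : α → ℝ} (hw : ∀ a, 0 ≤ w a)
    (c : ι → α) : 0 ≤ ∏ i, w (c i) :=
  Finset.prod_nonneg fun _ _ => hw _

theorem sum_prod_weight {w : α → ℝ} (hw : ∑ a, w a = 1) : ∑ c : ι → α, ∏ i, w (c i) = 1 := by
  rw [sum_pi_prod (fun _ => w)]
  simp [hw]

theorem sum_prod_weight_pair {w : α → ℝ} (hw : ∑ a, w a = 1) (f g : α → ℝ) {i j : ι}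
    (hij : i ≠ j) :
    ∑ c : ι → α, (∏ k, w (c k)) * (f (c i) * g (c j)) = (∑ a, w a * f a) * ∑ a, w a * g a := by
  have h := sum_pi_prod (fun (k : ι) (a : α) =>
    w a * ((if k = i then f a else 1) * (if k = j then g a else 1)))
  have h1 : ∀ c : ι → α, ∏ k, (w (c k) * ((if k = i then f (c k) else 1) *
      (if k = j then g (c k) else 1))) = (∏ k, w (c k)) * (f (c i) * g (c j)) := by
    intro c
    rw [Finset.prod_mul_distrib, Finset.prod_mul_distrib]
    simp
  have h2 : ∀ k, (∑ a, w a * ((if k = i then f a else 1) * (if k = j then g a else 1))) =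
      (if k = i then ∑ a, w a * f a else 1) * (if k = j then ∑ a, w a * g a else 1) := by
    intro k
    by_cases hi : k = i
    · subst hi; simp [hij]
    · by_cases hj : k = j
      · subst hj; simp [hi]
      · simp [hi, hj, hw]
  rw [Finset.sum_congr rfl (fun c _ => h1 c)] at h
  rw [h, Finset.prod_congr rfl (fun k _ => h2 k), Finset.prod_mul_distrib]
  simp

theorem sum_prod_weight_single {w : α → ℝ} (hw : ∑ a, w a = 1) (f : α → ℝ) (i : ι) :
    ∑ c : ι → α, (∏ k, w (c k)) * f (c i) = ∑ a, w a * f a := by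
  have h := sum_pi_prod (fun (k : ι) (a : α) => w a * (if k = i then f a else 1))
  have h1 : ∀ c : ι → α, ∏ k, (w (c k) * (if k = i then f (c k) else 1)) =
      (∏ k, w (c k)) * f (c i) := by
    intro c
    rw [Finset.prod_mul_distrib]
    simp
  have h2 : ∀ k, (∑ a, w a * (if k = i then f a else 1)) =
      (if k = i then ∑ a, w a * f a else 1) := by
    intro k
    by_cases hi : k = i
    · subst hi; simp
    · simp [hi, hw]
  rw [Finset.sum_congr rfl (fun c _ => h1 c)] at h
  rw [h, Finset.prod_congr rfl (fun k _ => h2 k)]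
  simp

theorem sum_prod_weight_sum {w : α → ℝ} (hw : ∑ a, w a = 1) (f : α → ℝ) (s : Finset ι) :
    ∑ c : ι → α, (∏ k, w (c k)) * ∑ i ∈ s, f (c i) = s.card * ∑ a, w a * f a := by
  simp_rw [Finset.mul_sum]
  rw [Finset.sum_comm]
  rw [Finset.sum_congr rfl (fun i _ => sum_prod_weight_single hw f i)]
  simp [Finset.mul_sum]

/-- The variables `g (c i)` are centred and independent, so the off-diagonal terms of the expanded
square vanish. -/
theorem sum_prod_weight_sq {w : α → ℝ} (hw : ∑ a, w a = 1) (g : α → ℝ)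
    (hg : ∑ a, w a * g a = 0) (s : Finset ι) :
    ∑ c : ι → α, (∏ k, w (c k)) * (∑ i ∈ s, g (c i)) ^ 2 = s.card * ∑ a, w a * g a ^ 2 := by
  have h1 : ∀ c : ι → α, (∏ k, w (c k)) * (∑ i ∈ s, g (c i)) ^ 2 =
      ∑ i ∈ s, ∑ j ∈ s, (∏ k, w (c k)) * (g (c i) * g (c j)) := by
    intro c
    rw [sq, Finset.sum_mul_sum, Finset.mul_sum]
    exact Finset.sum_congr rfl fun i _ => Finset.mul_sum _ _ _
  rw [Finset.sum_congr rfl (fun c _ => h1 c), Finset.sum_comm]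
  have h2 : ∀ i ∈ s, ∑ c : ι → α, ∑ j ∈ s, (∏ k, w (c k)) * (g (c i) * g (c j)) =
      ∑ a, w a * g a ^ 2 := by
    intro i hi
    rw [Finset.sum_comm, Finset.sum_eq_single_of_mem i hi]
    · have := sum_prod_weight_single hw (fun a => g a ^ 2) i
      rw [← this]
      exact Finset.sum_congr rfl fun c _ => by rw [sq]
    · intro j _ hj
      rw [sum_prod_weight_pair hw g g (Ne.symm hj), hg, zero_mul]
  rw [Finset.sum_congr rfl h2]
  simp

theorem prod_weight_mem {w : α → ℝ} (hw : w ∈ stdSimplex ℝ α) :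
    (fun c : ι → α => ∏ i, w (c i)) ∈ stdSimplex ℝ (ι → α) :=
  ⟨prod_weight_nonneg hw.1, sum_prod_weight hw.2⟩

/-- Mean absolute deviation of an empirical average over the indices in `s`. -/
theorem mean_abs_dev_le {w : α → ℝ} (hw : w ∈ stdSimplex ℝ α) (f : α → ℝ) {s : Finset ι}
    (hs : s.Nonempty) :
    ∑ c : ι → α, (∏ k, w (c k)) *
        |(1 / (s.card : ℝ)) * ∑ i ∈ s, f (c i) - ∑ a, w a * f a| ≤
      √((∑ a, w a * f a ^ 2) / s.card) := by
  have hcard : (0 : ℝ) < s.card := by exact_mod_cast hs.card_pos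
  set μ := ∑ a, w a * f a with hμ
  have hg : ∑ a, w a * (f a - μ) = 0 := by
    simp_rw [mul_sub]
    rw [Finset.sum_sub_distrib, ← Finset.sum_mul, hw.2, one_mul, sub_self]
  refine (sq_sum_weight_le (prod_weight_mem hw) _ fun c => abs_nonneg _).trans ?_
  apply Real.sqrt_le_sqrt
  have h1 : ∀ c : ι → α, (∏ k, w (c k)) *
      |(1 / (s.card : ℝ)) * ∑ i ∈ s, f (c i) - μ| ^ 2 =
      (1 / (s.card : ℝ)) ^ 2 * ((∏ k, w (c k)) * (∑ i ∈ s, (f (c i) - μ)) ^ 2) := by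
    intro c
    rw [sq_abs, Finset.sum_sub_distrib, Finset.sum_const, nsmul_eq_mul]
    field_simp
  rw [Finset.sum_congr rfl (fun c _ => h1 c), ← Finset.mul_sum,
    sum_prod_weight_sq hw.2 (fun a => f a - μ) hg]
  -- The variance is at most the second moment.
  have h2 : ∑ a, w a * (f a - μ) ^ 2 ≤ ∑ a, w a * f a ^ 2 := by
    have h3 : ∀ a, w a * (f a - μ) ^ 2 = w a * f a ^ 2 - 2 * μ * (w a * f a) + μ ^ 2 * w a := by
      intro a; ring
    rw [Finset.sum_congr rfl (fun a _ => h3 a), Finset.sum_add_distrib, Finset.sum_sub_distrib,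
      ← Finset.mul_sum, ← Finset.mul_sum, hw.2, ← hμ]
    nlinarith [sq_nonneg μ]
  rw [show (1 / (s.card : ℝ)) ^ 2 * (s.card * ∑ a, w a * (f a - μ) ^ 2) =
    (∑ a, w a * (f a - μ) ^ 2) / s.card by field_simp]
  gcongr

/-- Markov's inequality for the deviation of an empirical average over all indices. -/
theorem prob_dev_le {w : α → ℝ} (hw : w ∈ stdSimplex ℝ α) (f : α → ℝ) [Nonempty ι]
    {γ : ℝ} (hγ : 0 < γ) (A : (ι → α) → Prop) [DecidablePred A]
    (hA : ∀ c, A c →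
      γ ≤ |(1 / (Fintype.card ι : ℝ)) * ∑ i, f (c i) - ∑ a, w a * f a|) :
    ∑ c : ι → α, (∏ k, w (c k)) * (if A c then 1 else 0) ≤
      √((∑ a, w a * f a ^ 2) / Fintype.card ι) / γ := by
  rw [le_div_iff₀ hγ]
  refine le_trans ?_ (mean_abs_dev_le hw f (s := (Finset.univ : Finset ι)) Finset.univ_nonempty)
  rw [Finset.sum_mul]
  refine Finset.sum_le_sum fun c _ => ?_
  rw [mul_assoc]
  refine mul_le_mul_of_nonneg_left ?_ (prod_weight_nonneg hw.1 c)
  split_ifs with h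
  · simpa using hA c h
  · simp

end Product

theorem iid_mem {α : Type*} [Fintype α] {p : α → ℝ} (hp : p ∈ stdSimplex ℝ α) (n : ℕ) :
    iid p n ∈ stdSimplex ℝ (Fin n → α) :=
  prod_weight_mem hp

/-! ### Elementary properties of codes -/

theorem indexCard_pos (n : ℕ) {R : ℝ} (hR : 0 ≤ R) : 0 < indexCard n R :=
  Nat.floor_pos.2 (Real.one_le_rpow one_le_two (by positivity))

theorem avgDist_nonneg {α : Type*} {d : α → α → ℝ} (hd : ∀ x y, 0 ≤ d x y) {b : ℕ}
    (x y : Fin b → α) : 0 ≤ avgDist d x y :=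
  mul_nonneg (by positivity) (Finset.sum_nonneg fun _ _ => hd _ _)

theorem avgDist_le {α : Type*} {d : α → α → ℝ} {D : ℝ} (hD : 0 ≤ D) (hd : ∀ x y, d x y ≤ D) {b : ℕ}
    (x y : Fin b → α) : avgDist d x y ≤ D := by
  rw [avgDist]
  rcases Nat.eq_zero_or_pos b with rfl | hb
  · simpa using hD
  · have hb' : (0 : ℝ) < b := by exact_mod_cast hb
    have : ∑ k, d (x k) (y k) ≤ b * D := by
      refine (Finset.sum_le_sum fun k _ => hd (x k) (y k)).trans ?_
      simp
    calc 1 / (b : ℝ) * ∑ k, d (x k) (y k) ≤ 1 / (b : ℝ) * (b * D) := by gcongr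
      _ = D := by field_simp

theorem exists_dist_bound {X : Type*} [Fintype X] (d : X → X → ℝ) :
    ∃ D : ℝ, 0 ≤ D ∧ ∀ x y, d x y ≤ D := by
  refine ⟨∑ x, ∑ y, |d x y|, by positivity, fun x y => ?_⟩
  calc d x y ≤ |d x y| := le_abs_self _
    _ ≤ ∑ y, |d x y| :=
      Finset.single_le_sum (f := fun y => |d x y|) (fun _ _ => abs_nonneg _) (Finset.mem_univ y)
    _ ≤ ∑ x, ∑ y, |d x y| :=
      Finset.single_le_sum (f := fun x => ∑ y, |d x y|)
        (fun _ _ => Finset.sum_nonneg fun _ _ => abs_nonneg _) (Finset.mem_univ x)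

namespace Code

variable {X : Type*} [Fintype X] {n : ℕ} {R Rc : ℝ}

theorem induced_nonneg (c : Code X n R Rc) {p : X → ℝ} (hp : p ∈ stdSimplex ℝ X) (w) :
    0 ≤ c.induced p w := by
  have h1 := (iid_mem hp n).1 w.1
  have h2 := (c.enc_mem w.1 w.2.1).1 w.2.2.1
  have h3 := (c.dec_mem w.2.2.1 w.2.1).1 w.2.2.2
  unfold induced
  positivity

theorem inducedXY_mem (c : Code X n R Rc) {p : X → ℝ} (hp : p ∈ stdSimplex ℝ X) (hRc : 0 ≤ Rc) :
    c.inducedXY p ∈ stdSimplex ℝ ((Fin n → X) × (Fin n → X)) := by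
  refine ⟨fun z => Finset.sum_nonneg fun j _ => Finset.sum_nonneg fun m _ =>
    c.induced_nonneg hp _, ?_⟩
  have hJ : (indexCard n Rc : ℝ) ≠ 0 := by exact_mod_cast (indexCard_pos n hRc).ne'
  rw [Fintype.sum_prod_type]
  have key : ∀ x, ∑ y, c.inducedXY p (x, y) = iid p n x := by
    intro x
    simp only [inducedXY, induced]
    rw [Finset.sum_comm]
    have : ∀ j, ∑ y, ∑ m, iid p n x * (1 / (indexCard n Rc : ℝ)) * c.enc x j m * c.dec m j y =
        iid p n x * (1 / (indexCard n Rc : ℝ)) := by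
      intro j
      rw [Finset.sum_comm]
      simp_rw [← Finset.mul_sum]
      simp_rw [(c.dec_mem _ _).2, mul_one, ← Finset.mul_sum, (c.enc_mem _ _).2, mul_one]
    rw [Finset.sum_congr rfl fun j _ => this j]
    simp only [Finset.sum_const, Finset.card_univ, Fintype.card_fin, nsmul_eq_mul]
    field_simp
  rw [Finset.sum_congr rfl fun x _ => key x, (iid_mem hp n).2]

theorem inducedY_mem (c : Code X n R Rc) {p : X → ℝ} (hp : p ∈ stdSimplex ℝ X) (hRc : 0 ≤ Rc) :
    c.inducedY p ∈ stdSimplex ℝ (Fin n → X) := by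
  have h := c.inducedXY_mem hp hRc
  refine ⟨fun y => Finset.sum_nonneg fun x _ => h.1 _, ?_⟩
  rw [← h.2, Fintype.sum_prod_type, Finset.sum_comm]
  rfl

end Code

/-! ### Distortion and score of batches -/

section Distortion

variable {X : Type*} [Fintype X] {n : ℕ} {R Rc : ℝ}

theorem distortion_nonneg (c : Code X n R Rc) {p : X → ℝ} (hp : p ∈ stdSimplex ℝ X)
    (hRc : 0 ≤ Rc) {d : X → X → ℝ} (hd : ∀ x y, 0 ≤ d x y) : 0 ≤ distortion p d c :=
  Finset.sum_nonneg fun z _ => mul_nonneg ((c.inducedXY_mem hp hRc).1 z) (avgDist_nonneg hd _ _)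

theorem distortion_le (c : Code X n R Rc) {p : X → ℝ} (hp : p ∈ stdSimplex ℝ X)
    (hRc : 0 ≤ Rc) {d : X → X → ℝ} {D : ℝ} (hD : 0 ≤ D) (hd : ∀ x y, d x y ≤ D) :
    distortion p d c ≤ D := by
  have h := c.inducedXY_mem hp hRc
  calc distortion p d c ≤ ∑ z, c.inducedXY p z * D :=
        Finset.sum_le_sum fun z _ => mul_le_mul_of_nonneg_left (avgDist_le hD hd _ _) (h.1 z)
    _ = D := by rw [← Finset.sum_mul, h.2, one_mul]

/-- Linearity of expectation. Hence the batch size matters for realism only. Positivity of `b`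
excludes the empty batch, on which `avgDist` is `0`. -/
theorem batchDistortion_eq (c : Code X n R Rc) {p : X → ℝ} (hp : p ∈ stdSimplex ℝ X)
    (hRc : 0 ≤ Rc) (d : X → X → ℝ) {b : ℕ} (hb : 0 < b) :
    batchDistortion p d c b = distortion p d c := by
  have hb' : (b : ℝ) ≠ 0 := by exact_mod_cast hb.ne'
  have h := sum_prod_weight_sum (ι := Fin b) (c.inducedXY_mem hp hRc).2
    (fun z => avgDist d z.1 z.2) Finset.univ
  have h2 : batchDistortion p d c b = (1 / (b : ℝ)) *
      ∑ z : Fin b → (Fin n → X) × (Fin n → X), (∏ k, c.inducedXY p (z k)) *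
        ∑ i, avgDist d (z i).1 (z i).2 := by
    unfold batchDistortion expect iid
    rw [Finset.mul_sum]
    refine Finset.sum_congr rfl fun z _ => ?_
    change (∏ k, c.inducedXY p (z k)) * (1 / (b : ℝ) * ∑ i, avgDist d (z i).1 (z i).2) = _
    ring
  rw [h2, h, distortion, expect, Finset.card_univ, Fintype.card_fin]
  field_simp

theorem batchScore_eq (c : Code X n R Rc) (p : X → ℝ) (δ : List X → ℝ) (b : ℕ) :
    batchScore p δ c b =
      ∑ y : Fin b → Fin n → X, iid (c.inducedY p) b y * δ (batchWord y) := by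
  unfold batchScore expect
  rw [← (Equiv.arrowProdEquivProdArrow (Fin b) (fun _ => Fin n → X)
    (fun _ => Fin n → X)).symm.sum_comp, Fintype.sum_prod_type, Finset.sum_comm]
  refine Finset.sum_congr rfl fun y _ => ?_
  have h : iid (c.inducedY p) b y =
      ∑ x : Fin b → Fin n → X, ∏ k, c.inducedXY p (x k, y k) := by
    rw [sum_pi_prod (fun (k : Fin b) x => c.inducedXY p (x, y k))]
    rfl
  rw [h, Finset.sum_mul]
  rfl

/-- The words of length `b * n` are the batches of `b` words of length `n`. -/
theorem sum_batch (p : X → ℝ) (n b : ℕ) (F : List X → ℝ) :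
    ∑ x : Fin (b * n) → X, iid p (b * n) x * F (List.ofFn x) =
      ∑ y : Fin b → Fin n → X, iid (iid p n) b y * F (batchWord y) := by
  let e : (Fin (b * n) → X) ≃ (Fin b → Fin n → X) :=
    (Equiv.arrowCongr finProdFinEquiv.symm (Equiv.refl X)).trans (Equiv.curry _ _ _)
  have he : ∀ x i j, e x i j = x (finProdFinEquiv (i, j)) := fun x i j => rfl
  refine Fintype.sum_equiv e _ _ fun x => ?_
  have h1 : List.ofFn x = batchWord (e x) := by
    rw [List.ofFn_mul, batchWord]
    congr 2
    funext i
    congr 1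
    funext j
    rw [he]
    congr 1
    ext
    simp [finProdFinEquiv, mul_comm, add_comm]
  have h2 : iid p (b * n) x = iid (iid p n) b (e x) := by
    unfold iid
    simp_rw [he]
    rw [← finProdFinEquiv.prod_comp, Fintype.prod_prod_type]
  rw [h1, h2]

end Distortion

/-! ### Eventual bounds and upper limits -/

section Limsup

theorem limsup_le_of_forall_pos {u : ℕ → ℝ} {a : ℝ} (h0 : ∀ n, 0 ≤ u n)
    (h : ∀ e, 0 < e → ∀ᶠ n in atTop, u n ≤ a + e) : limsup u atTop ≤ a :=
  le_of_forall_pos_le_add fun e he =>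
    limsup_le_of_le (isCoboundedUnder_le_of_le atTop h0) (h e he)

/-- The bound `D` is needed because the real `limsup` of a sequence unbounded above carries no
information. -/
theorem eventually_le_of_limsup_le {u : ℕ → ℝ} {a D : ℝ} (hD : ∀ n, u n ≤ D)
    (h : limsup u atTop ≤ a) {e : ℝ} (he : 0 < e) : ∀ᶠ n in atTop, u n ≤ a + e :=
  (eventually_lt_of_limsup_lt (lt_of_le_of_lt h (by linarith))
    (isBoundedUnder_of ⟨D, hD⟩)).mono fun _ hn => hn.le

end Limsup

/-! ### Optimal coupling, and the equivalence of near-perfect and perfect realism -/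

theorem tvDist_eq_sum_sub_min {α : Type*} [Fintype α] {P Q : α → ℝ} (hP : P ∈ stdSimplex ℝ α)
    (hQ : Q ∈ stdSimplex ℝ α) : tvDist P Q = ∑ a, (P a - min (P a) (Q a)) := by
  have h : ∀ a, P a - min (P a) (Q a) = 1 / 2 * |P a - Q a| + 1 / 2 * (P a - Q a) := by
    intro a
    rcases le_total (P a) (Q a) with h | h
    · rw [min_eq_left h, abs_of_nonpos (by linarith)]; ring
    · rw [min_eq_right h, abs_of_nonneg (by linarith)]; ring
  rw [Finset.sum_congr rfl fun a _ => h a, Finset.sum_add_distrib, ← Finset.mul_sum,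
    ← Finset.mul_sum, Finset.sum_sub_distrib, hP.2, hQ.2, tvDist]
  ring

theorem tvDist_comm {α : Type*} [Fintype α] (P Q : α → ℝ) : tvDist P Q = tvDist Q P := by
  simp only [tvDist, abs_sub_comm]

theorem tvDist_nonneg {α : Type*} [Fintype α] (P Q : α → ℝ) : 0 ≤ tvDist P Q := by
  unfold tvDist; positivity

/-- The maximal coupling as a kernel: the mass common to `P` and `Q` stays put, and only the excess
of `P`, of total mass `tvDist P Q`, is redistributed. -/
theorem exists_coupling_kernel {α : Type*} [Fintype α] {P Q : α → ℝ} (hP : P ∈ stdSimplex ℝ α)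
    (hQ : Q ∈ stdSimplex ℝ α) :
    ∃ T : α → α → ℝ, (∀ a, T a ∈ stdSimplex ℝ α) ∧ (∀ b, ∑ a, P a * T a b = Q b) ∧
      ∑ a, P a * (1 - T a a) ≤ tvDist P Q := by
  classical
  set m : α → ℝ := fun a => min (P a) (Q a) with hm
  set τ := tvDist P Q with hτ
  have hτP : ∑ a, (P a - m a) = τ := (tvDist_eq_sum_sub_min hP hQ).symm
  have hτQ : ∑ a, (Q a - m a) = τ := by
    rw [hτ, tvDist_comm, tvDist_eq_sum_sub_min hQ hP]
    simp [hm, min_comm]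
  have hm0 : ∀ a, 0 ≤ m a := fun a => le_min (hP.1 a) (hQ.1 a)
  -- The excess is normalised by `τ` below, so equal laws are treated apart, with the identity
  -- kernel.
  rcases (tvDist_nonneg P Q).eq_or_lt with h0 | hpos
  · have hPQ : ∀ a, P a = Q a := by
      intro a
      have h1 : ∑ a, |P a - Q a| = 0 := by
        have := h0.symm; unfold tvDist at this; linarith
      have := (Finset.sum_eq_zero_iff_of_nonneg fun a _ => abs_nonneg (P a - Q a)).1 h1 a
        (Finset.mem_univ a)
      linarith [abs_eq_zero.1 this]
    refine ⟨fun a => Pi.single a 1, fun a => ⟨fun b => ?_, by simp⟩, fun b => ?_, ?_⟩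
    · simp only [Pi.single_apply]; split_ifs <;> simp
    · simp [Pi.single_apply, hPQ]
    · simp [tvDist_nonneg P Q, hτ]
  · rw [← hτ] at hpos
    have hdiv : ∀ a, P a * (m a / P a) = m a := by
      intro a
      rcases (hP.1 a).eq_or_lt with h | h
      · have : m a = 0 := le_antisymm ((min_le_left _ _).trans h.ge) (hm0 a)
        rw [← h, this]; simp
      · field_simp
    have hle1 : ∀ a, m a / P a ≤ 1 := fun a => div_le_one_of_le₀ (min_le_left _ _) (hP.1 a)
    have hrest : ∀ b, 0 ≤ (Q b - m b) / τ := fun b =>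
      div_nonneg (sub_nonneg.2 (min_le_right _ _)) hpos.le
    have hge : ∀ a, 0 ≤ m a / P a := fun a => div_nonneg (hm0 a) (hP.1 a)
    -- From `a`, stay with probability `m a / P a`; otherwise draw from the normalised excess of
    -- `Q`. The convention `0 / 0 = 0` covers `P a = 0`.
    refine ⟨fun a b => (if a = b then m a / P a else 0) + (1 - m a / P a) * ((Q b - m b) / τ),
      fun a => ⟨fun b => ?_, ?_⟩, fun b => ?_, ?_⟩
    · refine add_nonneg ?_ (mul_nonneg (by linarith [hle1 a]) (hrest b))
      split_ifs
      · exact hge a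
      · exact le_rfl
    · rw [Finset.sum_add_distrib, ← Finset.mul_sum, ← Finset.sum_div, hτQ]
      simp [hpos.ne']
    · have h1 : ∀ a, P a * ((if a = b then m a / P a else 0) +
          (1 - m a / P a) * ((Q b - m b) / τ)) =
          (if a = b then m a else 0) + (P a - m a) * ((Q b - m b) / τ) := by
        intro a
        rw [mul_add, mul_ite, hdiv, mul_zero, ← mul_assoc, mul_sub, hdiv, mul_one]
      rw [Finset.sum_congr rfl fun a _ => h1 a, Finset.sum_add_distrib, ← Finset.sum_mul, hτP]
      simp only [Finset.sum_ite_eq', Finset.mem_univ, if_true]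
      field_simp
      ring
    · refine le_of_le_of_eq (Finset.sum_le_sum fun a _ => ?_) hτP
      have h2 : P a - m a = P a * (1 - m a / P a) := by rw [mul_sub, hdiv, mul_one]
      rw [h2]
      refine mul_le_mul_of_nonneg_left ?_ (hP.1 a)
      have := mul_nonneg (sub_nonneg.2 (hle1 a)) (hrest a)
      simp only [if_true]
      linarith

/-- Post-processing of the reconstruction by a kernel. -/
def Code.postprocess {X : Type*} [Fintype X] {n : ℕ} {R Rc : ℝ} (c : Code X n R Rc)
    (T : (Fin n → X) → (Fin n → X) → ℝ) (hT : ∀ y, T y ∈ stdSimplex ℝ (Fin n → X)) :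
    Code X n R Rc where
  enc := c.enc
  dec := fun m j y' => ∑ y, c.dec m j y * T y y'
  enc_mem := c.enc_mem
  dec_mem := fun m j => by
    refine ⟨fun y' => Finset.sum_nonneg fun y _ =>
      mul_nonneg ((c.dec_mem m j).1 y) ((hT y).1 y'), ?_⟩
    rw [Finset.sum_comm]
    simp_rw [← Finset.mul_sum, (hT _).2, mul_one]
    exact (c.dec_mem m j).2

section Postprocess

variable {X : Type*} [Fintype X] {n : ℕ} {R Rc : ℝ}

theorem Code.postprocess_inducedXY (c : Code X n R Rc)
    {T : (Fin n → X) → (Fin n → X) → ℝ} (hT : ∀ y, T y ∈ stdSimplex ℝ (Fin n → X))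
    (p : X → ℝ) (x y' : Fin n → X) :
    (c.postprocess T hT).inducedXY p (x, y') = ∑ y, c.inducedXY p (x, y) * T y y' := by
  simp only [Code.inducedXY, Code.induced, Code.postprocess, Finset.sum_mul, Finset.mul_sum]
  conv_rhs => rw [Finset.sum_comm]
  refine Finset.sum_congr rfl fun j _ => ?_
  conv_rhs => rw [Finset.sum_comm]
  simp only [mul_assoc]

theorem Code.postprocess_inducedY (c : Code X n R Rc)
    {T : (Fin n → X) → (Fin n → X) → ℝ} (hT : ∀ y, T y ∈ stdSimplex ℝ (Fin n → X))
    (p : X → ℝ) (y' : Fin n → X) :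
    (c.postprocess T hT).inducedY p y' = ∑ y, c.inducedY p y * T y y' := by
  simp only [Code.inducedY, Code.postprocess_inducedXY, Finset.sum_mul]
  rw [Finset.sum_comm]

theorem distortion_postprocess_le (c : Code X n R Rc) {p : X → ℝ} (hp : p ∈ stdSimplex ℝ X)
    (hRc : 0 ≤ Rc) {T : (Fin n → X) → (Fin n → X) → ℝ}
    (hT : ∀ y, T y ∈ stdSimplex ℝ (Fin n → X)) {d : X → X → ℝ} (hd : ∀ x y, 0 ≤ d x y)
    {D : ℝ} (hD : 0 ≤ D) (hdD : ∀ x y, d x y ≤ D) :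
    distortion p d (c.postprocess T hT) ≤
      distortion p d c + D * ∑ y, c.inducedY p y * (1 - T y y) := by
  classical
  have hXY := (c.inducedXY_mem hp hRc).1
  -- Staying at `y` costs at most the old distortion; any move costs at most `D`.
  have key : ∀ x y, ∑ y', T y y' * avgDist d x y' ≤ avgDist d x y + D * (1 - T y y) := by
    intro x y
    have h1 : ∀ y', T y y' * avgDist d x y' ≤
        (if y' = y then T y y' * avgDist d x y' - T y y' * D else 0) + T y y' * D := by
      intro y'
      split_ifs
      · linarith
      · have := mul_le_mul_of_nonneg_left (avgDist_le hD hdD x y') ((hT y).1 y')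
        linarith
    refine (Finset.sum_le_sum fun y' _ => h1 y').trans ?_
    rw [Finset.sum_add_distrib, ← Finset.sum_mul, (hT y).2, Finset.sum_ite_eq']
    simp only [Finset.mem_univ, if_true]
    have h2 : T y y ≤ 1 := by
      rw [← (hT y).2]
      exact Finset.single_le_sum (fun b _ => (hT y).1 b) (Finset.mem_univ y)
    nlinarith [avgDist_nonneg hd x y, (hT y).1 y]
  have h1 : distortion p d (c.postprocess T hT) =
      ∑ x, ∑ y, c.inducedXY p (x, y) * ∑ y', T y y' * avgDist d x y' := by
    unfold distortion expect
    rw [Fintype.sum_prod_type]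
    refine Finset.sum_congr rfl fun x _ => ?_
    simp only [Code.postprocess_inducedXY, Finset.sum_mul, Finset.mul_sum]
    rw [Finset.sum_comm]
    simp only [mul_assoc]
  have h2 : distortion p d c + D * ∑ y, c.inducedY p y * (1 - T y y) =
      ∑ x, ∑ y, c.inducedXY p (x, y) * (avgDist d x y + D * (1 - T y y)) := by
    simp only [mul_add, Finset.sum_add_distrib]
    congr 1
    · unfold distortion expect
      rw [Fintype.sum_prod_type]
    · simp only [Code.inducedY, Finset.sum_mul, Finset.mul_sum]
      rw [Finset.sum_comm]
      exact Finset.sum_congr rfl fun _ _ => Finset.sum_congr rfl fun _ _ => by ring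
  rw [h1, h2]
  exact Finset.sum_le_sum fun x _ => Finset.sum_le_sum fun y _ =>
    mul_le_mul_of_nonneg_left (key x y) (hXY _)

/-- The coupling kernel is private randomness of the decoder, so the rates are unchanged, and the
distortion grows by at most `D` times the total variation. -/
theorem achievablePerfect_of_nearPerfect {p : X → ℝ} (hp : p ∈ stdSimplex ℝ X)
    {d : X → X → ℝ} (hd : ∀ x y, 0 ≤ d x y) {R Rc Δ : ℝ} (hRc : 0 ≤ Rc)
    (h : AchievableNearPerfect p d R Rc Δ) : AchievablePerfect p d R Rc Δ := by
  intro ε hε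
  obtain ⟨c, hc, htv⟩ := h ε hε
  obtain ⟨D, hD, hdD⟩ := exists_dist_bound d
  choose T hT hTQ hTle using fun n =>
    exists_coupling_kernel ((c n).inducedY_mem hp hRc) (iid_mem hp n)
  refine ⟨fun n => (c n).postprocess (T n) (hT n), ?_, 0, fun n _ => ?_⟩
  · refine limsup_le_of_forall_pos (fun n => distortion_nonneg _ hp hRc hd) fun e he => ?_
    have h1 := eventually_le_of_limsup_le (fun n => distortion_le (c n) hp hRc hD hdD) hc
      (half_pos he)
    have h2 : ∀ᶠ n in atTop, D * tvDist ((c n).inducedY p) (iid p n) < e / 2 := by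
      have := htv.const_mul D
      rw [mul_zero] at this
      exact this.eventually_lt_const (half_pos he)
    filter_upwards [h1, h2] with n h1 h2
    have := distortion_postprocess_le (c n) hp hRc (hT n) hd hD hdD
    have := mul_le_mul_of_nonneg_left (hTle n) hD
    linarith
  · funext y
    rw [Code.postprocess_inducedY, hTQ]

theorem achievableNearPerfect_of_perfect {p : X → ℝ} {d : X → X → ℝ} {R Rc Δ : ℝ}
    (h : AchievablePerfect p d R Rc Δ) : AchievableNearPerfect p d R Rc Δ := by
  intro ε hε
  obtain ⟨c, hc, N, hN⟩ := h ε hε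
  refine ⟨c, hc, tendsto_const_nhds.congr' ?_⟩
  filter_upwards [eventually_ge_atTop N] with n hn
  rw [hN n hn]
  simp [tvDist]

end Postprocess

/-! ### Perfect realism fools every critic -/

/-- Jensen's inequality for the logarithm, with the critic condition taken at length `b * n`. -/
theorem score_le_zero {X : Type*} [Fintype X] {p : X → ℝ} (hp : p ∈ stdSimplex ℝ X)
    {δ : List X → ℝ} (hδ : IsCritic p δ) {n b : ℕ} (hn : 1 ≤ n) (hb : 0 < b) :
    ∑ y : Fin b → Fin n → X, iid (iid p n) b y * δ (batchWord y) ≤ 0 := by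
  rw [← sum_batch]
  have h := sum_weight_logb_le (iid_mem hp (b * n)) (fun x => (2 : ℝ) ^ (δ (List.ofFn x)))
    (fun x _ => by positivity) (hδ (b * n) (Nat.mul_pos hb hn))
  simpa [Real.logb_rpow] using h

theorem achievableAlgorithmic_of_perfect {X : Type*} [Fintype X] [Primcodable X]
    {p : X → ℝ} (hp : p ∈ stdSimplex ℝ X) {d : X → X → ℝ}
    {R Rc Δ : ℝ} (hRc : 0 ≤ Rc) {B : ℕ → ℕ} (hB : ∀ n, 1 ≤ n → 0 < B n)
    (h : AchievablePerfect p d R Rc Δ) : AchievableAlgorithmic p d R Rc B Δ := by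
  intro ε hε
  obtain ⟨c, hc, N, hN⟩ := h ε hε
  refine ⟨c, ?_, fun δ _ hδ => ?_⟩
  · rwa [limsup_congr (v := fun n => distortion p d (c n))]
    filter_upwards [eventually_ge_atTop 1] with n hn
    exact batchDistortion_eq (c n) hp hRc d (hB n hn)
  -- The finitely many block lengths before perfect realism sets in are absorbed in the constant;
  -- later scores are nonpositive.
  · refine ⟨∑ n ∈ Finset.range N, |batchScore p δ (c n) (B n)|, fun n hn => ?_⟩
    rcases lt_or_ge n N with hlt | hge
    · exact (le_abs_self _).trans (Finset.single_le_sum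
        (f := fun n => |batchScore p δ (c n) (B n)|) (fun _ _ => abs_nonneg _)
        (Finset.mem_range.2 hlt))
    · rw [batchScore_eq, hN n hge]
      exact (score_le_zero hp hδ hn (hB n hn)).trans (Finset.sum_nonneg fun _ _ => abs_nonneg _)

/-! ### Lower semicomputable functions from witness searches -/

section Search

variable {α ω : Type*} [Primcodable ω]

/-- The largest value of a witness among the first `K` ones. -/
def searchMax (test : α → ω → Bool) (val : ω → ℕ) (a : α) (K : ℕ) : ℕ :=
  Nat.rec 0 (fun i r => Option.casesOn (Encodable.decode (α := ω) i) r
    fun w => bif test a w then max r (val w) else r) K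

theorem searchMax_succ (test : α → ω → Bool) (val : ω → ℕ) (a : α) (K : ℕ) :
    searchMax test val a (K + 1) = Option.casesOn (Encodable.decode (α := ω) K)
      (searchMax test val a K) fun w =>
        bif test a w then max (searchMax test val a K) (val w) else searchMax test val a K := rfl

theorem searchMax_mono (test : α → ω → Bool) (val : ω → ℕ) (a : α) :
    Monotone (searchMax test val a) := by
  refine monotone_nat_of_le_succ fun K => ?_
  rw [searchMax_succ]
  rcases Encodable.decode (α := ω) K with _ | w
  · exact le_rfl
  · cases h : test a w <;> simp [h]

theorem le_searchMax {test : α → ω → Bool} {val : ω → ℕ} {a : α} {w : ω} (h : test a w = true) :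
    val w ≤ searchMax test val a (Encodable.encode w + 1) := by
  rw [searchMax_succ, Encodable.encodek]
  simp [h]

theorem searchMax_eq (test : α → ω → Bool) (val : ω → ℕ) (a : α) (K : ℕ) :
    searchMax test val a K = 0 ∨ ∃ w, test a w = true ∧ val w = searchMax test val a K := by
  induction K with
  | zero => exact Or.inl rfl
  | succ K ih =>
    rw [searchMax_succ]
    rcases Encodable.decode (α := ω) K with _ | w
    · exact ih
    · cases h : test a w
      · simpa [h] using ih
      · rcases le_total (searchMax test val a K) (val w) with hle | hle
        · right
          exact ⟨w, h, by simp [hle, h]⟩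
        · simpa [hle, h] using ih

variable [Primcodable α]

theorem searchMax_computable {test : α → ω → Bool} (htest : Computable₂ test) {val : ω → ℕ}
    (hval : Computable val) : Computable₂ (searchMax test val) := by
  unfold searchMax
  refine Computable.nat_rec (σ := ℕ) (f := fun x : α × ℕ => x.2) (g := fun _ => 0)
    (h := fun x ir => Option.casesOn (Encodable.decode (α := ω) ir.1) ir.2
      fun w => bif test x.1 w then max ir.2 (val w) else ir.2)
    Computable.snd (Computable.const 0) ?_
  refine Computable.option_casesOn (Computable.decode.comp (Computable.fst.comp Computable.snd))
    (Computable.snd.comp Computable.snd) ?_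
  refine Computable.cond (htest.comp (Computable.fst.comp (Computable.fst.comp Computable.fst))
    Computable.snd) ?_ (Computable.snd.comp (Computable.snd.comp Computable.fst))
  exact Primrec.nat_max.to_comp.comp (Computable.snd.comp (Computable.snd.comp Computable.fst))
    (hval.comp Computable.snd)

theorem computablePred_and {P Q : α → Prop} (hP : ComputablePred P) (hQ : ComputablePred Q) :
    ComputablePred fun a => P a ∧ Q a := by
  classical
  obtain ⟨_, hP⟩ := hP
  obtain ⟨_, hQ⟩ := hQ
  refine ComputablePred.computable_iff.2 ⟨fun a => decide (P a) && decide (Q a),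
    Primrec.and.to_comp.comp hP hQ, ?_⟩
  funext a
  simp

theorem computablePred_forall_fintype {X : Type*} [Fintype X] {P : X → α → Prop}
    (hP : ∀ x, ComputablePred (P x)) : ComputablePred fun a => ∀ x, P x a := by
  classical
  have h : ∀ s : Finset X, ComputablePred fun a => ∀ x ∈ s, P x a := by
    intro s
    induction s using Finset.induction_on with
    | empty =>
      exact ComputablePred.computable_iff.2 ⟨fun _ => true, Computable.const _, by funext a; simp⟩
    | insert x s _ ih =>
      exact (computablePred_and (hP x) ih).of_eq fun a => by simp
  exact (h Finset.univ).of_eq fun a => by simp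

theorem computablePred_comp {β : Type*} [Primcodable β] {P : β → Prop} (hP : PrimrecPred P)
    {f : α → β} (hf : Computable f) : ComputablePred fun a => P (f a) := by
  classical
  obtain ⟨_, hP⟩ := hP
  exact ComputablePred.computable_iff.2 ⟨_, hP.to_comp.comp hf, by funext a; simp⟩

/-- The best value met so far is computable and nondecreasing in the search time, and it stabilises
because values are bounded. The shift by `1` makes the default score `-1`, which uses up only half
of the mass budget of a critic. -/
theorem exists_lowerSemicomputable_search {P : α → ω → Prop}
    (hP : ComputablePred fun x : α × ω => P x.1 x.2) {val : ω → ℕ} (hval : Computable val)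
    (hbdd : ∀ a, ∃ M, ∀ w, P a w → val w ≤ M) :
    ∃ f : α → ℕ, LowerSemicomputable (fun a => (f a : ℝ) - 1) ∧
      (∀ a w, P a w → val w ≤ f a) ∧ ∀ a, f a = 0 ∨ ∃ w, P a w ∧ val w = f a := by
  obtain ⟨t, ht, htP⟩ := ComputablePred.computable_iff.1 hP
  have htP' : ∀ a w, P a w ↔ t (a, w) = true := fun a w => by
    have := congrFun htP (a, w)
    simpa using this
  set g := searchMax (fun a w => t (a, w)) val with hg
  have hgb : ∀ a, ∃ M, ∀ K, g a K ≤ M := by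
    intro a
    obtain ⟨M, hM⟩ := hbdd a
    refine ⟨M, fun K => ?_⟩
    rcases searchMax_eq (fun a w => t (a, w)) val a K with h | ⟨w, hw, h⟩
    · rw [hg, h]; exact Nat.zero_le _
    · rw [hg, ← h]; exact hM w ((htP' a w).2 hw)
  have hsup : ∀ a, ∃ K, ∀ K', K ≤ K' → g a K' = g a K := by
    intro a
    obtain ⟨M, hM⟩ := hgb a
    have hne : (Set.range (g a)).Nonempty := ⟨_, 0, rfl⟩
    have hb : BddAbove (Set.range (g a)) := ⟨M, by rintro _ ⟨K, rfl⟩; exact hM K⟩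
    obtain ⟨K, hK⟩ := Nat.sSup_mem hne hb
    refine ⟨K, fun K' h => le_antisymm ?_ (searchMax_mono _ _ a h)⟩
    rw [hK]
    exact le_csSup hb ⟨K', rfl⟩
  choose K hK using hsup
  refine ⟨fun a => g a (K a), ⟨fun x => (g x.1 x.2 : ℚ) - 1, ?_, ?_, ?_⟩, fun a w h => ?_,
    fun a => ?_⟩
  -- Sign, numerator and denominator of `n - 1`, which is negative only at `n = 0`.
  · have hh : Primrec fun n : ℕ => (Nat.casesOn n (false, 1, 1) fun m => (true, m, 1) :
        Bool × ℕ × ℕ) := by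
      refine Primrec.nat_casesOn Primrec.id (Primrec.const _) ?_
      exact Primrec.pair (Primrec.const _) (Primrec.pair Primrec.snd (Primrec.const _))
    refine ⟨_, hh.to_comp.comp (searchMax_computable (test := fun a w => t (a, w)) ht hval),
      fun x => ?_⟩
    change _ ∧ (g x.1 x.2 : ℚ) - 1 = _
    rw [← hg]
    rcases g x.1 x.2 with _ | m <;> simp
  · intro a k
    have := searchMax_mono (fun a w => t (a, w)) val a (Nat.le_succ k)
    have : (g a k : ℚ) ≤ g a (k + 1) := by exact_mod_cast this
    simpa using this
  · intro a
    refine tendsto_const_nhds.congr' ?_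
    filter_upwards [eventually_ge_atTop (K a)] with k hk
    rw [hK a k hk]
    push_cast
    rfl
  · have h1 := le_searchMax (test := fun a w => t (a, w)) (val := val) ((htP' a w).1 h)
    have h2 := searchMax_mono (fun a w => t (a, w)) val a
      (le_max_left (Encodable.encode w + 1) (K a))
    rw [← hg] at h1 h2
    rw [hK a _ (le_max_right _ _)] at h2
    exact h1.trans h2
  · rcases searchMax_eq (fun a w => t (a, w)) val a (K a) with h | ⟨w, hw, h⟩
    · exact Or.inl h
    · exact Or.inr ⟨w, (htP' a w).2 hw, h⟩

end Search

/-! ### The empirical test -/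

section Test

variable {X : Type*} [Primcodable X]

/-- The product of the table entries of the letters of a word. -/
def tableProd (T : List ℕ) (s : List X) : ℕ :=
  s.foldr (fun x r => T.getD (Encodable.encode x) 0 * r) 1

/-- The sum over a list of words of the products of table entries. -/
def tableSum (T : List ℕ) (S : List (List X)) : ℕ :=
  S.foldr (fun s r => tableProd T s + r) 0

open Classical in
/-- The number of blocks that belong to the list `S`. -/
def hits (L S : List (List X)) : ℕ :=
  L.foldr (fun l r => (if l ∈ S then 1 else 0) + r) 0

theorem primrec_tableProd : Primrec₂ (tableProd (X := X)) := by
  refine Primrec.list_foldr (h := fun (a : List ℕ × List X) (b : X × ℕ) =>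
    a.1.getD (Encodable.encode b.1) 0 * b.2) Primrec.snd (Primrec.const 1) ?_
  refine Primrec.nat_mul.comp ?_ (Primrec.snd.comp Primrec.snd)
  exact (Primrec.list_getD 0).comp (Primrec.fst.comp Primrec.fst)
    (Primrec.encode.comp (Primrec.fst.comp Primrec.snd))

theorem primrec_tableSum : Primrec₂ (tableSum (X := X)) := by
  refine Primrec.list_foldr (h := fun (a : List ℕ × List (List X)) (b : List X × ℕ) =>
    tableProd a.1 b.1 + b.2) Primrec.snd (Primrec.const 0) ?_
  refine Primrec.nat_add.comp ?_ (Primrec.snd.comp Primrec.snd)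
  exact primrec_tableProd.comp (Primrec.fst.comp Primrec.fst) (Primrec.fst.comp Primrec.snd)

theorem primrecPred_mem {α β : Type*} [Primcodable α] [Primcodable β] {f : α → β}
    {g : α → List β} (hf : Primrec f) (hg : Primrec g) : PrimrecPred fun a => f a ∈ g a :=
  ((PrimrecRel.exists_mem_list (R := fun (a b : β) => a = b) Primrec.eq).comp hg hf).of_eq
    fun a => by simp

theorem primrec_hits : Primrec₂ (hits (X := X)) := by
  classical
  refine Primrec.list_foldr (h := fun (a : List (List X) × List (List X)) (b : List X × ℕ) =>
    (if b.1 ∈ a.2 then 1 else 0) + b.2) Primrec.fst (Primrec.const 0) ?_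
  refine Primrec.nat_add.comp ?_ (Primrec.snd.comp Primrec.snd)
  exact Primrec.ite (primrecPred_mem (Primrec.fst.comp Primrec.snd)
    (Primrec.snd.comp Primrec.fst)) (Primrec.const _) (Primrec.const _)

theorem primrec_pow : Primrec₂ ((· ^ ·) : ℕ → ℕ → ℕ) := Primrec₂.unpaired'.1 Nat.Primrec.pow

/-- A witness `(ℓ, n, L, S, T, D, k)` that a word is atypical: `ℓ` is the score, `L` the list of the
blocks, of length `n`, of the word, `S` a list of words of length `n` that is too frequent in `L`,
and `T`, `D` are numerators and the common denominator of upper bounds on the mass function,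
certified by its `k`-th approximation. -/
abbrev Witness (X : Type*) : Type _ :=
  ℕ × ℕ × List (List X) × List (List X) × List ℕ × ℕ × ℕ

/-- The test passed by the valid witnesses for `y`. The approximations of the mass function are
`num / den`, and `N` is the size of the alphabet. -/
def Passes (B : ℕ → ℕ) (num den : X × ℕ → ℕ) (N q : ℕ) (y : List X) (w : Witness X) : Prop :=
  match w with
  | (ℓ, n, L, S, T, D, k) =>
    (((L.flatten = y ∧ 1 ≤ n) ∧ (∀ l ∈ L, l.length = n) ∧ (∀ s ∈ S, s.length = n)) ∧ 0 < D) ∧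
    (L.length = B n ∧ 4 ^ ℓ * N ^ n * q ^ 2 ≤ B n) ∧
    (∀ x : X, num (x, k) * D ≤ T.getD (Encodable.encode x) 0 * den (x, k)) ∧
    B n * (tableSum T S * q + D ^ n) < hits L S * D ^ n * q

/-- The clauses are primitive recursive except for finitely many comparisons involving `B`, `num`
and `den`, which are only computable. -/
theorem computablePred_passes [Fintype X] {B : ℕ → ℕ} (hB : Computable B) {num den : X × ℕ → ℕ}
    (hnum : Computable num) (hden : Computable den) (N q : ℕ) :
    ComputablePred fun x : List X × Witness X => Passes B num den N q x.1 x.2 := by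
  let A := List X × Witness X
  have hℓ : Primrec fun x : A => x.2.1 := Primrec.fst.comp Primrec.snd
  have h1 : Primrec fun x : A => x.2.2 := Primrec.snd.comp Primrec.snd
  have hn : Primrec fun x : A => x.2.2.1 := Primrec.fst.comp h1
  have h2 : Primrec fun x : A => x.2.2.2 := Primrec.snd.comp h1
  have hL : Primrec fun x : A => x.2.2.2.1 := Primrec.fst.comp h2
  have h3 : Primrec fun x : A => x.2.2.2.2 := Primrec.snd.comp h2
  have hS : Primrec fun x : A => x.2.2.2.2.1 := Primrec.fst.comp h3
  have h4 : Primrec fun x : A => x.2.2.2.2.2 := Primrec.snd.comp h3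
  have hT : Primrec fun x : A => x.2.2.2.2.2.1 := Primrec.fst.comp h4
  have h5 : Primrec fun x : A => x.2.2.2.2.2.2 := Primrec.snd.comp h4
  have hD : Primrec fun x : A => x.2.2.2.2.2.2.1 := Primrec.fst.comp h5
  have hk : Primrec fun x : A => x.2.2.2.2.2.2.2 := Primrec.snd.comp h5
  have hlen : PrimrecRel fun (l : List X) (n : ℕ) => l.length = n :=
    Primrec.eq.comp (Primrec.list_length.comp Primrec.fst) Primrec.snd
  have hBn : Computable fun x : A => B x.2.2.1 := hB.comp hn.to_comp
  have hDn : Primrec fun x : A => x.2.2.2.2.2.2.1 ^ x.2.2.1 := primrec_pow.comp hD hn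
  have hle : ∀ {f g : A → ℕ}, Computable f → Computable g →
      ComputablePred fun x => f x ≤ g x := fun hf hg =>
    computablePred_comp (P := fun x : ℕ × ℕ => x.1 ≤ x.2) Primrec.nat_le (hf.pair hg)
  have hlt : ∀ {f g : A → ℕ}, Computable f → Computable g →
      ComputablePred fun x => f x < g x := fun hf hg =>
    computablePred_comp (P := fun x : ℕ × ℕ => x.1 < x.2) Primrec.nat_lt (hf.pair hg)
  refine computablePred_and (PrimrecPred.computablePred ?_) (computablePred_and
    (computablePred_and ?_ ?_) (computablePred_and (computablePred_forall_fintype fun x => ?_) ?_))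
  · refine ((((Primrec.eq.comp (Primrec.list_flatten.comp hL) Primrec.fst).and
      (Primrec.nat_le.comp (Primrec.const 1) hn))).and ?_).and
      (Primrec.nat_lt.comp (Primrec.const 0) hD)
    exact (hlen.forall_mem_list.comp hL hn).and (hlen.forall_mem_list.comp hS hn)
  · exact computablePred_comp (P := fun x : ℕ × ℕ => x.1 = x.2) Primrec.eq
      ((Primrec.list_length.comp hL).to_comp.pair hBn)
  · refine hle (Primrec.to_comp ?_) hBn
    exact Primrec.nat_mul.comp (Primrec.nat_mul.comp (primrec_pow.comp (Primrec.const 4) hℓ)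
      (primrec_pow.comp (Primrec.const N) hn)) (Primrec.const _)
  · refine hle ?_ ?_
    · exact Primrec.nat_mul.to_comp.comp (hnum.comp ((Computable.const x).pair hk.to_comp))
        hD.to_comp
    · exact Primrec.nat_mul.to_comp.comp
        ((Primrec.list_getD 0).comp hT (Primrec.const _)).to_comp
        (hden.comp ((Computable.const x).pair hk.to_comp))
  · refine hlt ?_ (Primrec.to_comp ?_)
    · refine Primrec.nat_mul.to_comp.comp hBn (Primrec.to_comp ?_)
      exact Primrec.nat_add.comp (Primrec.nat_mul.comp (primrec_tableSum.comp hT hS)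
        (Primrec.const q)) hDn
    · exact Primrec.nat_mul.comp (Primrec.nat_mul.comp (primrec_hits.comp hL hS) hDn)
        (Primrec.const q)

end Test

/-! ### Empirical distributions -/

open Classical in
/-- The empirical distribution of a finite sample. -/
def emp {α : Type*} {b : ℕ} (z : Fin b → α) (a : α) : ℝ :=
  (1 / (b : ℝ)) * ∑ i, if z i = a then 1 else 0

theorem sum_sqrt_le {α : Type*} [Fintype α] {w : α → ℝ} (hw : w ∈ stdSimplex ℝ α) {b : ℝ}
    (hb : 0 < b) : ∑ a, √(w a / b) ≤ √(Fintype.card α / b) := by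
  apply Real.le_sqrt_of_sq_le
  refine (sq_sum_le_card_mul_sum_sq (s := Finset.univ) (f := fun a => √(w a / b))).trans ?_
  have h : ∀ a, √(w a / b) ^ 2 = w a / b := fun a =>
    Real.sq_sqrt (div_nonneg (hw.1 a) hb.le)
  simp only [h]
  rw [← Finset.sum_div, hw.2, Finset.card_univ, mul_one_div]

/-- The mean `ℓ¹` distance between a law and its empirical estimate. -/
theorem mean_emp_dev_le {α : Type*} [Fintype α] {w : α → ℝ} (hw : w ∈ stdSimplex ℝ α) {b : ℕ}
    (hb : 0 < b) :
    ∑ z : Fin b → α, iid w b z * ∑ a, |emp z a - w a| ≤ √(Fintype.card α / b) := by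
  classical
  have hb' : (0 : ℝ) < b := by exact_mod_cast hb
  have : Nonempty (Fin b) := ⟨⟨0, hb⟩⟩
  refine le_trans ?_ (sum_sqrt_le hw hb')
  simp_rw [Finset.mul_sum]
  rw [Finset.sum_comm]
  refine Finset.sum_le_sum fun a _ => ?_
  have h := mean_abs_dev_le (ι := Fin b) hw (fun x => if x = a then (1 : ℝ) else 0)
    (s := Finset.univ) Finset.univ_nonempty
  simp only [Finset.card_univ, Fintype.card_fin, mul_ite, mul_one, mul_zero, Finset.sum_ite_eq',
    Finset.mem_univ, if_true, ite_pow, one_pow, ne_eq, OfNat.ofNat_ne_zero, not_false_eq_true,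
    zero_pow] at h
  refine le_trans (le_of_eq ?_) h
  refine Finset.sum_congr rfl fun z _ => ?_
  simp only [iid, emp]

open Classical in
theorem sum_emp {α : Type*} {b : ℕ} (z : Fin b → α) (A : Finset α) :
    ∑ a ∈ A, emp z a = (1 / (b : ℝ)) * ∑ i, if z i ∈ A then 1 else 0 := by
  unfold emp
  rw [← Finset.mul_sum, Finset.sum_comm]
  simp

theorem sum_sub_le_sum_abs {α : Type*} [Fintype α] (f g : α → ℝ) (A : Finset α) :
    ∑ a ∈ A, f a - ∑ a ∈ A, g a ≤ ∑ a, |f a - g a| := by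
  rw [← Finset.sum_sub_distrib]
  exact (Finset.sum_le_sum fun a _ => le_abs_self _).trans
    (Finset.sum_le_univ_sum_of_nonneg fun a => abs_nonneg _)

theorem exists_sum_sub_eq_tvDist {α : Type*} [Fintype α] {P Q : α → ℝ} (hP : P ∈ stdSimplex ℝ α)
    (hQ : Q ∈ stdSimplex ℝ α) :
    ∃ A : Finset α, ∑ a ∈ A, P a - ∑ a ∈ A, Q a = tvDist P Q := by
  classical
  refine ⟨Finset.univ.filter fun a => Q a ≤ P a, ?_⟩
  rw [tvDist_eq_sum_sub_min hP hQ, ← Finset.sum_sub_distrib, Finset.sum_filter]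
  refine Finset.sum_congr rfl fun a _ => ?_
  split_ifs with h
  · rw [min_eq_right h]
  · rw [min_eq_left (not_le.1 h).le, sub_self]

/-! ### Semantics of the test -/

section Semantics

variable {X : Type*}

theorem tableProd_bound [Primcodable X] {p : X → ℝ} (hp0 : ∀ x, 0 ≤ p x) {T : List ℕ}
    {D : ℕ} (hD : 0 < D) (hT : ∀ x, p x ≤ (T.getD (Encodable.encode x) 0 : ℝ) / D) (s : List X) :
    (s.map p).prod ≤ (tableProd T s : ℝ) / (D : ℝ) ^ s.length := by
  have hD' : (0 : ℝ) < D := by exact_mod_cast hD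
  induction s with
  | nil => simp [tableProd]
  | cons x s ih =>
    have h1 : (tableProd T (x :: s) : ℝ) = (T.getD (Encodable.encode x) 0 : ℝ) * tableProd T s := by
      simp [tableProd]
    rw [List.map_cons, List.prod_cons, h1, List.length_cons, pow_succ', mul_div_mul_comm]
    exact mul_le_mul (hT x) ih (List.prod_nonneg (by simpa using fun a _ => hp0 a)) (by positivity)

/-- Repetitions in `S` and members outside `A` only enlarge the right side, so a witness need not
certify that its list is free of them. -/
theorem sum_mem_le_list_sum {n : ℕ} [Fintype X] {g : List X → ℝ} (hg : ∀ s, 0 ≤ g s)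
    (S : List (List X)) (A : Finset (Fin n → X)) (hA : ∀ a ∈ A, List.ofFn a ∈ S) :
    ∑ a ∈ A, g (List.ofFn a) ≤ (S.map g).sum := by
  classical
  induction S generalizing A with
  | nil =>
    have : A = ∅ := Finset.eq_empty_of_forall_notMem fun a ha => by simpa using hA a ha
    simp [this]
  | cons s S ih =>
    rw [List.map_cons, List.sum_cons, ← Finset.sum_filter_add_sum_filter_not A
      (fun a => List.ofFn a = s)]
    refine add_le_add ?_ (ih _ fun a ha => ?_)
    · rcases (A.filter fun a => List.ofFn a = s).eq_empty_or_nonempty with h | ⟨a, ha⟩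
      · rw [h]; simpa using hg s
      · have h1 : (A.filter fun a => List.ofFn a = s) = {a} := by
          refine Finset.eq_singleton_iff_unique_mem.2 ⟨ha, fun b hb => ?_⟩
          exact List.ofFn_injective
            ((Finset.mem_filter.1 hb).2.trans (Finset.mem_filter.1 ha).2.symm)
        rw [h1, Finset.sum_singleton, (Finset.mem_filter.1 ha).2]
    · have h1 := hA a (Finset.mem_filter.1 ha).1
      have h2 := (Finset.mem_filter.1 ha).2
      simpa [h2] using h1

theorem tableSum_eq [Primcodable X] (T : List ℕ) (S : List (List X)) :
    tableSum T S = (S.map (tableProd T)).sum := by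
  induction S with
  | nil => rfl
  | cons s S ih => simp [← ih, tableSum]

open Classical in
theorem hits_ofFn {b : ℕ} (z : Fin b → List X) (S : List (List X)) :
    hits (List.ofFn z) S = ∑ i, if z i ∈ S then 1 else 0 := by
  have h : ∀ L : List (List X), hits L S = (L.map fun l => if l ∈ S then 1 else 0).sum := by
    intro L
    induction L with
    | nil => rfl
    | cons l L ih => rw [List.map_cons, List.sum_cons, ← ih]; rfl
  rw [h, List.map_ofFn, List.sum_ofFn]
  rfl

theorem prod_map_ofFn {n : ℕ} (p : X → ℝ) (a : Fin n → X) :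
    ((List.ofFn a).map p).prod = iid p n a := by
  rw [List.map_ofFn, List.prod_ofFn]
  rfl

/-- The map `n ↦ B n * n` is strictly increasing for `n ≥ 1`, so a critic can read the block length
off the length of the concatenated word. -/
theorem blockLength_unique {B : ℕ → ℕ} (hB_pos : ∀ n, 1 ≤ n → 0 < B n)
    (hB_mono : ∀ m n, 1 ≤ m → m ≤ n → B m ≤ B n) {m n : ℕ} (hm : 1 ≤ m) (hn : 1 ≤ n)
    (h : B m * m = B n * n) : m = n := by
  have key : ∀ {m n : ℕ}, 1 ≤ m → m < n → B m * m < B n * n := by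
    intro m n hm hmn
    calc B m * m < B m * n := by have := hB_pos m hm; gcongr
      _ ≤ B n * n := by have := hB_mono m n hm hmn.le; gcongr
  rcases lt_trichotomy m n with h1 | h1 | h1
  · exact absurd h (key hm h1).ne
  · exact h1
  · exact absurd h (key hn h1).ne'

theorem length_batchWord {n b : ℕ} (z : Fin b → Fin n → X) : (batchWord z).length = b * n := by
  simp [batchWord, List.length_flatten, List.map_ofFn, Function.comp_def]

variable [Fintype X] [Primcodable X]

/-- A word with a valid witness has an empirical block distribution far from the target. -/
theorem Passes.sound {B : ℕ → ℕ} (hB_pos : ∀ n, 1 ≤ n → 0 < B n)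
    (hB_mono : ∀ m n, 1 ≤ m → m ≤ n → B m ≤ B n) {p : X → ℝ} (hp0 : ∀ x, 0 ≤ p x)
    {num den : X × ℕ → ℕ} (hden : ∀ x, 0 < den x)
    (hnum : ∀ x k, p x ≤ (num (x, k) : ℝ) / den (x, k)) {N q : ℕ} (hq : 0 < q) {n : ℕ}
    (hn : 1 ≤ n) {z : Fin (B n) → Fin n → X} {w : Witness X}
    (h : Passes B num den N q (batchWord z) w) :
    4 ^ w.1 * N ^ n * q ^ 2 ≤ B n ∧ 1 / (q : ℝ) < ∑ a, |emp z a - iid p n a| := by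
  classical
  obtain ⟨ℓ, n', L, S, T, D, k⟩ := w
  obtain ⟨⟨⟨⟨hfl, hn'⟩, hLlen, hSlen⟩, hD⟩, ⟨hLB, h4⟩, hT, hlt⟩ := h
  have hlenL : L.flatten.length = L.length * n' := by
    rw [List.length_flatten]
    have : L.map List.length = L.map fun _ => n' := List.map_congr_left hLlen
    rw [this]
    simp
  have hnn : n' = n := by
    apply blockLength_unique hB_pos hB_mono hn' hn
    rw [← hLB, ← hlenL, hfl, length_batchWord]
  subst hnn
  -- Once all block lengths are known, the flattened word determines its blocks.
  have hL : L = List.ofFn fun i => List.ofFn (z i) := by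
    apply (List.eq_iff_flatten_eq).2
    refine ⟨hfl, ?_⟩
    have : L.map List.length = L.map fun _ => n' := List.map_congr_left hLlen
    rw [this, List.map_ofFn]
    simp [Function.comp_def, hLB, List.map_const', List.ofFn_const]
  refine ⟨h4, ?_⟩
  have hD' : (0 : ℝ) < D := by exact_mod_cast hD
  have hq' : (0 : ℝ) < q := by exact_mod_cast hq
  have hB' : (0 : ℝ) < B n' := by exact_mod_cast hB_pos n' hn
  have hTp : ∀ x, p x ≤ (T.getD (Encodable.encode x) 0 : ℝ) / D := by
    intro x
    have hd : (0 : ℝ) < den (x, k) := by exact_mod_cast hden (x, k)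
    refine (hnum x k).trans ?_
    rw [div_le_div_iff₀ hd hD']
    exact_mod_cast hT x
  -- The event named by the witness: its probability is bounded through the table, its empirical
  -- frequency is read off `hits`.
  set A : Finset (Fin n' → X) := Finset.univ.filter fun a => List.ofFn a ∈ S with hA
  have hpA : ∑ a ∈ A, iid p n' a ≤ (tableSum T S : ℝ) / (D : ℝ) ^ n' := by
    have h1 := sum_mem_le_list_sum (g := fun s => (s.map p).prod)
      (fun s => List.prod_nonneg (by simpa using fun a _ => hp0 a)) S A
      (fun a ha => (Finset.mem_filter.1 ha).2)
    simp only [prod_map_ofFn] at h1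
    refine h1.trans ?_
    rw [tableSum_eq]
    have h2 : ∀ S' : List (List X), (∀ s ∈ S', s.length = n') →
        (S'.map fun s => (s.map p).prod).sum ≤ (((S'.map (tableProd T)).sum : ℕ) : ℝ) /
          (D : ℝ) ^ n' := by
      intro S' hS'
      induction S' with
      | nil => simp
      | cons s S' ih =>
        rw [List.map_cons, List.sum_cons, List.map_cons, List.sum_cons, Nat.cast_add, add_div]
        refine add_le_add ?_ (ih fun s hs => hS' s (List.mem_cons_of_mem _ hs))
        have := tableProd_bound hp0 hD hTp s
        rwa [hS' s List.mem_cons_self] at this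
    exact h2 S hSlen
  have hemp : ∑ a ∈ A, emp z a = (hits L S : ℝ) / B n' := by
    rw [sum_emp, hL, hits_ofFn]
    push_cast
    rw [one_div, inv_mul_eq_div]
    simp [hA]
  refine lt_of_lt_of_le ?_ (sum_sub_le_sum_abs (emp z) (iid p n') A)
  rw [hemp]
  have hlt' : (B n' : ℝ) * (tableSum T S * q + (D : ℝ) ^ n') < hits L S * (D : ℝ) ^ n' * q := by
    exact_mod_cast hlt
  -- The last clause of the test is this inequality with denominators cleared.
  have h3 : 1 / (q : ℝ) + (tableSum T S : ℝ) / (D : ℝ) ^ n' < (hits L S : ℝ) / B n' := by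
    rw [div_add_div _ _ hq'.ne' (by positivity), div_lt_div_iff₀ (by positivity) hB']
    linarith
  linarith

/-- Every sufficiently atypical batch has a valid witness. -/
theorem exists_passes {B : ℕ → ℕ} {p : X → ℝ}
    {num den : X × ℕ → ℕ} (hden : ∀ x, 0 < den x)
    (hlim : ∀ x, Tendsto (fun k => (num (x, k) : ℝ) / den (x, k)) atTop (𝓝 (p x)))
    {N q : ℕ} (hq : 0 < q) {n : ℕ} (hn : 1 ≤ n) (hB : 0 < B n) {ℓ : ℕ}
    (hℓ : 4 ^ ℓ * N ^ n * q ^ 2 ≤ B n) {z : Fin (B n) → Fin n → X} {A : Finset (Fin n → X)}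
    (hA : 1 / (q : ℝ) < ∑ a ∈ A, emp z a - ∑ a ∈ A, iid p n a) :
    ∃ w : Witness X, Passes B num den N q (batchWord z) w ∧ w.1 = ℓ := by
  classical
  have hlim' : Tendsto (fun k => ∑ a ∈ A, iid (fun x => (num (x, k) : ℝ) / den (x, k)) n a) atTop
      (𝓝 (∑ a ∈ A, iid p n a)) :=
    tendsto_finsetSum _ fun a _ => tendsto_finsetProd _ fun i _ => hlim (a i)
  -- The gap is strict, so it survives replacing `p` by a late enough approximation; this is what
  -- makes the certificate finite.
  obtain ⟨k, hk⟩ := (hlim'.eventually_lt_const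
    (show ∑ a ∈ A, iid p n a < ∑ a ∈ A, emp z a - 1 / (q : ℝ) by linarith)).exists
  -- A common denominator for all letters: `t x / D` is the `k`-th approximation at `x`.
  set D : ℕ := ∏ x, den (x, k) with hDdef
  have hD : 0 < D := Finset.prod_pos fun x _ => hden _
  set t : X → ℕ := fun x => num (x, k) * ∏ x' ∈ Finset.univ.erase x, den (x', k) with ht
  have htD : ∀ x, t x * den (x, k) = num (x, k) * D := by
    intro x
    rw [ht, hDdef, ← Finset.mul_prod_erase Finset.univ _ (Finset.mem_univ x)]
    ring
  -- The table is indexed by codes of letters; the sum of all codes bounds the largest one.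
  set T : List ℕ := (List.range (∑ x : X, Encodable.encode x + 1)).map
    fun i => ((Encodable.decode (α := X) i).map t).getD 0 with hTdef
  have hT : ∀ x, T.getD (Encodable.encode x) 0 = t x := by
    intro x
    have : Encodable.encode x < ∑ x : X, Encodable.encode x + 1 :=
      Nat.lt_succ_of_le (Finset.single_le_sum (f := fun x : X => Encodable.encode x)
        (fun _ _ => Nat.zero_le _) (Finset.mem_univ x))
    simp [hTdef, List.getD_eq_getElem?_getD, this]
  have hD' : (0 : ℝ) < D := by exact_mod_cast hD
  have hq' : (0 : ℝ) < q := by exact_mod_cast hq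
  have hB' : (0 : ℝ) < B n := by exact_mod_cast hB
  have htr : ∀ x, (num (x, k) : ℝ) / den (x, k) = t x / D := by
    intro x
    have hd : (0 : ℝ) < den (x, k) := by exact_mod_cast hden (x, k)
    rw [div_eq_div_iff hd.ne' hD'.ne']
    exact_mod_cast (htD x).symm
  refine ⟨(ℓ, n, List.ofFn (fun i => List.ofFn (z i)), A.toList.map List.ofFn, T, D, k),
    ⟨⟨⟨⟨rfl, hn⟩, ?_, ?_⟩, hD⟩, ⟨by simp, hℓ⟩, fun x => ?_, ?_⟩, rfl⟩
  · intro l hl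
    obtain ⟨i, rfl⟩ := (List.mem_ofFn' _ _).1 hl
    simp
  · intro s hs
    obtain ⟨a, _, rfl⟩ := List.mem_map.1 hs
    simp
  · rw [hT, htD]
  · have hprod : ∀ a : Fin n → X, (tableProd T (List.ofFn a) : ℝ) = (D : ℝ) ^ n *
        iid (fun x => (num (x, k) : ℝ) / den (x, k)) n a := by
      intro a
      have h1 : ∀ s : List X, tableProd T s = (s.map t).prod := by
        intro s
        induction s with
        | nil => rfl
        | cons x s ih => rw [List.map_cons, List.prod_cons, ← ih, ← hT]; rfl
      rw [h1, List.map_ofFn, List.prod_ofFn]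
      simp only [iid, htr, Finset.prod_div_distrib, Finset.prod_const, Finset.card_univ,
        Fintype.card_fin]
      push_cast
      field_simp
      rfl
    have hsum : (tableSum T (A.toList.map List.ofFn) : ℝ) = (D : ℝ) ^ n *
        ∑ a ∈ A, iid (fun x => (num (x, k) : ℝ) / den (x, k)) n a := by
      rw [tableSum_eq, List.map_map, Finset.sum_map_toList]
      push_cast
      rw [Finset.mul_sum]
      exact Finset.sum_congr rfl fun a _ => hprod a
    have hhits : (hits (List.ofFn fun i => List.ofFn (z i)) (A.toList.map List.ofFn) : ℝ) =
        B n * ∑ a ∈ A, emp z a := by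
      rw [sum_emp, hits_ofFn]
      push_cast
      field_simp
      refine Finset.sum_congr rfl fun i _ => ?_
      have : List.ofFn (z i) ∈ A.toList.map List.ofFn ↔ z i ∈ A := by
        rw [List.mem_map]
        constructor
        · rintro ⟨a, ha, hz⟩
          rw [← List.ofFn_injective hz]
          exact Finset.mem_toList.1 ha
        · exact fun h => ⟨_, Finset.mem_toList.2 h, rfl⟩
      simp only [this]
      congr
    suffices h : (B n : ℝ) * (tableSum T (A.toList.map List.ofFn) * q + (D : ℝ) ^ n) <
        hits (List.ofFn fun i => List.ofFn (z i)) (A.toList.map List.ofFn) * (D : ℝ) ^ n * q by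
      exact_mod_cast h
    rw [hsum, hhits]
    have h1 : (∑ a ∈ A, iid (fun x => (num (x, k) : ℝ) / den (x, k)) n a) * q + 1 <
        (∑ a ∈ A, emp z a) * q := by
      have := mul_lt_mul_of_pos_right hk hq'
      rw [sub_mul, one_div, inv_mul_cancel₀ hq'.ne'] at this
      linarith
    have h2 := mul_lt_mul_of_pos_left h1 (show 0 < (B n : ℝ) * (D : ℝ) ^ n by positivity)
    linarith

end Semantics

/-! ### Algorithmic realism implies near-perfect realism -/

section Critic

variable {X : Type*} [Primcodable X]

theorem Passes.length_eq {B : ℕ → ℕ} {num den : X × ℕ → ℕ} {N q : ℕ} {y : List X} {w : Witness X}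
    (h : Passes B num den N q y w) :
    1 ≤ w.2.1 ∧ y.length = B w.2.1 * w.2.1 ∧ 4 ^ w.1 * N ^ w.2.1 * q ^ 2 ≤ B w.2.1 := by
  obtain ⟨ℓ, n', L, S, T, D, k⟩ := w
  obtain ⟨⟨⟨⟨hfl, hn'⟩, hLlen, hSlen⟩, hD⟩, ⟨hLB, h4⟩, hT, hlt⟩ := h
  refine ⟨hn', ?_, h4⟩
  have : L.map List.length = L.map fun _ => n' := List.map_congr_left hLlen
  rw [← hfl, List.length_flatten, this]
  simp [hLB]

/-- Upper approximations, as quotients of computable maps, of a positive computable real map. -/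
theorem exists_upper_approx {p : X → ℝ} (hp_pos : ∀ x, 0 < p x) (hp : ComputableRealMap p) :
    ∃ num den : X × ℕ → ℕ, Computable num ∧ Computable den ∧ (∀ x, 0 < den x) ∧
      (∀ x k, p x ≤ (num (x, k) : ℝ) / den (x, k)) ∧
      ∀ x, Tendsto (fun k => (num (x, k) : ℝ) / den (x, k)) atTop (𝓝 (p x)) := by
  obtain ⟨φ, ⟨f, hf, hφ⟩, hmono, hlim⟩ := hp.2
  have hle : ∀ x k, (φ (x, k) : ℝ) ≤ -p x := by
    intro x k
    refine Monotone.ge_of_tendsto (f := fun k => (φ (x, k) : ℝ)) ?_ (hlim x) k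
    exact monotone_nat_of_le_succ fun k => by exact_mod_cast hmono x k
  -- The approximations of `-p` are negative, so the stored sign is minus and the stored quotient is
  -- the negated approximation.
  have heq : ∀ x k, ((f (x, k)).2.1 : ℝ) / ((f (x, k)).2.2 : ℝ) = -(φ (x, k) : ℝ) := by
    intro x k
    have h1 := (hφ (x, k)).2
    have h2 := hle x k
    have h3 := hp_pos x
    have h4 : (φ (x, k) : ℝ) = (if (f (x, k)).1 then 1 else -1) *
        ((f (x, k)).2.1 : ℝ) / ((f (x, k)).2.2 : ℝ) := by
      rw [h1]; push_cast; split_ifs <;> simp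
    by_cases hs : (f (x, k)).1 = true
    · rw [if_pos hs, one_mul] at h4
      have : (0 : ℝ) ≤ ((f (x, k)).2.1 : ℝ) / ((f (x, k)).2.2 : ℝ) := by positivity
      linarith
    · rw [if_neg hs] at h4
      rw [h4]; ring
  refine ⟨fun x => (f x).2.1, fun x => (f x).2.2,
    Computable.fst.comp (Computable.snd.comp hf), Computable.snd.comp (Computable.snd.comp hf),
    fun x => (hφ x).1, fun x k => ?_, fun x => ?_⟩
  · rw [heq]; linarith [hle x k]
  · simp_rw [heq]
    simpa using (hlim x).neg

variable [Fintype X]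

/-- For every precision `1 / q` there is a lower semicomputable critic that gives the score
`ℓ - 1` to the batches whose empirical distribution overestimates some event by more than `1 / q`,
as soon as the batch is large. -/
theorem exists_empirical_critic {p : X → ℝ} (hp : p ∈ stdSimplex ℝ X) (hp_pos : ∀ x, 0 < p x)
    (hp_comp : ComputableRealMap p) {B : ℕ → ℕ} (hB_comp : Computable B)
    (hB_pos : ∀ n, 1 ≤ n → 0 < B n) (hB_mono : ∀ m n, 1 ≤ m → m ≤ n → B m ≤ B n)
    {q : ℕ} (hq : 0 < q) :
    ∃ δ : List X → ℝ, LowerSemicomputable δ ∧ IsCritic p δ ∧ (∀ y, -1 ≤ δ y) ∧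
      ∀ (n ℓ : ℕ), 1 ≤ n → 4 ^ ℓ * Fintype.card X ^ n * q ^ 2 ≤ B n →
        ∀ (z : Fin (B n) → Fin n → X) (A : Finset (Fin n → X)),
          1 / (q : ℝ) < ∑ a ∈ A, emp z a - ∑ a ∈ A, iid p n a → (ℓ : ℝ) - 1 ≤ δ (batchWord z) := by
  obtain ⟨num, den, hnum, hden, hden_pos, hle, hlim⟩ := exists_upper_approx hp_pos hp_comp
  have hne : Nonempty X := by
    by_contra h
    rw [not_nonempty_iff] at h
    have := hp.2
    simp at this
  have hcard : 0 < Fintype.card X := Fintype.card_pos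
  obtain ⟨f, hf_lsc, hf_ge, hf_eq⟩ := exists_lowerSemicomputable_search
    (computablePred_passes hB_comp hnum hden (Fintype.card X) q) (val := fun w => w.1)
    -- The search is bounded because `ℓ ≤ 4 ^ ℓ ≤ B n`, which is at most the length of the word.
    Computable.fst (fun y => ⟨y.length, fun w hw => by
      obtain ⟨h1, h2, h3⟩ := hw.length_eq
      rw [h2]
      calc w.1 ≤ 4 ^ w.1 := (Nat.lt_pow_self (by norm_num)).le
        _ ≤ 4 ^ w.1 * Fintype.card X ^ w.2.1 * q ^ 2 := by
          rw [mul_assoc]; exact Nat.le_mul_of_pos_right _ (by positivity)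
        _ ≤ B w.2.1 := h3
        _ ≤ B w.2.1 * w.2.1 := Nat.le_mul_of_pos_right _ h1⟩)
  refine ⟨fun y => (f y : ℝ) - 1, hf_lsc, fun m hm => ?_, fun y => by
    have : (0 : ℝ) ≤ f y := Nat.cast_nonneg _
    linarith, fun n ℓ hn hℓ z A hA => ?_⟩
  · by_cases hex : ∃ n, 1 ≤ n ∧ m = B n * n
    · obtain ⟨n, hn, rfl⟩ := hex
      rw [sum_batch p n (B n) (fun y => (2 : ℝ) ^ ((f y : ℝ) - 1))]
      have hb : (0 : ℝ) < B n := by exact_mod_cast hB_pos n hn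
      set k : ℝ := (Fintype.card (Fin n → X) : ℝ) with hk
      have hk0 : 0 < k := by rw [hk]; exact_mod_cast Fintype.card_pos
      have hkX : k = (Fintype.card X : ℝ) ^ n := by rw [hk]; simp
      have hq' : (0 : ℝ) < q := by exact_mod_cast hq
      -- Without a witness the left side is `1 / 2`. With one, soundness gives `2 ^ ℓ ≤ √(B n / k) /
      -- q` and a deviation above `1 / q`, so the deviation pays for the score.
      have hpt : ∀ z : Fin (B n) → Fin n → X, (2 : ℝ) ^ ((f (batchWord z) : ℝ) - 1) ≤
          1 / 2 * (1 + √(B n / k) * ∑ a, |emp z a - iid p n a|) := by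
        intro z
        have hs : 0 ≤ √(B n / k) * ∑ a, |emp z a - iid p n a| := by positivity
        rw [Real.rpow_sub (by norm_num), Real.rpow_natCast, Real.rpow_one]
        rcases hf_eq (batchWord z) with h0 | ⟨w, hw, hwf⟩
        · rw [h0, pow_zero]
          linarith
        · obtain ⟨h4, hlt⟩ := hw.sound hB_pos hB_mono hp.1 hden_pos hle hq hn
          have h5 : (2 : ℝ) ^ f (batchWord z) ≤ √(B n / k) * (1 / q) := by
            rw [← hwf, mul_one_div, le_div_iff₀ hq']
            apply Real.le_sqrt_of_sq_le
            rw [le_div_iff₀ hk0, hkX]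
            have h6 : ((4 : ℝ) ^ w.1 * (Fintype.card X : ℝ) ^ n * (q : ℝ) ^ 2) ≤ B n := by
              exact_mod_cast h4
            calc ((2 : ℝ) ^ w.1 * q) ^ 2 * (Fintype.card X : ℝ) ^ n =
                (4 : ℝ) ^ w.1 * (Fintype.card X : ℝ) ^ n * (q : ℝ) ^ 2 := by
                  rw [mul_pow, ← pow_mul, mul_comm w.1 2, pow_mul]; norm_num; ring
              _ ≤ _ := h6
          have h7 := mul_le_mul_of_nonneg_left hlt.le (Real.sqrt_nonneg ((B n : ℝ) / k))
          linarith
      -- The mean deviation is at most `√(k / B n)`, which cancels the factor `√(B n / k)`: the two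
      -- halves add up to `1`.
      have hdev := mean_emp_dev_le (iid_mem hp n) (hB_pos n hn)
      rw [← hk] at hdev
      have hw := iid_mem (iid_mem hp n) (B n)
      calc ∑ z : Fin (B n) → Fin n → X,
            iid (iid p n) (B n) z * (2 : ℝ) ^ ((f (batchWord z) : ℝ) - 1)
          ≤ ∑ z : Fin (B n) → Fin n → X, iid (iid p n) (B n) z *
            (1 / 2 * (1 + √(B n / k) * ∑ a, |emp z a - iid p n a|)) :=
            Finset.sum_le_sum fun z _ => mul_le_mul_of_nonneg_left (hpt z) (hw.1 z)
        _ = 1 / 2 * (1 + √(B n / k) * ∑ z : Fin (B n) → Fin n → X, iid (iid p n) (B n) z *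
            ∑ a, |emp z a - iid p n a|) := by
            have : (1 : ℝ) = ∑ z, iid (iid p n) (B n) z := hw.2.symm
            conv_rhs => rw [this]
            rw [Finset.mul_sum (a := √(B n / k)), ← Finset.sum_add_distrib, ← this,
              Finset.mul_sum]
            exact Finset.sum_congr rfl fun z _ => by ring
        _ ≤ 1 / 2 * (1 + √(B n / k) * √(k / B n)) := by gcongr
        _ = 1 := by
            rw [← Real.sqrt_mul (by positivity), div_mul_div_cancel₀ hk0.ne', div_self hb.ne',
              Real.sqrt_one]
            norm_num
    · have h0 : ∀ x : Fin m → X, f (List.ofFn x) = 0 := by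
        intro x
        rcases hf_eq (List.ofFn x) with h | ⟨w, hw, _⟩
        · exact h
        · obtain ⟨h1, h2, _⟩ := hw.length_eq
          exact absurd ⟨w.2.1, h1, by simpa using h2⟩ hex
      simp only [h0, Nat.cast_zero, zero_sub]
      rw [← Finset.sum_mul, (iid_mem hp m).2, one_mul]
      exact Real.rpow_le_one_of_one_le_of_nonpos (by norm_num) (by norm_num)
  · obtain ⟨w, hw, hwℓ⟩ := exists_passes (B := B) hden_pos hlim hq hn (hB_pos n hn) hℓ hA
    have := hf_ge _ w hw
    have : (ℓ : ℝ) ≤ f (batchWord z) := by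
      rw [← hwℓ]; exact_mod_cast this
    linarith

/-- If the total variation exceeded `2 / q` at a large block length, the empirical frequency of an
optimal distinguishing event would betray it with probability at least `1 / 2`, pushing the mean
score above its bound `C`. The critic depends on `q` only, not on the block length or the event. -/
theorem achievableNearPerfect_of_algorithmic {p : X → ℝ} (hp : p ∈ stdSimplex ℝ X)
    (hp_pos : ∀ x, 0 < p x) (hp_comp : ComputableRealMap p) {d : X → X → ℝ} {B : ℕ → ℕ}
    (hB_comp : Computable B) (hB_pos : ∀ n, 1 ≤ n → 0 < B n)
    (hB_mono : ∀ m n, 1 ≤ m → m ≤ n → B m ≤ B n)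
    (hB_lim : Tendsto (fun n => (B n : ℝ) / (Fintype.card X : ℝ) ^ n) atTop atTop)
    {R Rc Δ : ℝ} (hRc : 0 ≤ Rc) (h : AchievableAlgorithmic p d R Rc B Δ) :
    AchievableNearPerfect p d R Rc Δ := by
  classical
  intro ε hε
  obtain ⟨c, hc, hscore⟩ := h ε hε
  refine ⟨c, ?_, ?_⟩
  · rwa [limsup_congr (v := fun n => distortion p d (c n))] at hc
    filter_upwards [eventually_ge_atTop 1] with n hn
    exact batchDistortion_eq (c n) hp hRc d (hB_pos n hn)
  rw [Metric.tendsto_atTop']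
  have hne : Nonempty X := by
    by_contra h
    rw [not_nonempty_iff] at h
    have := hp.2
    simp at this
  have hcard : (1 : ℝ) ≤ Fintype.card X := by exact_mod_cast Fintype.card_pos (α := X)
  intro η hη
  obtain ⟨q₀, hq₀⟩ := exists_nat_gt (2 / η)
  set q := q₀ + 1 with hqdef
  have hq : 0 < q := Nat.succ_pos _
  have hq' : (0 : ℝ) < q := by exact_mod_cast hq
  have hqη : 2 / (q : ℝ) < η := by
    rw [div_lt_iff₀ hq']
    rw [div_lt_iff₀ hη] at hq₀
    push_cast [hqdef]
    nlinarith
  obtain ⟨δ, hδ, hδc, hδ1, hδℓ⟩ :=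
    exists_empirical_critic hp hp_pos hp_comp hB_comp hB_pos hB_mono hq
  obtain ⟨C, hC⟩ := hscore δ hδ hδc
  -- Chosen so that the lower bound `ℓ / 2 - 1` on the mean score exceeds `C`.
  obtain ⟨ℓ, hℓ⟩ := exists_nat_gt (2 * (C + 1))
  -- The factor `4 ^ ℓ` unlocks the score `ℓ - 1`; the extra `4` ensures `q / √(B n) ≤ 1 / 2` in the
  -- deviation bound.
  have hev := hB_lim.eventually_ge_atTop ((4 : ℝ) ^ (ℓ + 1) * (q : ℝ) ^ 2)
  obtain ⟨n₀, hn₀⟩ := eventually_atTop.1 hev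
  refine ⟨max n₀ 1, fun n hn => ?_⟩
  have hn1 : 1 ≤ n := (le_max_right _ _).trans hn.le
  have hBn := hn₀ n ((le_max_left _ _).trans hn.le)
  rw [Real.dist_eq, sub_zero, abs_of_nonneg (tvDist_nonneg _ _)]
  refine lt_of_le_of_lt ?_ hqη
  by_contra! htv
  have hP := (c n).inducedY_mem hp hRc
  set P := (c n).inducedY p with hPdef
  obtain ⟨A, hA⟩ := exists_sum_sub_eq_tvDist hP (iid_mem hp n)
  have hb0 := hB_pos n hn1
  have hb : (0 : ℝ) < B n := by exact_mod_cast hb0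
  have hkn : (1 : ℝ) ≤ (Fintype.card X : ℝ) ^ n := one_le_pow₀ hcard
  rw [le_div_iff₀ (by linarith)] at hBn
  have hBℓ : 4 ^ ℓ * Fintype.card X ^ n * q ^ 2 ≤ B n := by
    have : (4 : ℝ) ^ ℓ * (Fintype.card X : ℝ) ^ n * (q : ℝ) ^ 2 ≤ B n := by
      refine le_trans ?_ hBn
      rw [pow_succ 4 ℓ]
      have : 0 ≤ (4 : ℝ) ^ ℓ * (Fintype.card X : ℝ) ^ n * (q : ℝ) ^ 2 := by positivity
      linarith
    exact_mod_cast this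
  have hB4 : 4 * (q : ℝ) ^ 2 ≤ B n := by
    refine le_trans ?_ hBn
    rw [pow_succ 4 ℓ]
    have h1 : (1 : ℝ) ≤ (4 : ℝ) ^ ℓ := one_le_pow₀ (by norm_num)
    have h2 : 0 ≤ 4 * (q : ℝ) ^ 2 := by positivity
    calc 4 * (q : ℝ) ^ 2 = 1 * (4 * (q : ℝ) ^ 2) * 1 := by ring
      _ ≤ (4 : ℝ) ^ ℓ * (4 * (q : ℝ) ^ 2) * (Fintype.card X : ℝ) ^ n := by gcongr
      _ = _ := by ring
  have : Nonempty (Fin (B n)) := ⟨⟨0, hb0⟩⟩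
  have hindic : ∑ a, P a * (if a ∈ A then (1 : ℝ) else 0) = ∑ a ∈ A, P a := by simp
  have hempA : ∀ z : Fin (B n) → Fin n → X, ∑ a ∈ A, emp z a = 1 / (B n : ℝ) *
      ∑ i, if z i ∈ A then (1 : ℝ) else 0 := fun z => by
    rw [sum_emp]; congr!
  -- `P` exceeds the source law on `A` by more than `2 / q`, so a batch with empirical excess at
  -- most `1 / q` deviates from `P` by at least `1 / q`.
  have hbad := prob_dev_le (ι := Fin (B n)) hP (fun a => if a ∈ A then (1 : ℝ) else 0)
    (γ := 1 / q) (by positivity)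
    (fun z => ¬ (1 / (q : ℝ) < ∑ a ∈ A, emp z a - ∑ a ∈ A, iid p n a)) (by
      intro z hz
      rw [hindic, Fintype.card_fin, ← hempA z]
      have h1 : 2 / (q : ℝ) = 1 / q + 1 / q := by ring
      rw [not_lt] at hz
      rw [abs_sub_comm]
      exact le_trans (by linarith) (le_abs_self _))
  have hbad2 : √((∑ a, P a * (if a ∈ A then (1 : ℝ) else 0) ^ 2) / Fintype.card (Fin (B n))) /
      (1 / (q : ℝ)) ≤ 1 / 2 := by
    rw [div_le_iff₀ (by positivity)]
    apply Real.sqrt_le_iff.2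
    refine ⟨by positivity, ?_⟩
    have h1 : ∑ a, P a * (if a ∈ A then (1 : ℝ) else 0) ^ 2 ≤ 1 := by
      refine (Finset.sum_le_sum fun a _ => mul_le_of_le_one_right (hP.1 a) ?_).trans hP.2.le
      split_ifs <;> norm_num
    rw [Fintype.card_fin, div_le_iff₀ hb]
    refine h1.trans ?_
    rw [mul_one_div, div_div, div_pow, one_pow, one_div, inv_mul_eq_div,
      le_div_iff₀ (by positivity)]
    linarith
  -- The score is at least `ℓ - 1` off the bad event and at least `-1` on it, and the bad event has
  -- probability at most `1 / 2`.
  have hscore_ge : (ℓ : ℝ) / 2 - 1 ≤ batchScore p δ (c n) (B n) := by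
    rw [batchScore_eq]
    have hw := iid_mem hP (B n)
    have hpt : ∀ z : Fin (B n) → Fin n → X,
        (ℓ : ℝ) - 1 - ℓ * (if ¬ (1 / (q : ℝ) < ∑ a ∈ A, emp z a - ∑ a ∈ A, iid p n a)
          then 1 else 0) ≤ δ (batchWord z) := by
      intro z
      split_ifs with hz
      · linarith [hδℓ n ℓ hn1 hBℓ z A hz]
      · linarith [hδ1 (batchWord z)]
    refine le_trans ?_ (Finset.sum_le_sum fun z _ => mul_le_mul_of_nonneg_left (hpt z) (hw.1 z))
    have hexp : ∑ z, iid P (B n) z * ((ℓ : ℝ) - 1 - ℓ * (if ¬ (1 / (q : ℝ) <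
        ∑ a ∈ A, emp z a - ∑ a ∈ A, iid p n a) then 1 else 0)) =
        ((ℓ : ℝ) - 1) - ℓ * ∑ z, iid P (B n) z * (if ¬ (1 / (q : ℝ) <
        ∑ a ∈ A, emp z a - ∑ a ∈ A, iid p n a) then 1 else 0) := by
      simp_rw [mul_sub ((iid P (B n)) _)]
      rw [Finset.sum_sub_distrib]
      simp_rw [mul_one]
      rw [Finset.sum_sub_distrib, ← Finset.sum_mul, hw.2, one_mul, Finset.mul_sum]
      congr 1
      exact Finset.sum_congr rfl fun z _ => by ring
    rw [hexp]
    have hbad3 := hbad.trans hbad2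
    have := mul_le_mul_of_nonneg_left hbad3 (Nat.cast_nonneg (α := ℝ) ℓ)
    simp only [iid] at this ⊢
    linarith
  have := hC n hn1
  linarith

end Critic

/-! ### Compactness of convex hulls in finite dimension -/

/-- By Carathéodory's theorem `finrank + 1` points suffice, so the hull is a continuous image of a
simplex times a power of `K`. -/
theorem isCompact_convexHull_of_finiteDimensional {E : Type*} [NormedAddCommGroup E]
    [NormedSpace ℝ E] [FiniteDimensional ℝ E] {K : Set E} (hK : IsCompact K) :
    IsCompact (convexHull ℝ K) := by
  rcases K.eq_empty_or_nonempty with rfl | ⟨z₀, hz₀⟩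
  · simp
  set N := Module.finrank ℝ E + 1 with hN
  let Ψ : (Fin N → ℝ) × (Fin N → E) → E := fun x => ∑ i, x.1 i • x.2 i
  have hΨ : Continuous Ψ := by fun_prop
  have hdom : IsCompact (stdSimplex ℝ (Fin N) ×ˢ Set.pi Set.univ fun _ : Fin N => K) :=
    (isCompact_stdSimplex ℝ (Fin N)).prod (isCompact_univ_pi fun _ => hK)
  convert hdom.image hΨ
  apply Set.Subset.antisymm
  · intro x hx
    obtain ⟨ι, _, z, w, hz, haff, hw0, hw1, rfl⟩ := eq_pos_convex_span_of_mem_convexHull hx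
    have hcard : Fintype.card ι ≤ Fintype.card (Fin N) := by
      have h1 := haff.card_le_finrank_succ
      have h2 := Submodule.finrank_le (vectorSpan ℝ (Set.range z))
      rw [Fintype.card_fin]
      omega
    obtain ⟨e⟩ := Function.Embedding.nonempty_of_card_le hcard
    have hew : ∀ i, Function.extend e w 0 (e i) = w i := e.injective.extend_apply w 0
    have hez : ∀ i, Function.extend e z (fun _ => z₀) (e i) = z i := e.injective.extend_apply z _
    have h0 : ∀ j, j ∉ Set.range e → Function.extend e w 0 j = 0 := fun j hj =>
      Function.extend_apply' _ _ _ hj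
    -- A shorter family is padded with weight `0` at `z₀`.
    refine ⟨(Function.extend e w 0, Function.extend e z fun _ => z₀), ⟨⟨fun j => ?_, ?_⟩,
      fun j _ => ?_⟩, ?_⟩
    · by_cases hj : j ∈ Set.range e
      · obtain ⟨i, rfl⟩ := hj
        change 0 ≤ Function.extend e w 0 (e i)
        rw [hew]
        exact (hw0 i).le
      · exact (h0 j hj).ge
    · rw [← hw1]
      exact (Fintype.sum_of_injective e e.injective _ _ h0 fun i => (hew i).symm).symm
    · by_cases hj : j ∈ Set.range e
      · obtain ⟨i, rfl⟩ := hj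
        change Function.extend e z (fun _ => z₀) (e i) ∈ K
        rw [hez]
        exact hz ⟨i, rfl⟩
      · simp only [Function.extend_apply' _ _ _ hj]
        exact hz₀
    · refine (Fintype.sum_of_injective e e.injective _ _ (fun j hj => ?_) fun i => ?_).symm
      · simp [h0 j hj]
      · simp [hew, hez]
  · rintro _ ⟨⟨w, z⟩, ⟨hw, hz⟩, rfl⟩
    exact (convex_convexHull ℝ K).sum_mem (fun i _ => hw.1 i) hw.2
      fun i _ => subset_convexHull ℝ K (hz i (Set.mem_univ i))

/-! ### The region in terms of mixtures of product distributions -/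

section Region

variable {X : Type*} [Fintype X]

/-- The relative entropy, in bits, of `q` with respect to `p`. -/
def relEnt (p q : X → ℝ) : ℝ := ∑ x, q x * Real.logb 2 (q x / p x)

/-- The triplet `t` is attained by the mixture with weights `w` of the products `q v ⊗ r v`. -/
structure IsMixture {V : Type*} [Fintype V] (p : X → ℝ) (d : X → X → ℝ) (w : V → ℝ)
    (q r : V → X → ℝ) (t : ℝ × ℝ × ℝ) : Prop where
  w_mem : w ∈ stdSimplex ℝ V
  q_mem : ∀ v, q v ∈ stdSimplex ℝ X
  r_mem : ∀ v, r v ∈ stdSimplex ℝ X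
  q_avg : ∀ x, ∑ v, w v * q v x = p x
  r_avg : ∀ y, ∑ v, w v * r v y = p y
  q_ent : ∑ v, w v * relEnt p (q v) ≤ t.1
  r_ent : ∑ v, w v * relEnt p (r v) ≤ t.1 + t.2.1
  dist_le : ∑ v, w v * (∑ x, ∑ y, q v x * r v y * d x y) ≤ t.2.2

/-- The factor `w v` cancels inside the logarithm, leaving the divergence of the conditional law
from the marginal; terms with `w v = 0` vanish on both sides. -/
theorem mutualInfo_eq_sum_relEnt {V : Type*} [Fintype V] {p : X → ℝ} {w : V → ℝ}
    {k : V → X → ℝ} (hk : ∀ v, ∑ x, k v x = 1) (havg : ∀ x, ∑ v, w v * k v x = p x)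
    (A : X × V → ℝ) (hA : ∀ x v, A (x, v) = w v * k v x) :
    mutualInfo A = ∑ v, w v * relEnt p (k v) := by
  unfold mutualInfo relEnt
  simp only [hA, havg, ← Finset.mul_sum, hk, mul_one]
  rw [Finset.sum_comm]
  refine Finset.sum_congr rfl fun v _ => ?_
  rw [Finset.mul_sum]
  refine Finset.sum_congr rfl fun x _ => ?_
  by_cases hw : w v = 0
  · simp [hw]
  · rw [mul_comm (p x), mul_div_mul_left _ _ hw, mul_assoc]

theorem IsMixture.mem_region {V : Type*} [Fintype V] {p : X → ℝ} (hp_pos : ∀ x, 0 < p x)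
    {d : X → X → ℝ} {w : V → ℝ} {q r : V → X → ℝ} {t : ℝ × ℝ × ℝ} (h : IsMixture p d w q r t)
    (ht : 0 ≤ t.2.1) : t ∈ region p d := by
  let e := Fintype.equivFin V
  -- Bayes' rule; positivity of `p x` makes it a conditional law.
  let W : X → X × Fin (Fintype.card V) → ℝ := fun x yv =>
    w (e.symm yv.2) * q (e.symm yv.2) x * r (e.symm yv.2) yv.1 / p x
  have hJ : ∀ x y v, jointXYV p W x y v = w (e.symm v) * q (e.symm v) x * r (e.symm v) y := by
    intro x y v
    have := (hp_pos x).ne'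
    simp only [jointXYV, W]
    field_simp
  have hq1 : ∀ v, ∑ x, q v x = 1 := fun v => (h.q_mem v).2
  have hr1 : ∀ v, ∑ x, r v x = 1 := fun v => (h.r_mem v).2
  have hJy : ∀ x v, ∑ y, jointXYV p W x y v = w (e.symm v) * q (e.symm v) x := by
    intro x v
    simp only [hJ, ← Finset.mul_sum, hr1, mul_one]
  have hJx : ∀ y v, ∑ x, jointXYV p W x y v = w (e.symm v) * r (e.symm v) y := by
    intro y v
    simp only [hJ]
    rw [← Finset.sum_mul, ← Finset.mul_sum, hq1, mul_one]
  refine ⟨ht, Fintype.card V, W, fun x => ⟨fun yv => ?_, ?_⟩, fun y => ?_, ?_, ?_, ?_, ?_⟩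
  · exact div_nonneg (mul_nonneg (mul_nonneg (h.w_mem.1 _) ((h.q_mem _).1 _))
      ((h.r_mem _).1 _)) (hp_pos x).le
  · rw [Fintype.sum_prod_type, Finset.sum_comm]
    simp only [W]
    simp_rw [← Finset.sum_div, ← Finset.mul_sum, hr1, mul_one]
    rw [e.symm.sum_comp (fun v => w v * q v x), h.q_avg, div_self (hp_pos x).ne']
  · rw [Finset.sum_comm]
    simp_rw [hJx]
    rw [e.symm.sum_comp (fun v => w v * r v y), h.r_avg]
  · rw [mutualInfo_eq_sum_relEnt (p := p) (w := fun v => w (e.symm v)) (k := fun v => q (e.symm v))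
      (fun v => hq1 _) (fun x => by rw [e.symm.sum_comp (fun v => w v * q v x), h.q_avg]) _ hJy,
      e.symm.sum_comp (fun v => w v * relEnt p (q v))]
    exact h.q_ent
  · rw [mutualInfo_eq_sum_relEnt (p := p) (w := fun v => w (e.symm v)) (k := fun v => r (e.symm v))
      (fun v => hr1 _) (fun x => by rw [e.symm.sum_comp (fun v => w v * r v x), h.r_avg]) _ hJx,
      e.symm.sum_comp (fun v => w v * relEnt p (r v))]
    exact h.r_ent
  · refine le_trans (le_of_eq ?_) h.dist_le
    rw [← e.symm.sum_comp]
    simp_rw [hJ, Finset.mul_sum]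
    conv_rhs => rw [Finset.sum_comm]
    refine Finset.sum_congr rfl fun x _ => ?_
    conv_rhs => rw [Finset.sum_comm]
    exact Finset.sum_congr rfl fun y _ => Finset.sum_congr rfl fun v _ => by ring
  · intro x y v
    have : ∑ x', ∑ y', jointXYV p W x' y' v = w (e.symm v) := by
      simp_rw [hJy]
      rw [← Finset.mul_sum, hq1, mul_one]
    rw [this, hJy, hJx, hJ]
    ring

theorem exists_isMixture_of_mem_region {p : X → ℝ} (hp : p ∈ stdSimplex ℝ X) {d : X → X → ℝ}
    {t : ℝ × ℝ × ℝ} (ht : t ∈ region p d) :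
    ∃ (s : ℕ) (w : Fin s → ℝ) (q r : Fin s → X → ℝ), IsMixture p d w q r t := by
  obtain ⟨-, s, W, hW, hY, hI1, hI2, hd, hM⟩ := ht
  set Q : X → X → Fin s → ℝ := jointXYV p W with hQ
  have hQ0 : ∀ x y v, 0 ≤ Q x y v := fun x y v => mul_nonneg (hp.1 x) ((hW x).1 _)
  set P : Fin s → ℝ := fun v => ∑ x, ∑ y, Q x y v with hP
  have hP0 : ∀ v, 0 ≤ P v := fun v =>
    Finset.sum_nonneg fun x _ => Finset.sum_nonneg fun y _ => hQ0 x y v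
  have hPzero : ∀ v, P v = 0 → ∀ x y, Q x y v = 0 := by
    intro v hv x y
    have h1 := (Finset.sum_eq_zero_iff_of_nonneg fun x _ =>
      Finset.sum_nonneg fun y _ => hQ0 x y v).1 hv x (Finset.mem_univ x)
    exact (Finset.sum_eq_zero_iff_of_nonneg fun y _ => hQ0 x y v).1 h1 y (Finset.mem_univ y)
  -- Conditional laws given `v`. On null `v` any law would do; `p` keeps `q v` and `r v` in the
  -- simplex.
  set q : Fin s → X → ℝ := fun v x => if P v = 0 then p x else (∑ y, Q x y v) / P v with hq
  set r : Fin s → X → ℝ := fun v y => if P v = 0 then p y else (∑ x, Q x y v) / P v with hr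
  have hPq : ∀ x v, ∑ y, Q x y v = P v * q v x := by
    intro x v
    by_cases hv : P v = 0
    · rw [hv, zero_mul]
      exact Finset.sum_eq_zero fun y _ => hPzero v hv x y
    · simp only [hq, if_neg hv]
      field_simp
  have hPr : ∀ y v, ∑ x, Q x y v = P v * r v y := by
    intro y v
    by_cases hv : P v = 0
    · rw [hv, zero_mul]
      exact Finset.sum_eq_zero fun x _ => hPzero v hv x y
    · simp only [hr, if_neg hv]
      field_simp
  have hqm : ∀ v, q v ∈ stdSimplex ℝ X := by
    intro v
    by_cases hv : P v = 0
    · have : q v = p := by funext x; simp [hq, hv]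
      rw [this]; exact hp
    · refine ⟨fun x => ?_, ?_⟩
      · simp only [hq, if_neg hv]
        exact div_nonneg (Finset.sum_nonneg fun y _ => hQ0 x y v) (hP0 v)
      · simp only [hq, if_neg hv]
        rw [← Finset.sum_div]
        exact div_self hv
  have hrm : ∀ v, r v ∈ stdSimplex ℝ X := by
    intro v
    by_cases hv : P v = 0
    · have : r v = p := by funext x; simp [hr, hv]
      rw [this]; exact hp
    · refine ⟨fun x => ?_, ?_⟩
      · simp only [hr, if_neg hv]
        exact div_nonneg (Finset.sum_nonneg fun y _ => hQ0 y x v) (hP0 v)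
      · simp only [hr, if_neg hv]
        rw [← Finset.sum_div, Finset.sum_comm]
        exact div_self hv
  have hsumx : ∀ x, ∑ v, P v * q v x = p x := by
    intro x
    simp_rw [← hPq]
    have h1 := (hW x).2
    rw [Fintype.sum_prod_type, Finset.sum_comm] at h1
    simp only [hQ, jointXYV, ← Finset.mul_sum]
    rw [h1, mul_one]
  have hsumy : ∀ y, ∑ v, P v * r v y = p y := by
    intro y
    simp_rw [← hPr]
    rw [Finset.sum_comm]
    exact hY y
  refine ⟨s, P, q, r, ⟨⟨hP0, ?_⟩, hqm, hrm, hsumx, hsumy, ?_, ?_, ?_⟩⟩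
  · calc ∑ v, P v = ∑ v, ∑ x, P v * q v x :=
          Finset.sum_congr rfl fun v _ => by rw [← Finset.mul_sum, (hqm v).2, mul_one]
      _ = ∑ x, p x := by rw [Finset.sum_comm]; exact Finset.sum_congr rfl fun x _ => hsumx x
      _ = 1 := hp.2
  · rw [← mutualInfo_eq_sum_relEnt (fun v => (hqm v).2) hsumx
      (fun a : X × Fin s => ∑ y, Q a.1 y a.2) hPq]
    exact hI1
  · rw [← mutualInfo_eq_sum_relEnt (fun v => (hrm v).2) hsumy
      (fun a : X × Fin s => ∑ x, Q x a.1 a.2) hPr]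
    exact hI2
  · refine le_trans (le_of_eq ?_) hd
    -- The Markov condition divided by `P v`.
    have hQe : ∀ x y v, Q x y v = P v * (q v x * r v y) := by
      intro x y v
      by_cases hv : P v = 0
      · rw [hPzero v hv, hv, zero_mul]
      · have h1 := hM x y v
        rw [hPq, hPr] at h1
        have h2 : Q x y v * P v = P v * (q v x * r v y) * P v := by
          rw [show ∑ x', ∑ y', Q x' y' v = P v from rfl] at h1
          rw [h1]; ring
        exact mul_right_cancel₀ hv h2
    simp_rw [hQe, Finset.mul_sum]
    rw [Finset.sum_comm]
    refine Finset.sum_congr rfl fun x _ => ?_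
    rw [Finset.sum_comm]
    exact Finset.sum_congr rfl fun y _ => Finset.sum_congr rfl fun v _ => by ring

/-- Each term is a multiple of `u log u` at `u = q x / p x`, which is continuous at `0` too. -/
theorem continuous_relEnt {p : X → ℝ} (hp_pos : ∀ x, 0 < p x) : Continuous (relEnt p) := by
  unfold relEnt
  refine continuous_finsetSum _ fun x _ => ?_
  have h : ∀ q : X → ℝ, q x * Real.logb 2 (q x / p x) =
      p x * ((q x / p x) * Real.log (q x / p x)) / Real.log 2 := by
    intro q
    have := (hp_pos x).ne'
    rw [Real.logb]
    field_simp
  simp_rw [h]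
  have := Real.continuous_mul_log.comp ((continuous_apply (A := fun _ : X => ℝ) x).div_const (p x))
  exact ((continuous_const.mul this).div_const _)

/-- The points `(q, r, D(q‖p), D(r‖p), E[d])` of the product distributions `q ⊗ r`. -/
def productPoints (p : X → ℝ) (d : X → X → ℝ) : Set ((X → ℝ) × (X → ℝ) × ℝ × ℝ × ℝ) :=
  (fun z : (X → ℝ) × (X → ℝ) =>
    (z.1, z.2, relEnt p z.1, relEnt p z.2, ∑ x, ∑ y, z.1 x * z.2 y * d x y)) ''
    (stdSimplex ℝ X ×ˢ stdSimplex ℝ X)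

/-- The constraints are averages over `v` of functions of `(q v, r v)`, so only a barycentre
matters. This removes the unbounded alphabet of `V` from the description. -/
theorem mem_region_iff_convexHull {p : X → ℝ} (hp : p ∈ stdSimplex ℝ X) (hp_pos : ∀ x, 0 < p x)
    {d : X → X → ℝ} (t : ℝ × ℝ × ℝ) :
    t ∈ region p d ↔ 0 ≤ t.2.1 ∧ ∃ e ∈ convexHull ℝ (productPoints p d),
      e.1 = p ∧ e.2.1 = p ∧ e.2.2.1 ≤ t.1 ∧ e.2.2.2.1 ≤ t.1 + t.2.1 ∧ e.2.2.2.2 ≤ t.2.2 := by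
  constructor
  · intro ht
    refine ⟨ht.1, ?_⟩
    obtain ⟨s, w, q, r, h⟩ := exists_isMixture_of_mem_region hp ht
    refine ⟨∑ v, w v • (q v, r v, relEnt p (q v), relEnt p (r v),
      ∑ x, ∑ y, q v x * r v y * d x y), ?_, ?_, ?_, ?_, ?_, ?_⟩
    · exact (convex_convexHull ℝ _).sum_mem (fun v _ => h.w_mem.1 v) h.w_mem.2 fun v _ =>
        subset_convexHull ℝ _ ⟨(q v, r v), ⟨h.q_mem v, h.r_mem v⟩, rfl⟩
    · funext x
      simpa [Prod.fst_sum] using h.q_avg x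
    · funext x
      simpa [Prod.fst_sum, Prod.snd_sum] using h.r_avg x
    · simpa [Prod.fst_sum, Prod.snd_sum] using h.q_ent
    · simpa [Prod.fst_sum, Prod.snd_sum] using h.r_ent
    · simpa [Prod.fst_sum, Prod.snd_sum] using h.dist_le
  · rintro ⟨ht, e, he, h1, h2, h3, h4, h5⟩
    obtain ⟨ι, _, w, z, hw0, hw1, hz, rfl⟩ := mem_convexHull_iff_exists_fintype.1 he
    choose u hu huz using hz
    have hz' : ∀ i, z i = ((u i).1, (u i).2, relEnt p (u i).1, relEnt p (u i).2,
      ∑ x, ∑ y, (u i).1 x * (u i).2 y * d x y) := fun i => (huz i).symm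
    refine IsMixture.mem_region (V := ι) (w := w) (q := fun i => (u i).1) (r := fun i => (u i).2)
      hp_pos ⟨⟨hw0, hw1⟩, fun i => (hu i).1, fun i => (hu i).2, fun x => ?_, fun x => ?_, ?_, ?_,
        ?_⟩ ht
    · simpa [Prod.fst_sum, hz'] using congrFun h1 x
    · simpa [Prod.fst_sum, Prod.snd_sum, hz'] using congrFun h2 x
    · simpa [Prod.fst_sum, Prod.snd_sum, hz'] using h3
    · simpa [Prod.fst_sum, Prod.snd_sum, hz'] using h4
    · simpa [Prod.fst_sum, Prod.snd_sum, hz'] using h5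

/-- Along a convergent sequence the barycentres stay in a compact hull, so a subsequence converges,
and the equalities and weak inequalities pass to the limit. -/
theorem isClosed_region {p : X → ℝ} (hp : p ∈ stdSimplex ℝ X) (hp_pos : ∀ x, 0 < p x)
    (d : X → X → ℝ) : IsClosed (region p d) := by
  have hK : IsCompact (productPoints p d) := by
    refine ((isCompact_stdSimplex ℝ X).prod (isCompact_stdSimplex ℝ X)).image ?_
    have := continuous_relEnt hp_pos
    fun_prop
  have hC := isCompact_convexHull_of_finiteDimensional hK
  have hS : IsClosed {z : (ℝ × ℝ × ℝ) × ((X → ℝ) × (X → ℝ) × ℝ × ℝ × ℝ) |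
      0 ≤ z.1.2.1 ∧ z.2.1 = p ∧ z.2.2.1 = p ∧ z.2.2.2.1 ≤ z.1.1 ∧
        z.2.2.2.2.1 ≤ z.1.1 + z.1.2.1 ∧ z.2.2.2.2.2 ≤ z.1.2.2} := by
    refine IsClosed.and (isClosed_le (by fun_prop) (by fun_prop)) <|
      IsClosed.and (isClosed_eq (by fun_prop) (by fun_prop)) <|
      IsClosed.and (isClosed_eq (by fun_prop) (by fun_prop)) <|
      IsClosed.and (isClosed_le (by fun_prop) (by fun_prop)) <|
      IsClosed.and (isClosed_le (by fun_prop) (by fun_prop))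
        (isClosed_le (by fun_prop) (by fun_prop))
  refine IsSeqClosed.isClosed fun u t hu hut => ?_
  choose h0 e he h1 h2 h3 h4 h5 using fun n => (mem_region_iff_convexHull hp hp_pos (u n)).1 (hu n)
  obtain ⟨e₀, he₀, φ, hφ, hlim⟩ := hC.tendsto_subseq he
  have hmem := hS.mem_of_tendsto ((hut.comp hφ.tendsto_atTop).prodMk_nhds hlim)
    (Eventually.of_forall fun n => ⟨h0 (φ n), h1 (φ n), h2 (φ n), h3 (φ n), h4 (φ n), h5 (φ n)⟩)
  exact (mem_region_iff_convexHull hp hp_pos t).2 ⟨hmem.1, e₀, he₀, hmem.2⟩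

theorem relEnt_nonneg {p q : X → ℝ} (hp : p ∈ stdSimplex ℝ X) (hp_pos : ∀ x, 0 < p x)
    (hq : q ∈ stdSimplex ℝ X) : 0 ≤ relEnt p q := by
  have h := sum_weight_logb_le hq (fun x => if q x = 0 then 0 else p x / q x) (b := 1)
    (fun x hx => by simpa [hx.ne'] using div_pos (hp_pos x) hx) (by
      rw [← hp.2]
      refine Finset.sum_le_sum fun x _ => ?_
      split_ifs with h
      · simpa using hp.1 x
      · rw [mul_div_cancel₀ _ h])
  rw [Real.logb_one] at h
  have h2 : relEnt p q = -∑ x, q x * Real.logb 2 (if q x = 0 then 0 else p x / q x) := by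
    rw [relEnt, ← Finset.sum_neg_distrib]
    refine Finset.sum_congr rfl fun x _ => ?_
    split_ifs with h
    · simp [h]
    · rw [← mul_neg, ← Real.logb_inv, inv_div]
  linarith

theorem region_nonneg {p : X → ℝ} (hp : p ∈ stdSimplex ℝ X) (hp_pos : ∀ x, 0 < p x)
    {d : X → X → ℝ} (hd : ∀ x y, 0 ≤ d x y) {t : ℝ × ℝ × ℝ} (ht : t ∈ region p d) :
    0 ≤ t.1 ∧ 0 ≤ t.2.1 ∧ 0 ≤ t.2.2 := by
  obtain ⟨s, w, q, r, h⟩ := exists_isMixture_of_mem_region hp ht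
  refine ⟨le_trans ?_ h.q_ent, ht.1, le_trans ?_ h.dist_le⟩
  · exact Finset.sum_nonneg fun v _ =>
      mul_nonneg (h.w_mem.1 v) (relEnt_nonneg hp hp_pos (h.q_mem v))
  · exact Finset.sum_nonneg fun v _ => mul_nonneg (h.w_mem.1 v) <|
      Finset.sum_nonneg fun x _ => Finset.sum_nonneg fun y _ =>
        mul_nonneg (mul_nonneg ((h.q_mem v).1 x) ((h.r_mem v).1 y)) (hd x y)

end Region

/-! ### Converse: perfect codes yield points of the region -/

section Marginal

variable {X : Type*} [Fintype X] {n : ℕ}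

open Classical in
/-- The law of the `t`-th letter of a random word with law `k`. -/
def marginal (t : Fin n) (k : (Fin n → X) → ℝ) (a : X) : ℝ :=
  ∑ x : Fin n → X, if x t = a then k x else 0

theorem sum_marginal_mul (t : Fin n) (k : (Fin n → X) → ℝ) (f : X → ℝ) :
    ∑ a, marginal t k a * f a = ∑ x, k x * f (x t) := by
  classical
  simp only [marginal, Finset.sum_mul]
  rw [Finset.sum_comm]
  refine Finset.sum_congr rfl fun x _ => ?_
  simp

theorem marginal_mem (t : Fin n) {k : (Fin n → X) → ℝ} (hk : k ∈ stdSimplex ℝ (Fin n → X)) :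
    marginal t k ∈ stdSimplex ℝ X := by
  refine ⟨fun a => Finset.sum_nonneg fun x _ => ?_, ?_⟩
  · split_ifs
    · exact hk.1 x
    · exact le_rfl
  · simpa [hk.2] using sum_marginal_mul t k (fun _ => 1)

theorem le_marginal (t : Fin n) {k : (Fin n → X) → ℝ} (hk : k ∈ stdSimplex ℝ (Fin n → X))
    (x : Fin n → X) : k x ≤ marginal t k (x t) := by
  classical
  refine le_trans (by simp) (Finset.single_le_sum (f := fun x' : Fin n → X =>
    if x' t = x t then k x' else 0) (fun x' _ => ?_) (Finset.mem_univ x))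
  · split_ifs
    · exact hk.1 x'
    · exact le_rfl

theorem marginal_iid {p : X → ℝ} (hp : p ∈ stdSimplex ℝ X) (t : Fin n) :
    marginal t (iid p n) = p := by
  classical
  funext a
  have h := sum_prod_weight_single (ι := Fin n) hp.2 (fun x => if x = a then (1 : ℝ) else 0) t
  simp only [mul_ite, mul_one, mul_zero, Finset.sum_ite_eq', Finset.mem_univ, if_true] at h
  rw [← h]
  unfold marginal iid
  congr!

theorem marginal_sum {U : Type*} [Fintype U] (w : U → ℝ) (k : U → (Fin n → X) → ℝ) (t : Fin n)
    (a : X) :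
    ∑ u, w u * marginal t (k u) a = marginal t (fun x => ∑ u, w u * k u x) a := by
  classical
  simp only [marginal, Finset.mul_sum]
  rw [Finset.sum_comm]
  refine Finset.sum_congr rfl fun x _ => ?_
  split_ifs <;> simp

/-- If `w ⊗ k ≤ p^{⊗ n} ⊗ b` then the mean relative entropies of the marginals of the `k u` add up
to at most the logarithm of the mass of `b`. -/
theorem sum_relEnt_marginal_le {U : Type*} [Fintype U] {p : X → ℝ}
    (hp_pos : ∀ x, 0 < p x) {w : U → ℝ} (hw : w ∈ stdSimplex ℝ U) {k : U → (Fin n → X) → ℝ}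
    (hk : ∀ u, k u ∈ stdSimplex ℝ (Fin n → X)) {b : U → ℝ}
    (hb : ∀ u x, w u * k u x ≤ iid p n x * b u) {C : ℝ} (hC : ∑ u, b u ≤ C) :
    ∑ u, w u * ∑ t, relEnt p (marginal t (k u)) ≤ Real.logb 2 C := by
  classical
  have hpn : ∀ x : Fin n → X, 0 < iid p n x := fun x => Finset.prod_pos fun i _ => hp_pos _
  set W : U × (Fin n → X) → ℝ := fun z => w z.1 * k z.1 z.2 with hW
  have hWm : W ∈ stdSimplex ℝ (U × (Fin n → X)) := by
    refine ⟨fun z => mul_nonneg (hw.1 _) ((hk _).1 _), ?_⟩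
    rw [Fintype.sum_prod_type]
    simp only [hW, ← Finset.mul_sum, (hk _).2, mul_one, hw.2]
  -- The mean of `log Z` is the sum of divergences to be bounded. Bounding the mean of `Z` and
  -- applying Jensen replaces the chain rule for entropies.
  set Z : U × (Fin n → X) → ℝ := fun z => ∏ t, (marginal t (k z.1) (z.2 t) / p (z.2 t)) with hZ
  have hmpos : ∀ z, 0 < W z → ∀ t, 0 < marginal t (k z.1) (z.2 t) := by
    intro z hz t
    refine lt_of_lt_of_le ?_ (le_marginal t (hk z.1) z.2)
    rcases ((hk z.1).1 z.2).eq_or_lt with h | h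
    · simp [hW, ← h] at hz
    · exact h
  have hZpos : ∀ z, 0 < W z → 0 < Z z := fun z hz =>
    Finset.prod_pos fun t _ => div_pos (hmpos z hz t) (hp_pos _)
  have hZ0 : ∀ z, 0 ≤ Z z := fun z =>
    Finset.prod_nonneg fun t _ => div_nonneg ((marginal_mem t (hk z.1)).1 _) (hp_pos _).le
  have hsum : ∑ z, W z * Z z ≤ C := by
    refine le_trans ?_ hC
    rw [Fintype.sum_prod_type]
    refine Finset.sum_le_sum fun u _ => ?_
    -- After `hb` the source law cancels the denominators of `Z`; what remains is a product of
    -- marginals, of total mass one.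
    calc ∑ x, W (u, x) * Z (u, x) ≤ ∑ x : Fin n → X, b u * ∏ t, marginal t (k u) (x t) := by
          refine Finset.sum_le_sum fun x _ => ?_
          refine (mul_le_mul_of_nonneg_right (hb u x) (hZ0 (u, x))).trans (le_of_eq ?_)
          simp only [hZ, Finset.prod_div_distrib]
          have : ∏ t, p (x t) ≠ 0 := (hpn x).ne'
          rw [iid]
          field_simp
      _ = b u := by
          rw [← Finset.mul_sum, sum_pi_prod (fun t => marginal t (k u))]
          simp [(marginal_mem _ (hk u)).2]
  refine le_trans (le_of_eq ?_) (sum_weight_logb_le hWm Z hZpos hsum)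
  rw [Fintype.sum_prod_type]
  refine Finset.sum_congr rfl fun u _ => ?_
  have h1 : ∀ t, relEnt p (marginal t (k u)) =
      ∑ x, k u x * Real.logb 2 (marginal t (k u) (x t) / p (x t)) := fun t =>
    sum_marginal_mul t (k u) (fun a => Real.logb 2 (marginal t (k u) a / p a))
  simp_rw [h1]
  rw [Finset.sum_comm, Finset.mul_sum]
  refine Finset.sum_congr rfl fun x _ => ?_
  rw [← Finset.mul_sum]
  simp only [hW]
  rw [mul_assoc]
  rcases (hWm.1 (u, x)).eq_or_lt with h | h
  · rw [← mul_assoc, ← mul_assoc]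
    simp only [hW] at h
    rw [← h]; simp
  · congr 2
    rw [Real.logb_prod]
    exact fun t _ => (div_pos (hmpos _ h t) (hp_pos _)).ne'

end Marginal

/-! ### Single-letter bounds from a perfect code -/

section Converse

variable {X : Type*} [Fintype X] {n : ℕ} {R Rc : ℝ}

theorem logb_indexCard_le {n : ℕ} {R : ℝ} (hR : 0 ≤ R) :
    Real.logb 2 (indexCard n R) ≤ n * R := by
  have hpos : (0 : ℝ) < indexCard n R := by exact_mod_cast indexCard_pos n hR
  rw [Real.logb_le_iff_le_rpow (by norm_num) hpos]
  exact Nat.floor_le (by positivity)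

/-- Take `V = (J, M, T)` with `T` a uniform time index. Given `(J, M)`, source and reconstruction
are independent, so their `T`-th letters form a mixture of products. Perfect realism gives the
reconstructed letter the law `p`. -/
theorem Code.mem_region_of_perfect (c : Code X n R Rc) (hn : 1 ≤ n) (hR : 0 ≤ R) (hRc : 0 ≤ Rc)
    {p : X → ℝ} (hp : p ∈ stdSimplex ℝ X) (hp_pos : ∀ x, 0 < p x) (d : X → X → ℝ)
    (hY : c.inducedY p = iid p n) : (R, Rc, distortion p d c) ∈ region p d := by
  classical
  set J := indexCard n Rc with hJ
  set M := indexCard n R with hM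
  have hJ0 : (0 : ℝ) < J := by exact_mod_cast indexCard_pos n hRc
  have hM0 : (0 : ℝ) < M := by exact_mod_cast indexCard_pos n hR
  have hn0 : (0 : ℝ) < n := by exact_mod_cast hn
  have hpn : ∀ x : Fin n → X, 0 ≤ iid p n x := (iid_mem hp n).1
  -- Joint law of `(J, M)` and the source word; `w` is its marginal, `k` and `l` the conditional
  -- laws of source and reconstruction.
  set g : Fin J × Fin M → (Fin n → X) → ℝ := fun u x => iid p n x * (1 / J) * c.enc x u.1 u.2
    with hg
  have hg0 : ∀ u x, 0 ≤ g u x := fun u x =>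
    mul_nonneg (mul_nonneg (hpn x) (by positivity)) ((c.enc_mem x u.1).1 _)
  set w : Fin J × Fin M → ℝ := fun u => ∑ x, g u x with hw
  set k : Fin J × Fin M → (Fin n → X) → ℝ := fun u x =>
    if w u = 0 then iid p n x else g u x / w u with hk
  set l : Fin J × Fin M → (Fin n → X) → ℝ := fun u => c.dec u.2 u.1 with hl
  have hw0 : ∀ u, 0 ≤ w u := fun u => Finset.sum_nonneg fun x _ => hg0 u x
  have hwk : ∀ u x, w u * k u x = g u x := by
    intro u x
    by_cases h : w u = 0
    · rw [h, zero_mul]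
      exact ((Finset.sum_eq_zero_iff_of_nonneg fun x _ => hg0 u x).1 h x (Finset.mem_univ x)).symm
    · simp only [hk, if_neg h]
      field_simp
  have hkm : ∀ u, k u ∈ stdSimplex ℝ (Fin n → X) := by
    intro u
    by_cases h : w u = 0
    · have : k u = iid p n := by funext x; simp [hk, h]
      rw [this]; exact iid_mem hp n
    · refine ⟨fun x => ?_, ?_⟩
      · simp only [hk, if_neg h]
        exact div_nonneg (hg0 u x) (hw0 u)
      · simp only [hk, if_neg h]
        rw [← Finset.sum_div]
        exact div_self h
  have hlm : ∀ u, l u ∈ stdSimplex ℝ (Fin n → X) := fun u => c.dec_mem _ _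
  have hgsum : ∀ x, ∑ u, g u x = iid p n x := by
    intro x
    simp only [hg, Fintype.sum_prod_type, ← Finset.mul_sum]
    rw [Finset.sum_congr rfl fun j _ => (c.enc_mem x j).2]
    simp only [Finset.sum_const, Finset.card_univ, Fintype.card_fin, nsmul_eq_mul, mul_one]
    field_simp
    rfl
  have hwm : w ∈ stdSimplex ℝ (Fin J × Fin M) := by
    refine ⟨hw0, ?_⟩
    rw [hw, Finset.sum_comm, Finset.sum_congr rfl fun x _ => hgsum x, (iid_mem hp n).2]
  have hXY : ∀ x y, c.inducedXY p (x, y) = ∑ u, w u * (k u x * l u y) := by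
    intro x y
    simp_rw [← mul_assoc, hwk]
    rw [Fintype.sum_prod_type]
    rfl
  have hlsum : ∀ y, ∑ u, w u * l u y = iid p n y := by
    intro y
    rw [← hY, Code.inducedY]
    simp_rw [hXY]
    rw [Finset.sum_comm]
    refine Finset.sum_congr rfl fun u _ => ?_
    rw [← Finset.mul_sum, ← Finset.sum_mul, (hkm u).2, one_mul]
  have hent : ∀ (κ : Fin J × Fin M → (Fin n → X) → ℝ),
      ∑ v : (Fin J × Fin M) × Fin n, w v.1 / n * relEnt p (marginal v.2 (κ v.1)) =
        (∑ u, w u * ∑ t, relEnt p (marginal t (κ u))) / n := by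
    intro κ
    rw [Fintype.sum_prod_type, Finset.sum_div]
    refine Finset.sum_congr rfl fun u _ => ?_
    rw [Finset.mul_sum, Finset.sum_div]
    exact Finset.sum_congr rfl fun t _ => by ring
  have havg : ∀ (κ : Fin J × Fin M → (Fin n → X) → ℝ), (∀ x, ∑ u, w u * κ u x = iid p n x) →
      ∀ a, ∑ v : (Fin J × Fin M) × Fin n, w v.1 / n * marginal v.2 (κ v.1) a = p a := by
    intro κ hκ a
    rw [Fintype.sum_prod_type, Finset.sum_comm]
    have h1 : ∀ t : Fin n, ∑ u, w u / n * marginal t (κ u) a = p a / n := by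
      intro t
      have h2 := marginal_sum w κ t a
      rw [funext hκ, marginal_iid hp] at h2
      rw [← h2, Finset.sum_div]
      exact Finset.sum_congr rfl fun u _ => by ring
    rw [Finset.sum_congr rfl fun t _ => h1 t]
    simp
    field_simp
  refine IsMixture.mem_region (V := (Fin J × Fin M) × Fin n) (w := fun v => w v.1 / n)
    (q := fun v => marginal v.2 (k v.1)) (r := fun v => marginal v.2 (l v.1)) hp_pos
    ⟨⟨fun v => div_nonneg (hw0 _) hn0.le, ?_⟩, fun v => marginal_mem _ (hkm _),
      fun v => marginal_mem _ (hlm _), havg k fun x => ?_, havg l hlsum, ?_, ?_, ?_⟩ hRc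
  · rw [Fintype.sum_prod_type]
    simp only [Finset.sum_const, Finset.card_univ, Fintype.card_fin, nsmul_eq_mul]
    rw [← Finset.mul_sum, ← Finset.sum_div, hwm.2]
    field_simp
  · simp_rw [hwk]; exact hgsum x
  · rw [hent, div_le_iff₀ hn0]
    -- Encoder probabilities are at most `1`, and the weight `1 / J` of the common randomness leaves
    -- total mass `M`, whence `n * R`.
    refine (sum_relEnt_marginal_le hp_pos hwm hkm (b := fun _ => 1 / J) (C := M)
      (fun u x => ?_) ?_).trans ?_
    · rw [hwk]
      refine mul_le_of_le_one_right (mul_nonneg (hpn x) (by positivity)) ?_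
      rw [← (c.enc_mem x u.1).2]
      exact Finset.single_le_sum (fun m _ => (c.enc_mem x u.1).1 m) (Finset.mem_univ _)
    · apply le_of_eq
      simp
      field_simp
    · exact (logb_indexCard_le hR).trans (by simp [mul_comm])
  · rw [hent, div_le_iff₀ hn0]
    -- By perfect realism a single term `w u * l u x` is at most `iid p n x`. There is no factor `1
    -- / J` now, so the mass is `J * M`.
    refine (sum_relEnt_marginal_le hp_pos hwm hlm (b := fun _ => 1) (C := J * M)
      (fun u x => ?_) ?_).trans ?_
    · rw [← hlsum x, mul_one]
      exact Finset.single_le_sum (f := fun u => w u * l u x)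
        (fun u _ => mul_nonneg (hw0 u) ((hlm u).1 x)) (Finset.mem_univ u)
    · apply le_of_eq
      simp
    · rw [Real.logb_mul hJ0.ne' hM0.ne']
      have h1 := logb_indexCard_le (n := n) hR
      have h2 := logb_indexCard_le (n := n) hRc
      simp only
      linarith
  · apply le_of_eq
    have h1 : ∀ u t, ∑ x, ∑ y, marginal t (k u) x * marginal t (l u) y * d x y =
        ∑ x, ∑ y, k u x * (l u y * d (x t) (y t)) := by
      intro u t
      simp_rw [mul_assoc, ← Finset.mul_sum]
      rw [sum_marginal_mul t (k u) (fun x => ∑ y, marginal t (l u) y * d x y)]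
      exact Finset.sum_congr rfl fun x _ => by
        rw [sum_marginal_mul t (l u) (fun y => d (x t) y)]
    simp_rw [h1]
    rw [Fintype.sum_prod_type]
    simp only [distortion, expect, hXY, Fintype.sum_prod_type (α₁ := Fin n → X), avgDist]
    simp_rw [Finset.mul_sum, Finset.sum_mul]
    have h2 : ∀ u, (∑ t : Fin n, ∑ x : Fin n → X, ∑ y : Fin n → X,
        w u / n * (k u x * (l u y * d (x t) (y t)))) =
        ∑ x : Fin n → X, ∑ y : Fin n → X, ∑ t : Fin n,
          w u * (k u x * l u y) * (1 / n * d (x t) (y t)) := by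
      intro u
      rw [Finset.sum_comm]
      refine Finset.sum_congr rfl fun x _ => ?_
      rw [Finset.sum_comm]
      exact Finset.sum_congr rfl fun y _ => Finset.sum_congr rfl fun t _ => by ring
    rw [Finset.sum_congr rfl fun u _ => h2 u, Finset.sum_comm]
    refine Finset.sum_congr rfl fun x _ => ?_
    rw [Finset.sum_comm]
    refine Finset.sum_congr rfl fun y _ => ?_
    rw [Finset.sum_comm]

/-- One perfect code at one large block length gives a point of the region up to a slack in `ε`;
closedness removes the slack. -/
theorem mem_region_of_achievablePerfect {p : X → ℝ} (hp : p ∈ stdSimplex ℝ X)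
    (hp_pos : ∀ x, 0 < p x) {d : X → X → ℝ} {R Rc Δ : ℝ} (hR : 0 ≤ R)
    (hRc : 0 ≤ Rc) (h : AchievablePerfect p d R Rc Δ) : (R, Rc, Δ) ∈ region p d := by
  obtain ⟨D, hD, hdD⟩ := exists_dist_bound d
  have hmono : ∀ {a b b' : ℝ}, (a, Rc, b) ∈ region p d → b ≤ b' → (a, Rc, b') ∈ region p d := by
    rintro a b b' ⟨h0, s, W, h1, h2, h3, h4, h5, h6⟩ hb
    exact ⟨h0, s, W, h1, h2, h3, h4, h5.trans hb, h6⟩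
  have key : ∀ ε : ℝ, 0 < ε → (R + ε, Rc, Δ + ε + ε) ∈ region p d := by
    intro ε hε
    obtain ⟨c, hc, N, hN⟩ := h ε hε
    have h1 := eventually_le_of_limsup_le (fun n => distortion_le (c n) hp hRc hD hdD) hc hε
    obtain ⟨n, hn, hnN, hn1⟩ :=
      (h1.and ((eventually_ge_atTop N).and (eventually_ge_atTop 1))).exists
    exact hmono ((c n).mem_region_of_perfect hn1 (by linarith) hRc hp hp_pos d (hN n hnN)) hn
  have hlim : Tendsto (fun ε : ℝ => (R + ε, Rc, Δ + ε + ε)) (𝓝[>] 0) (𝓝 (R, Rc, Δ)) := by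
    have hcont : Continuous fun ε : ℝ => (R + ε, Rc, Δ + ε + ε) := by fun_prop
    have := hcont.tendsto 0
    simp only [add_zero] at this
    exact this.mono_left nhdsWithin_le_nhds
  exact (isClosed_region hp hp_pos d).mem_of_tendsto hlim
    (eventually_nhdsWithin_of_forall fun ε hε => key ε hε)

end Converse

/-! ### Soft covering -/

section SoftCovering

variable {ι α β : Type*} [Fintype ι] [DecidableEq ι] [Fintype α] [Fintype β]

open Classical in
/-- One-shot soft covering: the output of a random codebook approximates the target law. -/
theorem soft_covering {w : α → ℝ} (hw : w ∈ stdSimplex ℝ α) {K : α → β → ℝ}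
    (hK : ∀ a b, 0 ≤ K a b) {o : β → ℝ} (ho : o ∈ stdSimplex ℝ β)
    (hKo : ∀ b, ∑ a, w a * K a b = o b) {T : ℝ} (hT : 0 ≤ T) {s : Finset ι} (hs : s.Nonempty) :
    ∑ c : ι → α, (∏ i, w (c i)) * ∑ b, |(1 / (s.card : ℝ)) * ∑ i ∈ s, K (c i) b - o b| ≤
      2 * (∑ a, ∑ b, w a * K a b * (if T * o b < K a b then 1 else 0)) + √(T / s.card) := by
  have hcard : (0 : ℝ) < s.card := by exact_mod_cast hs.card_pos
  -- Truncation at likelihood ratio `T`: the second moment of `K1` is controlled, and the mean of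
  -- `K2` is the tail term of the bound.
  obtain ⟨K1, hK1⟩ : ∃ K1 : β → α → ℝ,
    ∀ b a, K1 b a = if T * o b < K a b then 0 else K a b := ⟨_, fun _ _ => rfl⟩
  obtain ⟨K2, hK2⟩ : ∃ K2 : β → α → ℝ,
    ∀ b a, K2 b a = K a b * (if T * o b < K a b then 1 else 0) := ⟨_, fun _ _ => rfl⟩
  have hsplit : ∀ a b, K a b = K1 b a + K2 b a := by
    intro a b
    simp only [hK1, hK2]
    split_ifs <;> simp
  have hK1_0 : ∀ b a, 0 ≤ K1 b a := by
    intro b a; simp only [hK1]; split_ifs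
    · exact le_rfl
    · exact hK a b
  have hK2_0 : ∀ b a, 0 ≤ K2 b a := by
    intro b a; simp only [hK2]; split_ifs <;> simp [hK a b]
  have hb : ∀ b, ∑ c : ι → α, (∏ i, w (c i)) *
      |(1 / (s.card : ℝ)) * ∑ i ∈ s, K (c i) b - o b| ≤
      2 * (∑ a, w a * K2 b a) + o b * √(T / s.card) := by
    intro b
    -- Cancellation is used for `K1` only. The tail is bounded by its mean, once for the codebook
    -- and once for the target, whence the factor `2`.
    have h1 : ∀ c : ι → α, |(1 / (s.card : ℝ)) * ∑ i ∈ s, K (c i) b - o b| ≤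
        |(1 / (s.card : ℝ)) * ∑ i ∈ s, K1 b (c i) - ∑ a, w a * K1 b a| +
          ((1 / (s.card : ℝ)) * ∑ i ∈ s, K2 b (c i) + ∑ a, w a * K2 b a) := by
      intro c
      have e : (1 / (s.card : ℝ)) * ∑ i ∈ s, K (c i) b - o b =
          ((1 / (s.card : ℝ)) * ∑ i ∈ s, K1 b (c i) - ∑ a, w a * K1 b a) +
          ((1 / (s.card : ℝ)) * ∑ i ∈ s, K2 b (c i) - ∑ a, w a * K2 b a) := by
        rw [← hKo b]
        simp only [hsplit, mul_add, Finset.sum_add_distrib]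
        ring
      have p1 : 0 ≤ (1 / (s.card : ℝ)) * ∑ i ∈ s, K2 b (c i) :=
        mul_nonneg (one_div_nonneg.2 hcard.le) (Finset.sum_nonneg fun i _ => hK2_0 b _)
      have p2 : 0 ≤ ∑ a, w a * K2 b a :=
        Finset.sum_nonneg fun a _ => mul_nonneg (hw.1 a) (hK2_0 b a)
      rw [e]
      refine (abs_add_le _ _).trans (add_le_add le_rfl ?_)
      rw [abs_le]
      constructor <;> linarith
    have h2 := mean_abs_dev_le (ι := ι) hw (K1 b) hs
    -- Pointwise `K1 b a ^ 2 ≤ T * o b * K a b`, so the bound is proportional to `o b` and sums over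
    -- `b` without loss.
    have h3 : √((∑ a, w a * K1 b a ^ 2) / s.card) ≤ o b * √(T / s.card) := by
      rw [show o b * √(T / s.card) = √(o b ^ 2 * (T / s.card)) by
        rw [Real.sqrt_mul (sq_nonneg _), Real.sqrt_sq (ho.1 b)]]
      apply Real.sqrt_le_sqrt
      rw [← mul_div_assoc]
      refine div_le_div_of_nonneg_right ?_ hcard.le
      calc ∑ a, w a * K1 b a ^ 2 ≤ ∑ a, T * o b * (w a * K a b) := by
            refine Finset.sum_le_sum fun a _ => ?_
            have : K1 b a ^ 2 ≤ T * o b * K a b := by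
              simp only [hK1]
              split_ifs with h
              · have := mul_nonneg (mul_nonneg hT (ho.1 b)) (hK a b)
                simpa using this
              · rw [sq]
                exact mul_le_mul_of_nonneg_right (not_lt.1 h) (hK a b)
            calc w a * K1 b a ^ 2 ≤ w a * (T * o b * K a b) :=
                  mul_le_mul_of_nonneg_left this (hw.1 a)
              _ = _ := by ring
        _ = o b ^ 2 * T := by rw [← Finset.mul_sum, hKo]; ring
    have h4 : ∑ c : ι → α, (∏ i, w (c i)) * ((1 / (s.card : ℝ)) * ∑ i ∈ s, K2 b (c i) +
        ∑ a, w a * K2 b a) = 2 * ∑ a, w a * K2 b a := by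
      have h5 := sum_prod_weight_sum (ι := ι) hw.2 (K2 b) s
      simp_rw [mul_add]
      rw [Finset.sum_add_distrib, ← Finset.sum_mul, sum_prod_weight hw.2, one_mul]
      have h6 : ∀ c : ι → α, (∏ i, w (c i)) * ((1 / (s.card : ℝ)) * ∑ i ∈ s, K2 b (c i)) =
          (1 / (s.card : ℝ)) * ((∏ i, w (c i)) * ∑ i ∈ s, K2 b (c i)) := fun c => by ring
      rw [Finset.sum_congr rfl fun c _ => h6 c, ← Finset.mul_sum, h5]
      rw [← mul_assoc, one_div_mul_cancel hcard.ne', one_mul]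
      ring
    calc _ ≤ ∑ c : ι → α, (∏ i, w (c i)) *
          (|(1 / (s.card : ℝ)) * ∑ i ∈ s, K1 b (c i) - ∑ a, w a * K1 b a| +
          ((1 / (s.card : ℝ)) * ∑ i ∈ s, K2 b (c i) + ∑ a, w a * K2 b a)) :=
          Finset.sum_le_sum fun c _ =>
            mul_le_mul_of_nonneg_left (h1 c) (prod_weight_nonneg hw.1 c)
      _ ≤ _ := by
          rw [Finset.sum_congr rfl fun c _ => mul_add (∏ i, w (c i)) |_| _,
            Finset.sum_add_distrib, h4]
          linarith
  rw [Finset.sum_congr rfl fun c _ => Finset.mul_sum _ _ (∏ i, w (c i)), Finset.sum_comm]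
  refine (Finset.sum_le_sum fun b _ => hb b).trans (le_of_eq ?_)
  rw [Finset.sum_add_distrib, ← Finset.sum_mul, ho.2, one_mul, ← Finset.mul_sum,
    Finset.sum_comm]
  simp only [hK2, mul_assoc]

end SoftCovering

section IidSoftCovering

variable {X V : Type*} [Fintype X] [Fintype V]

/-- The `n`-fold product of the kernel `k`. -/
def prodKernel (k : V → X → ℝ) {n : ℕ} (a : Fin n → V) (b : Fin n → X) : ℝ := ∏ t, k (a t) (b t)

theorem prodKernel_mem {X V : Type*} [Fintype X] {k : V → X → ℝ}
    (hk : ∀ v, k v ∈ stdSimplex ℝ X) {n : ℕ} (a : Fin n → V) :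
    prodKernel k a ∈ stdSimplex ℝ (Fin n → X) := by
  refine ⟨fun b => Finset.prod_nonneg fun t _ => (hk _).1 _, ?_⟩
  have := sum_pi_prod (fun (t : Fin n) x => k (a t) x)
  simp only [(hk _).2, Finset.prod_const_one] at this
  exact this

theorem sum_iid_mul_prodKernel {X V : Type*} [Fintype V] {p : X → ℝ} {w : V → ℝ} {k : V → X → ℝ}
    (havg : ∀ x, ∑ v, w v * k v x = p x) {n : ℕ} (b : Fin n → X) :
    ∑ a, iid w n a * prodKernel k a b = iid p n b := by
  have := sum_pi_prod (fun (t : Fin n) v => w v * k v (b t))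
  simp only [havg, Finset.prod_mul_distrib] at this
  exact this

-- The weak law of large numbers, with a rate, for the information density `f`: crossing the
-- threshold is a deviation of its empirical mean by at least `γ`.
open Classical in
theorem exists_prob_atypical_le {p : X → ℝ} (hp_pos : ∀ x, 0 < p x) {w : V → ℝ}
    (hw : w ∈ stdSimplex ℝ V) {k : V → X → ℝ} (hk : ∀ v, k v ∈ stdSimplex ℝ X) {γ : ℝ}
    (hγ : 0 < γ) :
    ∃ C : ℝ, 0 ≤ C ∧ ∀ n : ℕ, 1 ≤ n →
      ∑ a, ∑ b, iid w n a * prodKernel k a b *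
        (if (2 : ℝ) ^ ((n : ℝ) * (∑ v, w v * relEnt p (k v) + γ)) * iid p n b <
          prodKernel k a b then 1 else 0) ≤ C / √n := by
  set I := ∑ v, w v * relEnt p (k v) with hI
  set P : V × X → ℝ := fun z => w z.1 * k z.1 z.2 with hP
  set f : V × X → ℝ := fun z => Real.logb 2 (k z.1 z.2 / p z.2) with hf
  have hPm : P ∈ stdSimplex ℝ (V × X) := by
    refine ⟨fun z => mul_nonneg (hw.1 _) ((hk _).1 _), ?_⟩
    rw [Fintype.sum_prod_type]
    simp only [hP, ← Finset.mul_sum, (hk _).2, mul_one, hw.2]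
  have hEf : ∑ z, P z * f z = I := by
    rw [Fintype.sum_prod_type]
    simp only [hP, hf, hI, relEnt, Finset.mul_sum, mul_assoc]
  refine ⟨√(∑ z, P z * f z ^ 2) / γ, by positivity, fun n hn => ?_⟩
  have hn0 : (0 : ℝ) < n := by exact_mod_cast hn
  have : Nonempty (Fin n) := ⟨⟨0, hn⟩⟩
  have h := prob_dev_le (ι := Fin n) hPm f hγ
    (fun z => (2 : ℝ) ^ ((n : ℝ) * (I + γ)) * iid p n (fun t => (z t).2) <
      prodKernel k (fun t => (z t).1) (fun t => (z t).2)) (by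
      intro z hz
      rw [hEf, Fintype.card_fin]
      have hpn : 0 < iid p n (fun t => (z t).2) := Finset.prod_pos fun _ _ => hp_pos _
      have hpos : 0 < prodKernel k (fun t => (z t).1) (fun t => (z t).2) :=
        lt_trans (by positivity) hz
      have hkne : ∀ t, k (z t).1 (z t).2 ≠ 0 := fun t h0 =>
        hpos.ne' (Finset.prod_eq_zero (Finset.mem_univ t) h0)
      have hsum : ∑ t, f (z t) = Real.logb 2 (prodKernel k (fun t => (z t).1) (fun t => (z t).2) /
          iid p n (fun t => (z t).2)) := by
        rw [prodKernel, iid, ← Finset.prod_div_distrib, Real.logb_prod]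
        exact fun t _ => div_ne_zero (hkne t) (hp_pos _).ne'
      have hlt : (n : ℝ) * (I + γ) < ∑ t, f (z t) := by
        rw [hsum, Real.lt_logb_iff_rpow_lt (by norm_num) (div_pos hpos hpn), lt_div_iff₀ hpn]
        exact hz
      refine le_trans ?_ (le_abs_self _)
      rw [one_div, inv_mul_eq_div, le_sub_iff_add_le, le_div_iff₀ hn0]
      linarith)
  rw [Fintype.card_fin, Real.sqrt_div' _ hn0.le, div_right_comm] at h
  refine le_trans (le_of_eq ?_) h
  rw [← (Equiv.arrowProdEquivProdArrow (Fin n) (fun _ => V) (fun _ => X)).symm.sum_comp,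
    Fintype.sum_prod_type]
  refine Finset.sum_congr rfl fun a _ => Finset.sum_congr rfl fun b _ => ?_
  have h1 : iid w n a * prodKernel k a b = ∏ t, P (a t, b t) := by
    simp only [hP, iid, prodKernel, Finset.prod_mul_distrib]
  rw [h1]
  rfl

/-- Soft covering for product channels. -/
theorem iid_soft_covering {p : X → ℝ} (hp : p ∈ stdSimplex ℝ X) (hp_pos : ∀ x, 0 < p x)
    {w : V → ℝ} (hw : w ∈ stdSimplex ℝ V) {k : V → X → ℝ} (hk : ∀ v, k v ∈ stdSimplex ℝ X)
    (havg : ∀ x, ∑ v, w v * k v x = p x) {I : ℝ} (hI : ∑ v, w v * relEnt p (k v) ≤ I)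
    {γ : ℝ} (hγ : 0 < γ) :
    ∃ C : ℝ, 0 ≤ C ∧ ∀ (n : ℕ), 1 ≤ n → ∀ (ι : Type) [Fintype ι] [DecidableEq ι] (s : Finset ι),
      s.Nonempty → ∑ c : ι → Fin n → V, (∏ i, iid w n (c i)) *
        ∑ b, |(1 / (s.card : ℝ)) * ∑ i ∈ s, prodKernel k (c i) b - iid p n b| ≤
      C / √n + √((2 : ℝ) ^ ((n : ℝ) * (I + γ)) / s.card) := by
  classical
  obtain ⟨C, hC, h⟩ := exists_prob_atypical_le hp_pos hw hk hγ
  refine ⟨2 * C, by positivity, fun n hn ι _ _ s hs => ?_⟩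
  refine (soft_covering (iid_mem hw n) (fun a b => (prodKernel_mem hk a).1 b) (iid_mem hp n)
    (sum_iid_mul_prodKernel havg)
    (T := (2 : ℝ) ^ ((n : ℝ) * (∑ v, w v * relEnt p (k v) + γ))) (by positivity) hs).trans ?_
  refine add_le_add ?_ ?_
  · have := h n hn
    rw [mul_div_assoc]
    convert mul_le_mul_of_nonneg_left this (zero_le_two (α := ℝ))
  · apply Real.sqrt_le_sqrt
    gcongr
    norm_num

end IidSoftCovering

/-! ### The likelihood encoder -/

section Likelihood

variable {X : Type*} [Fintype X] {n : ℕ} {R Rc : ℝ}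

/-- The code of a codebook, given by the laws `kq` of the source and `kr` of the reconstruction
conditioned on the codeword. -/
theorem exists_likelihood_code (hR : 0 ≤ R) (hRc : 0 ≤ Rc) {p : X → ℝ}
    {d : X → X → ℝ} (hd : ∀ x y, 0 ≤ d x y) {D : ℝ} (hD : 0 ≤ D) (hdD : ∀ x y, d x y ≤ D)
    {kq kr : Fin (indexCard n R) × Fin (indexCard n Rc) → (Fin n → X) → ℝ}
    (hq : ∀ i, kq i ∈ stdSimplex ℝ (Fin n → X)) (hr : ∀ i, kr i ∈ stdSimplex ℝ (Fin n → X))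
    {T₁ T₂ : ℝ}
    (hT₁ : (1 / (indexCard n Rc : ℝ)) * ∑ j, ∑ x,
      |(1 / (indexCard n R : ℝ)) * ∑ m, kq (m, j) x - iid p n x| ≤ T₁)
    (hT₂ : ∑ y, |(1 / ((indexCard n R : ℝ) * indexCard n Rc)) * ∑ i, kr i y - iid p n y| ≤ T₂) :
    ∃ c : Code X n R Rc,
      distortion p d c ≤ (1 / ((indexCard n R : ℝ) * indexCard n Rc)) *
        (∑ i, ∑ x, ∑ y, kq i x * kr i y * avgDist d x y) + D * T₁ ∧
      tvDist (c.inducedY p) (iid p n) ≤ (1 / 2) * (T₁ + T₂) := by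
  have hJ0 : (0 : ℝ) < indexCard n Rc := by exact_mod_cast indexCard_pos n hRc
  have hM0 : (0 : ℝ) < indexCard n R := by exact_mod_cast indexCard_pos n hR
  obtain ⟨J, hJ⟩ : ∃ J : ℝ, J = indexCard n Rc := ⟨_, rfl⟩
  obtain ⟨M, hM⟩ : ∃ M : ℝ, M = indexCard n R := ⟨_, rfl⟩
  rw [← hJ] at hJ0 hT₁ hT₂ ⊢
  rw [← hM] at hM0 hT₁ hT₂ ⊢
  obtain ⟨a, ha⟩ : ∃ a : Fin (indexCard n Rc) → (Fin n → X) → ℝ,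
    ∀ j x, a j x = (1 / M) * ∑ m, kq (m, j) x := ⟨_, fun _ _ => rfl⟩
  simp only [← ha] at hT₁
  have ha0 : ∀ j x, 0 ≤ a j x := fun j x => by
    rw [ha]; exact mul_nonneg (by positivity) (Finset.sum_nonneg fun m _ => (hq _).1 x)
  -- The posterior of the message in the ideal model where `(m, j)` is uniform and the source has
  -- law `kq (m, j)`; uniform by default where that model gives `x` no mass.
  let enc : (Fin n → X) → Fin (indexCard n Rc) → Fin (indexCard n R) → ℝ := fun x j m =>
    if a j x = 0 then 1 / M else kq (m, j) x / (M * a j x)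
  have henc : ∀ x j, enc x j ∈ stdSimplex ℝ (Fin (indexCard n R)) := by
    intro x j
    by_cases h : a j x = 0
    · refine ⟨fun m => ?_, ?_⟩
      · simp only [enc, if_pos h]; positivity
      · simp only [enc, if_pos h, Finset.sum_const, Finset.card_univ, Fintype.card_fin,
          nsmul_eq_mul, ← hM]
        field_simp
    · refine ⟨fun m => ?_, ?_⟩
      · simp only [enc, if_neg h]
        exact div_nonneg ((hq _).1 _) (mul_nonneg hM0.le (ha0 j x))
      · simp only [enc, if_neg h]
        rw [← Finset.sum_div, show ∑ m, kq (m, j) x = M * a j x by rw [ha]; field_simp]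
        exact div_self (mul_ne_zero hM0.ne' h)
  have hae : ∀ x j m, a j x * enc x j m = (1 / M) * kq (m, j) x := by
    intro x j m
    by_cases h : a j x = 0
    · rw [h, zero_mul]
      have h1 : ∑ m, kq (m, j) x = 0 := by
        have := ha j x
        rw [h] at this
        rcases mul_eq_zero.1 this.symm with h2 | h2
        · exact absurd h2 (by positivity)
        · exact h2
      rw [(Finset.sum_eq_zero_iff_of_nonneg fun m _ => (hq (m, j)).1 x).1 h1 m (Finset.mem_univ m),
        mul_zero]
    · simp only [enc, if_neg h]
      field_simp
  let c : Code X n R Rc := ⟨enc, fun m j => kr (m, j), henc, fun m j => hr (m, j)⟩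
  have hXY : ∀ x y, c.inducedXY p (x, y) =
      ∑ j, ∑ m, iid p n x * (1 / J) * enc x j m * kr (m, j) y := by
    intro x y
    rw [hJ]
    rfl
  -- The ideal law of `(X, Y)`. It differs from the induced one only in the source law `a j`, the
  -- channel from `(x, j)` to `(m, y)` being shared.
  obtain ⟨Q, hQ⟩ : ∃ Q : (Fin n → X) → (Fin n → X) → ℝ, ∀ x y, Q x y =
    ∑ j, ∑ m, a j x * (1 / J) * enc x j m * kr (m, j) y := ⟨_, fun _ _ => rfl⟩
  have hQ' : ∀ x y, Q x y = (1 / (M * J)) * ∑ i, kq i x * kr i y := by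
    intro x y
    rw [hQ, Fintype.sum_prod_type_right, Finset.mul_sum]
    refine Finset.sum_congr rfl fun j _ => ?_
    rw [Finset.mul_sum]
    refine Finset.sum_congr rfl fun m _ => ?_
    rw [mul_right_comm (a j x), hae]
    field_simp
  have hdiff : ∑ x, ∑ y, |c.inducedXY p (x, y) - Q x y| ≤ T₁ := by
    refine le_trans ?_ hT₁
    rw [Finset.mul_sum]
    simp_rw [Finset.mul_sum]
    rw [Finset.sum_comm (s := (Finset.univ : Finset (Fin (indexCard n Rc))))]
    refine Finset.sum_le_sum fun x _ => ?_
    calc ∑ y, |c.inducedXY p (x, y) - Q x y|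
        ≤ ∑ y, ∑ j, ∑ m, (1 / J * |a j x - iid p n x|) * (enc x j m * kr (m, j) y) := by
          refine Finset.sum_le_sum fun y _ => ?_
          rw [hXY, hQ, ← Finset.sum_sub_distrib]
          refine (Finset.abs_sum_le_sum_abs _ _).trans (Finset.sum_le_sum fun j _ => ?_)
          rw [← Finset.sum_sub_distrib]
          refine (Finset.abs_sum_le_sum_abs _ _).trans (Finset.sum_le_sum fun m _ => ?_)
          apply le_of_eq
          have h1 : 0 ≤ (1 / J) * (enc x j m * kr (m, j) y) :=
            mul_nonneg (by positivity) (mul_nonneg ((henc x j).1 m) ((hr _).1 y))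
          rw [show iid p n x * (1 / J) * enc x j m * kr (m, j) y -
            a j x * (1 / J) * enc x j m * kr (m, j) y =
            (iid p n x - a j x) * ((1 / J) * (enc x j m * kr (m, j) y)) by ring, abs_mul,
            abs_of_nonneg h1, abs_sub_comm]
          ring
      _ = ∑ j, 1 / J * |a j x - iid p n x| := by
          rw [Finset.sum_comm]
          refine Finset.sum_congr rfl fun j _ => ?_
          rw [Finset.sum_comm]
          simp_rw [← Finset.mul_sum, (hr _).2, mul_one]
          rw [(henc x j).2, mul_one]
  refine ⟨c, ?_, ?_⟩
  · have hdist : distortion p d c = ∑ x, ∑ y, c.inducedXY p (x, y) * avgDist d x y := by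
      rw [distortion, expect, Fintype.sum_prod_type]
    have hmain : ∑ x, ∑ y, Q x y * avgDist d x y = (1 / (M * J)) *
        (∑ i, ∑ x, ∑ y, kq i x * kr i y * avgDist d x y) := by
      simp_rw [hQ', mul_assoc, ← Finset.mul_sum]
      congr 1
      simp_rw [Finset.sum_mul]
      rw [Finset.sum_congr rfl fun x _ => Finset.sum_comm, Finset.sum_comm]
      refine Finset.sum_congr rfl fun i _ => Finset.sum_congr rfl fun x _ => ?_
      rw [Finset.mul_sum]
      exact Finset.sum_congr rfl fun y _ => by ring
    rw [← hmain, hdist]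
    calc ∑ x, ∑ y, c.inducedXY p (x, y) * avgDist d x y
        ≤ ∑ x, ∑ y, (Q x y * avgDist d x y + D * |c.inducedXY p (x, y) - Q x y|) := by
          refine Finset.sum_le_sum fun x _ => Finset.sum_le_sum fun y _ => ?_
          have h1 := le_abs_self (c.inducedXY p (x, y) - Q x y)
          have h2 := abs_nonneg (c.inducedXY p (x, y) - Q x y)
          have h3 := avgDist_nonneg hd x y
          have h4 := avgDist_le hD hdD x y
          nlinarith
      _ = ∑ x, ∑ y, Q x y * avgDist d x y + D * ∑ x, ∑ y, |c.inducedXY p (x, y) - Q x y| := by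
          simp_rw [Finset.sum_add_distrib, Finset.mul_sum]
      _ ≤ _ := by gcongr
  · rw [tvDist]
    refine mul_le_mul_of_nonneg_left ?_ (by norm_num)
    have hQy : ∀ y, ∑ x, Q x y = (1 / (M * J)) * ∑ i, kr i y := by
      intro y
      simp_rw [hQ', ← Finset.mul_sum]
      congr 1
      rw [Finset.sum_comm]
      exact Finset.sum_congr rfl fun i _ => by rw [← Finset.sum_mul, (hq i).2, one_mul]
    calc ∑ y, |c.inducedY p y - iid p n y|
        ≤ ∑ y, (∑ x, |c.inducedXY p (x, y) - Q x y| +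
            |(1 / (M * J)) * ∑ i, kr i y - iid p n y|) := by
          refine Finset.sum_le_sum fun y _ => ?_
          rw [← hQy, Code.inducedY]
          refine (abs_sub_le _ (∑ x, Q x y) _).trans (add_le_add ?_ le_rfl)
          rw [← Finset.sum_sub_distrib]
          exact Finset.abs_sum_le_sum_abs _ _
      _ = ∑ x, ∑ y, |c.inducedXY p (x, y) - Q x y| +
            ∑ y, |(1 / (M * J)) * ∑ i, kr i y - iid p n y| := by
          rw [Finset.sum_add_distrib, Finset.sum_comm]
      _ ≤ T₁ + T₂ := add_le_add hdiff hT₂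

theorem Code.nonempty (hR : 0 ≤ R) (hRc : 0 ≤ Rc) {p : X → ℝ} (hp : p ∈ stdSimplex ℝ X) :
    Nonempty (Code X n R Rc) := by
  obtain ⟨c, -⟩ := exists_likelihood_code (n := n) (p := p) hR hRc (d := fun _ _ => 0) (D := 0)
    (fun _ _ => le_rfl) le_rfl (fun _ _ => le_rfl) (kq := fun _ => iid p n)
    (kr := fun _ => iid p n) (fun _ => iid_mem hp n) (fun _ => iid_mem hp n) le_rfl le_rfl
  exact ⟨c⟩

end Likelihood

/-! ### Random coding -/

section RandomCoding

variable {X V : Type*} [Fintype X] [Fintype V]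

theorem sum_prodKernel_single {X V : Type*} [Fintype X] {k : V → X → ℝ}
    (hk : ∀ v, k v ∈ stdSimplex ℝ X) {n : ℕ}
    (a : Fin n → V) (t : Fin n) (f : X → ℝ) :
    ∑ x, prodKernel k a x * f (x t) = ∑ x, k (a t) x * f x := by
  have h := sum_pi_prod (fun (i : Fin n) x => k (a i) x * (if i = t then f x else 1))
  have h1 : ∀ x : Fin n → X, ∏ i, (k (a i) (x i) * (if i = t then f (x i) else 1)) =
      prodKernel k a x * f (x t) := by
    intro x
    rw [Finset.prod_mul_distrib]
    simp [prodKernel]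
  have h2 : ∀ i, ∑ x, k (a i) x * (if i = t then f x else 1) =
      if i = t then ∑ x, k (a t) x * f x else 1 := by
    intro i
    by_cases hi : i = t
    · subst hi; simp
    · simp [hi, (hk _).2]
  rw [Finset.sum_congr rfl fun x _ => h1 x] at h
  rw [h, Finset.prod_congr rfl fun i _ => h2 i]
  simp

theorem sum_iid_avgDist {w : V → ℝ} (hw : w ∈ stdSimplex ℝ V) {q r : V → X → ℝ}
    (hq : ∀ v, q v ∈ stdSimplex ℝ X) (hr : ∀ v, r v ∈ stdSimplex ℝ X) (d : X → X → ℝ) {n : ℕ}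
    (hn : 1 ≤ n) :
    ∑ a, iid w n a * (∑ x, ∑ y, prodKernel q a x * prodKernel r a y * avgDist d x y) =
      ∑ v, w v * ∑ x, ∑ y, q v x * r v y * d x y := by
  have hn0 : (n : ℝ) ≠ 0 := by exact_mod_cast (by omega : n ≠ 0)
  have h1 : ∀ a : Fin n → V,
      ∑ x, ∑ y, prodKernel q a x * prodKernel r a y * avgDist d x y =
      (1 / (n : ℝ)) * ∑ t, ∑ x, ∑ y, q (a t) x * r (a t) y * d x y := by
    intro a
    have h2 : ∀ t, ∑ x, ∑ y, q (a t) x * r (a t) y * d x y =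
        ∑ x, ∑ y, prodKernel q a x * (prodKernel r a y * d (x t) (y t)) := by
      intro t
      simp_rw [mul_assoc, ← Finset.mul_sum]
      rw [← sum_prodKernel_single hq a t (fun x => ∑ y, r (a t) y * d x y)]
      exact Finset.sum_congr rfl fun x _ => by
        rw [sum_prodKernel_single hr a t (fun y => d (x t) y)]
    simp_rw [h2]
    conv_rhs => rw [Finset.sum_comm, Finset.mul_sum]
    refine Finset.sum_congr rfl fun x _ => ?_
    conv_rhs => rw [Finset.sum_comm, Finset.mul_sum]
    refine Finset.sum_congr rfl fun y _ => ?_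
    rw [avgDist, ← Finset.mul_sum, ← Finset.mul_sum]
    ring
  have h3 := sum_prod_weight_sum (ι := Fin n) hw.2
    (fun v => ∑ x : X, ∑ y : X, q v x * r v y * d x y) Finset.univ
  rw [Finset.card_univ, Fintype.card_fin] at h3
  simp_rw [h1]
  have h4 : ∀ a : Fin n → V, iid w n a * ((1 / (n : ℝ)) *
      ∑ t, ∑ x, ∑ y, q (a t) x * r (a t) y * d x y) = (1 / (n : ℝ)) * ((∏ i, w (a i)) *
      ∑ t, ∑ x, ∑ y, q (a t) x * r (a t) y * d x y) := fun a => by rw [iid]; ring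
  rw [Finset.sum_congr rfl fun a _ => h4 a, ← Finset.mul_sum, h3]
  field_simp

theorem rpow_le_two_mul_indexCard (n : ℕ) {R : ℝ} (hR : 0 ≤ R) :
    (2 : ℝ) ^ ((n : ℝ) * R) ≤ 2 * indexCard n R := by
  have h1 : (1 : ℝ) ≤ indexCard n R := by exact_mod_cast indexCard_pos n hR
  have h2 := Nat.lt_floor_add_one ((2 : ℝ) ^ ((n : ℝ) * R))
  rw [indexCard] at *
  linarith

/-- Existence of a good code at block length `n`, from bounds on the mean total variations. -/
theorem exists_code_of_mean_le {p : X → ℝ} {d : X → X → ℝ}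
    (hd : ∀ x y, 0 ≤ d x y) {D : ℝ} (hD : 0 ≤ D) (hdD : ∀ x y, d x y ≤ D)
    {w : V → ℝ} {q r : V → X → ℝ} {t : ℝ × ℝ × ℝ} (h : IsMixture p d w q r t)
    {R Rc : ℝ} (hR : 0 ≤ R) (hRc : 0 ≤ Rc) {n : ℕ} (hn : 1 ≤ n) {a : ℝ} (ha : 0 < a)
    {a₁ a₂ : ℝ} (haa : a₁ + a₂ ≤ a)
    (h₁ : ∀ s : Finset (Fin (indexCard n R) × Fin (indexCard n Rc)), s.card = indexCard n R →
      ∑ c : Fin (indexCard n R) × Fin (indexCard n Rc) → Fin n → V, (∏ i, iid w n (c i)) *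
        ∑ x, |(1 / (s.card : ℝ)) * ∑ i ∈ s, prodKernel q (c i) x - iid p n x| ≤ a₁)
    (h₂ : ∑ c : Fin (indexCard n R) × Fin (indexCard n Rc) → Fin n → V, (∏ i, iid w n (c i)) *
        ∑ y, |(1 / ((indexCard n R : ℝ) * indexCard n Rc)) * ∑ i, prodKernel r (c i) y -
          iid p n y| ≤ a₂) :
    ∃ c : Code X n R Rc, distortion p d c ≤ t.2.2 + √a + D * (√a * (t.2.2 + √a)) ∧
      tvDist (c.inducedY p) (iid p n) ≤ √a * (t.2.2 + √a) := by
  classical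
  have hJ0 : (0 : ℝ) < indexCard n Rc := by exact_mod_cast indexCard_pos n hRc
  have hM0 : (0 : ℝ) < indexCard n R := by exact_mod_cast indexCard_pos n hR
  obtain ⟨T₁, hT₁⟩ : ∃ T : (Fin (indexCard n R) × Fin (indexCard n Rc) → Fin n → V) → ℝ,
    ∀ c, T c = (1 / (indexCard n Rc : ℝ)) * ∑ j, ∑ x,
      |(1 / (indexCard n R : ℝ)) * ∑ m, prodKernel q (c (m, j)) x - iid p n x| :=
    ⟨_, fun _ => rfl⟩
  obtain ⟨T₂, hT₂⟩ : ∃ T : (Fin (indexCard n R) × Fin (indexCard n Rc) → Fin n → V) → ℝ,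
    ∀ c, T c = ∑ y, |(1 / ((indexCard n R : ℝ) * indexCard n Rc)) *
      ∑ i, prodKernel r (c i) y - iid p n y| := ⟨_, fun _ => rfl⟩
  obtain ⟨E, hE⟩ : ∃ E : (Fin (indexCard n R) × Fin (indexCard n Rc) → Fin n → V) → ℝ,
    ∀ c, E c = (1 / ((indexCard n R : ℝ) * indexCard n Rc)) *
      ∑ i, ∑ x, ∑ y, prodKernel q (c i) x * prodKernel r (c i) y * avgDist d x y :=
    ⟨_, fun _ => rfl⟩
  have hwn := iid_mem h.w_mem n
  have hmT₁ : ∑ c, (∏ i, iid w n (c i)) * T₁ c ≤ a₁ := by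
    simp_rw [hT₁]
    have h3 : ∀ j, ∑ c : Fin (indexCard n R) × Fin (indexCard n Rc) → Fin n → V,
        (∏ i, iid w n (c i)) * ∑ x, |(1 / (indexCard n R : ℝ)) * ∑ m, prodKernel q (c (m, j)) x -
          iid p n x| ≤ a₁ := by
      intro j
      -- For each `j`, the subcodebook of messages must cover the source law on its own.
      have h4 := h₁ (Finset.univ ×ˢ {j}) (by simp)
      simpa [Finset.sum_product] using h4
    calc _ = (1 / (indexCard n Rc : ℝ)) * ∑ j,
          ∑ c : Fin (indexCard n R) × Fin (indexCard n Rc) → Fin n → V,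
          (∏ i, iid w n (c i)) * ∑ x, |(1 / (indexCard n R : ℝ)) *
            ∑ m, prodKernel q (c (m, j)) x - iid p n x| := by
          rw [Finset.sum_comm, Finset.mul_sum]
          refine Finset.sum_congr rfl fun c _ => ?_
          rw [← Finset.mul_sum]
          ring
      _ ≤ (1 / (indexCard n Rc : ℝ)) * ∑ j : Fin (indexCard n Rc), a₁ := by
          gcongr with j
          exact h3 j
      _ = a₁ := by
          simp only [Finset.sum_const, Finset.card_univ, Fintype.card_fin, nsmul_eq_mul]
          field_simp
  have hmT₂ : ∑ c, (∏ i, iid w n (c i)) * T₂ c ≤ a₂ := by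
    simp_rw [hT₂]; exact h₂
  have hmE : ∑ c, (∏ i, iid w n (c i)) * E c ≤ t.2.2 := by
    refine le_trans (le_of_eq ?_) h.dist_le
    rw [← sum_iid_avgDist h.w_mem h.q_mem h.r_mem d hn]
    have h3 := sum_prod_weight_sum (ι := Fin (indexCard n R) × Fin (indexCard n Rc)) hwn.2
      (fun a => ∑ x, ∑ y, prodKernel q a x * prodKernel r a y * avgDist d x y) Finset.univ
    rw [Finset.card_univ, Fintype.card_prod, Fintype.card_fin, Fintype.card_fin,
      Nat.cast_mul] at h3
    have h4 : ∀ c : Fin (indexCard n R) × Fin (indexCard n Rc) → Fin n → V,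
        (∏ i, iid w n (c i)) * E c = (1 / ((indexCard n R : ℝ) * indexCard n Rc)) *
        ((∏ i, iid w n (c i)) * ∑ i, ∑ x, ∑ y,
          prodKernel q (c i) x * prodKernel r (c i) y * avgDist d x y) := fun c => by
      rw [hE]; ring
    rw [Finset.sum_congr rfl fun c _ => h4 c, ← Finset.mul_sum, h3]
    field_simp
  have hsa : 0 < √a := Real.sqrt_pos.2 ha
  have hss : √a * √a = a := Real.mul_self_sqrt ha.le
  -- One codebook must serve distortion and covering at once. The weight `1 / √a` adds at most `√a`
  -- to the mean and still forces `T₁ + T₂` to be of order `√a`.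
  obtain ⟨c, hc⟩ := exists_le_of_sum_weight_le (prod_weight_mem hwn)
    (fun c => E c + (T₁ c + T₂ c) / √a) (b := t.2.2 + √a) (by
      have h5 : ∀ c : Fin (indexCard n R) × Fin (indexCard n Rc) → Fin n → V,
          (∏ i, iid w n (c i)) * (E c + (T₁ c + T₂ c) / √a) = (∏ i, iid w n (c i)) * E c +
          ((∏ i, iid w n (c i)) * T₁ c + (∏ i, iid w n (c i)) * T₂ c) / √a := fun c => by ring
      rw [Finset.sum_congr rfl fun c _ => h5 c, Finset.sum_add_distrib, ← Finset.sum_div,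
        Finset.sum_add_distrib]
      refine add_le_add hmE ?_
      rw [div_le_iff₀ hsa, hss]
      linarith)
  have hT₁0 : 0 ≤ T₁ c := by rw [hT₁]; positivity
  have hT₂0 : 0 ≤ T₂ c := by rw [hT₂]; positivity
  have hE0 : 0 ≤ E c := by
    rw [hE]
    refine mul_nonneg (by positivity) (Finset.sum_nonneg fun i _ => Finset.sum_nonneg fun x _ =>
      Finset.sum_nonneg fun y _ => ?_)
    exact mul_nonneg (mul_nonneg ((prodKernel_mem h.q_mem _).1 _)
      ((prodKernel_mem h.r_mem _).1 _)) (avgDist_nonneg hd x y)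
  have hEc : E c ≤ t.2.2 + √a := by
    have : 0 ≤ (T₁ c + T₂ c) / √a := by positivity
    linarith
  have hTc : T₁ c + T₂ c ≤ √a * (t.2.2 + √a) := by
    have : (T₁ c + T₂ c) / √a ≤ t.2.2 + √a := by linarith
    rwa [div_le_iff₀ hsa, mul_comm] at this
  obtain ⟨code, h6, h7⟩ := exists_likelihood_code (p := p) hR hRc hd hD hdD
    (kq := fun i => prodKernel q (c i)) (kr := fun i => prodKernel r (c i))
    (fun i => prodKernel_mem h.q_mem _) (fun i => prodKernel_mem h.r_mem _)
    (T₁ := T₁ c) (T₂ := T₂ c) (hT₁ c).ge (hT₂ c).ge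
  refine ⟨code, h6.trans ?_, h7.trans (by linarith)⟩
  rw [← hE]
  exact add_le_add hEc (mul_le_mul_of_nonneg_left (by linarith) hD)

/-- Half of the extra rate `ε` goes to the typicality threshold of soft covering, the other half
leaves an exponential margin in the codebook size. -/
theorem IsMixture.achievableNearPerfect {p : X → ℝ} (hp : p ∈ stdSimplex ℝ X)
    (hp_pos : ∀ x, 0 < p x) {d : X → X → ℝ} (hd : ∀ x y, 0 ≤ d x y)
    {w : V → ℝ} {q r : V → X → ℝ} {R Rc Δ : ℝ} (h : IsMixture p d w q r (R, Rc, Δ))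
    (hR : 0 ≤ R) (hRc : 0 ≤ Rc) : AchievableNearPerfect p d R Rc Δ := by
  intro ε hε
  obtain ⟨D, hD, hdD⟩ := exists_dist_bound d
  obtain ⟨C₁, hC₁, hcov₁⟩ := iid_soft_covering hp hp_pos h.w_mem h.q_mem h.q_avg h.q_ent
    (half_pos hε)
  obtain ⟨C₂, hC₂, hcov₂⟩ := iid_soft_covering hp hp_pos h.w_mem h.r_mem h.r_avg h.r_ent
    (half_pos hε)
  simp only at hcov₁ hcov₂
  have hRε : 0 ≤ R + ε := by linarith
  -- The factor `4` pays for the integer parts in the two index sets, each losing at most a factor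
  -- `2`.
  set S : ℕ → ℝ := fun n => √(4 * (2 : ℝ) ^ (-((n : ℝ) * (ε / 2)))) with hS
  set a : ℕ → ℝ := fun n => (C₁ + C₂) / √n + 2 * S n with ha
  have ha0 : ∀ n, 0 < a n := by
    intro n
    have : 0 < S n := Real.sqrt_pos.2 (by positivity)
    have : 0 ≤ (C₁ + C₂) / √n := by positivity
    simp only [ha]
    linarith
  have hlim : Tendsto a atTop (𝓝 0) := by
    have h1 : Tendsto (fun n : ℕ => (C₁ + C₂) / √(n : ℝ)) atTop (𝓝 0) :=
      (Real.tendsto_sqrt_atTop.comp tendsto_natCast_atTop_atTop).const_div_atTop _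
    have h2 : Tendsto (fun n : ℕ => 4 * (2 : ℝ) ^ (-((n : ℝ) * (ε / 2)))) atTop (𝓝 0) := by
      have h3 : ∀ n : ℕ, (2 : ℝ) ^ (-((n : ℝ) * (ε / 2))) = ((2 : ℝ) ^ (-(ε / 2))) ^ n := by
        intro n
        rw [← Real.rpow_mul_natCast (by norm_num)]
        congr 1
        ring
      simp_rw [h3]
      have h4 := tendsto_pow_atTop_nhds_zero_of_lt_one
        (r := (2 : ℝ) ^ (-(ε / 2))) (by positivity)
        (Real.rpow_lt_one_of_one_lt_of_neg (by norm_num) (by linarith))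
      simpa using h4.const_mul 4
    have h5 : Tendsto S atTop (𝓝 0) := by
      have := (Real.continuous_sqrt.tendsto 0).comp h2
      rw [Real.sqrt_zero] at this
      exact this
    simpa using h1.add (h5.const_mul 2)
  have hcode : ∀ n : ℕ, ∃ c : Code X n (R + ε) Rc, 1 ≤ n →
      distortion p d c ≤ Δ + √(a n) + D * (√(a n) * (Δ + √(a n))) ∧
      tvDist (c.inducedY p) (iid p n) ≤ √(a n) * (Δ + √(a n)) := by
    intro n
    -- Nothing is claimed at `n = 0`, where any code serves.
    rcases Nat.lt_or_ge n 1 with hn | hn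
    · obtain ⟨c⟩ := Code.nonempty (n := n) hRε hRc hp
      exact ⟨c, fun h => absurd h (by omega)⟩
    have hM0 : (0 : ℝ) < indexCard n (R + ε) := by exact_mod_cast indexCard_pos n hRε
    have hJ0 : (0 : ℝ) < indexCard n Rc := by exact_mod_cast indexCard_pos n hRc
    have hM := rpow_le_two_mul_indexCard n hRε
    have hJ := rpow_le_two_mul_indexCard n hRc
    have hne1 : Nonempty (Fin (indexCard n (R + ε))) := ⟨⟨0, indexCard_pos n hRε⟩⟩
    have hne2 : Nonempty (Fin (indexCard n Rc)) := ⟨⟨0, indexCard_pos n hRc⟩⟩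
    have hs₁ : √((2 : ℝ) ^ ((n : ℝ) * (R + ε / 2)) / indexCard n (R + ε)) ≤ S n := by
      apply Real.sqrt_le_sqrt
      rw [div_le_iff₀ hM0]
      have e : (2 : ℝ) ^ ((n : ℝ) * (R + ε / 2)) =
          (2 : ℝ) ^ (-((n : ℝ) * (ε / 2))) * (2 : ℝ) ^ ((n : ℝ) * (R + ε)) := by
        rw [← Real.rpow_add (by norm_num)]; congr 1; ring
      have h0 : 0 < (2 : ℝ) ^ (-((n : ℝ) * (ε / 2))) := by positivity
      rw [e]
      nlinarith [mul_le_mul_of_nonneg_left hM h0.le, mul_pos h0 hM0]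
    have hs₂ : √((2 : ℝ) ^ ((n : ℝ) * (R + Rc + ε / 2)) /
        ((indexCard n (R + ε) : ℝ) * indexCard n Rc)) ≤ S n := by
      apply Real.sqrt_le_sqrt
      rw [div_le_iff₀ (mul_pos hM0 hJ0)]
      have e : (2 : ℝ) ^ ((n : ℝ) * (R + Rc + ε / 2)) = (2 : ℝ) ^ (-((n : ℝ) * (ε / 2))) *
          ((2 : ℝ) ^ ((n : ℝ) * (R + ε)) * (2 : ℝ) ^ ((n : ℝ) * Rc)) := by
        rw [← Real.rpow_add (by norm_num), ← Real.rpow_add (by norm_num)]; congr 1; ring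
      have h0 : 0 < (2 : ℝ) ^ (-((n : ℝ) * (ε / 2))) := by positivity
      rw [e, show 4 * (2 : ℝ) ^ (-((n : ℝ) * (ε / 2))) *
        ((indexCard n (R + ε) : ℝ) * indexCard n Rc) = (2 : ℝ) ^ (-((n : ℝ) * (ε / 2))) *
        ((2 * indexCard n (R + ε)) * (2 * indexCard n Rc)) by ring]
      gcongr
    obtain ⟨c, hc⟩ := exists_code_of_mean_le hd hD hdD h hRε hRc hn (ha0 n)
      (a₁ := C₁ / √n + S n) (a₂ := C₂ / √n + S n)
      (by simp only [ha]; rw [add_div]; linarith)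
      (fun s hs => by
        have hsn : s.Nonempty := by
          rw [← Finset.card_pos, hs]; exact indexCard_pos n hRε
        refine (hcov₁ n hn _ s hsn).trans ?_
        rw [hs]
        linarith)
      (by
        have h3 := hcov₂ n hn (Fin (indexCard n (R + ε)) × Fin (indexCard n Rc)) Finset.univ
          Finset.univ_nonempty
        rw [Finset.card_univ, Fintype.card_prod, Fintype.card_fin, Fintype.card_fin,
          Nat.cast_mul] at h3
        linarith)
    exact ⟨c, fun _ => hc⟩
  choose c hc using hcode
  have hsq : Tendsto (fun n => √(a n)) atTop (𝓝 0) := by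
    have := (Real.continuous_sqrt.tendsto 0).comp hlim
    rw [Real.sqrt_zero] at this
    exact this
  have htv : Tendsto (fun n => √(a n) * (Δ + √(a n))) atTop (𝓝 0) := by
    simpa using hsq.mul (hsq.const_add Δ)
  refine ⟨c, ?_, ?_⟩
  · refine limsup_le_of_forall_pos (fun n => distortion_nonneg _ hp hRc hd) fun e he => ?_
    have h1 : Tendsto (fun n => Δ + √(a n) + D * (√(a n) * (Δ + √(a n)))) atTop (𝓝 Δ) := by
      simpa using (hsq.const_add Δ).add (htv.const_mul D)
    filter_upwards [h1.eventually_lt_const (show Δ < Δ + ε + e by linarith),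
      eventually_ge_atTop 1] with n h2 h3
    exact (hc n h3).1.trans h2.le
  · refine tendsto_of_tendsto_of_tendsto_of_le_of_le' tendsto_const_nhds htv
      (Eventually.of_forall fun n => tvDist_nonneg _ _) ?_
    filter_upwards [eventually_ge_atTop 1] with n hn
    exact (hc n hn).2

end RandomCoding

end RDP

end

/-! ### The equivalences and the closure -/

theorem theorem3 {X : Type*} [Fintype X] [Primcodable X]
    (p : X → ℝ) (hp : p ∈ stdSimplex ℝ X) (hp_pos : ∀ x, 0 < p x)
    (hp_comp : RDP.ComputableRealMap p)
    (d : X → X → ℝ) (hd : ∀ x y, 0 ≤ d x y)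
    (B : ℕ → ℕ) (hB_comp : Computable B) (hB_pos : ∀ n, 1 ≤ n → 0 < B n)
    (hB_mono : ∀ m n, 1 ≤ m → m ≤ n → B m ≤ B n)
    (hB_lim : Filter.Tendsto (fun n => (B n : ℝ) / (Fintype.card X : ℝ) ^ n)
      Filter.atTop Filter.atTop) :
    (∀ R Rc Δ : ℝ, 0 < R → 0 ≤ Rc → 0 < Δ →
      (RDP.AchievableAlgorithmic p d R Rc B Δ ↔ RDP.AchievableNearPerfect p d R Rc Δ) ∧
      (RDP.AchievableNearPerfect p d R Rc Δ ↔ RDP.AchievablePerfect p d R Rc Δ)) ∧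
    closure {t : ℝ × ℝ × ℝ | 0 < t.1 ∧ 0 ≤ t.2.1 ∧ 0 < t.2.2 ∧
      RDP.AchievableAlgorithmic p d t.1 t.2.1 B t.2.2} = RDP.region p d := by
  have h_alg_near : ∀ {R Rc Δ : ℝ}, 0 ≤ Rc → RDP.AchievableAlgorithmic p d R Rc B Δ →
      RDP.AchievableNearPerfect p d R Rc Δ := fun hRc h =>
    RDP.achievableNearPerfect_of_algorithmic hp hp_pos hp_comp hB_comp hB_pos hB_mono hB_lim hRc h
  have h_near_perf : ∀ {R Rc Δ : ℝ}, 0 ≤ Rc → RDP.AchievableNearPerfect p d R Rc Δ →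
      RDP.AchievablePerfect p d R Rc Δ := fun hRc h =>
    RDP.achievablePerfect_of_nearPerfect hp hd hRc h
  have h_perf_alg : ∀ {R Rc Δ : ℝ}, 0 ≤ Rc → RDP.AchievablePerfect p d R Rc Δ →
      RDP.AchievableAlgorithmic p d R Rc B Δ := fun hRc h =>
    RDP.achievableAlgorithmic_of_perfect hp hRc hB_pos h
  refine ⟨fun R Rc Δ _ hRc _ => ⟨⟨h_alg_near hRc, fun h => h_perf_alg hRc (h_near_perf hRc h)⟩,
    ⟨h_near_perf hRc, RDP.achievableNearPerfect_of_perfect⟩⟩, ?_⟩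
  apply Set.Subset.antisymm
  · refine closure_minimal ?_ (RDP.isClosed_region hp hp_pos d)
    rintro ⟨R, Rc, Δ⟩ ⟨hR, hRc, -, h⟩
    exact RDP.mem_region_of_achievablePerfect hp hp_pos hR.le hRc
      (h_near_perf hRc (h_alg_near hRc h))
  · rintro ⟨R, Rc, Δ⟩ ht
    obtain ⟨hR, hRc, hΔ⟩ := RDP.region_nonneg hp hp_pos hd ht
    obtain ⟨s, w, q, r, hmix⟩ := RDP.exists_isMixture_of_mem_region hp ht
    simp only at hR hRc hΔ
    -- The region contains points with zero rate or zero distortion; inflating both by `ε` makes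
    -- them positive, hence the closure.
    have hlim : Filter.Tendsto (fun ε : ℝ => (R + ε, Rc, Δ + ε)) (nhdsWithin 0 (Set.Ioi 0))
        (nhds (R, Rc, Δ)) := by
      have hcont : Continuous fun ε : ℝ => (R + ε, Rc, Δ + ε) := by fun_prop
      have := hcont.tendsto 0
      simp only [add_zero] at this
      exact this.mono_left nhdsWithin_le_nhds
    refine mem_closure_of_tendsto hlim (eventually_nhdsWithin_of_forall fun ε hε => ?_)
    have hε' : (0 : ℝ) < ε := hε
    have hmix' : RDP.IsMixture p d w q r (R + ε, Rc, Δ + ε) :=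
      ⟨hmix.w_mem, hmix.q_mem, hmix.r_mem, hmix.q_avg, hmix.r_avg,
        hmix.q_ent.trans (by simp only; linarith), hmix.r_ent.trans (by simp only; linarith),
        hmix.dist_le.trans (by simp only; linarith)⟩
    refine ⟨by simp only; linarith, hRc, by simp only; linarith, ?_⟩
    exact h_perf_alg hRc (h_near_perf hRc
      (hmix'.achievableNearPerfect hp hp_pos hd (by linarith) hRc))
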